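/- Work over $\mathbb{P}^1=\mathbb{P}^1(\mathbb{C})$. Let $\mathcal{O}_{J^*}$ be the sheaf of rings on $\mathbb{P}^1\times\mathbb{P}^1$ of differential equations on local biholomorphisms of $\mathbb{P}^1$: in charts $(x,y)$ it is $\bigcup_k \mathcal{O}_{J^*_k}$ with $\mathcal{O}_{J^*_k}=\mathcal{O}[y_1,y_1^{-1},y_2,\dots,y_k]$ for $k\ge 1$ and $\mathcal{O}_{J_0^*}=\mathcal{O}$, where $\mathcal{O}$ is the sheaf of holomorphic functions of $(x,y)$; it carries the derivation $D=\partial_x+y_1\partial_y+y_2\partial_{y_1}+\cdots$. A $\mathcal{D}$-groupoid of Lie on $\mathbb{P}^1$ is given by a sheaf of ideals $\mathcal{I}\subset\mathcal{O}_{J^*}$, stable under $D$, such that all $\mathcal{I}_k=\mathcal{I}\cap\mathcal{O}_{J^*_k}$ are coherent and such that, for some $k_0$ and some finite set $Z\subset\mathbb{P}^1$, for all $k\ge k_0$: the equations of $\mathcal{I}_k$ vanish on the jets of the identity; $\mathcal{I}_k$ is stable under pullback by the inversion of jets; and near each point $(x,y,z)\in(\mathbb{P}^1\setminus Z)^3$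 the pullback of $\mathcal{I}_k$ by the composition of jets lies in the ideal $\mathcal{I}_k\otimes 1+1\otimes\mathcal{I}_k$ of the functions on pairs of composable jets of order $k$ (polynomial in $y_1^{\pm1},y_2,\dots,y_k,z_1^{\pm1},z_2,\dots,z_k$, with coefficients holomorphic in $(x,y,z)$). A map $R$ is a solution if all equations of $\mathcal{I}$ vanish on the jets of $R$ at the points where $R$ is locally invertible. The $\mathcal{D}$-envelope of a rational map $R$ is the smallest $\mathcal{D}$-groupoid of Lie (the one with the largest ideal) of which $R$ is a solution. A $\mathcal{D}$-groupoid is of type (3) if there is a rational function $\nu$ such that the ideal generated by $\mathcal{I}$ in the sheaf of equations meromorphic in $x$ and in $y$, $\mathcal{M}_{\mathbb{P}^1}\otimes\mathcal{O}_{J^*}\otimes\mathcal{M}_{\mathbb{P}^1}$, is the differential ideal generated by $$\nu(y)\,y_1^2+2\frac{y_3}{y_1}-3\Big(\frac{y_2}{y_1}\Big)^2-\nu(x)=0,$$ where $x$, $y$ are the affine coordinates. \textbf{Lemma.} No rational map $R:\mathbb{P}^1\to\mathbb{P}^1$ has a $\mathcal{D}$-envelope of type (3). -/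

import Mathlib

open scoped Topology
open TopologicalSpace Filter

noncomputable section

namespace JetP1

/-! ### The projective line and its two standard charts -/

/-- The complex projective line. -/
abbrev P1 : Type := OnePoint ℂ

/-- The two standard charts of the projective line: the coordinate `x` away from `∞`
and the coordinate `1 / x` away from `0`. -/
inductive Chart : Type
  | affine
  | infinity

/-- The domain of a chart. -/
def Chart.dom : Chart → Set P1
  | .affine => {a | a ≠ OnePoint.infty}
  | .infinity => {a | a ≠ ((0 : ℂ) : P1)}

/-- The coordinate function of a chart (with an irrelevant value outside its domain). -/
def Chart.coord : Chart → P1 → ℂ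
  | .affine => fun a => a.elim 0 id
  | .infinity => fun a => a.elim 0 (fun z : ℂ => z⁻¹)

/-- The parametrization of the domain of a chart, inverse to the coordinate function. -/
def Chart.par : Chart → ℂ → P1
  | .affine => fun z => (z : P1)
  | .infinity => fun w => if w = 0 then OnePoint.infty else ((w⁻¹ : ℂ) : P1)

/-- The map of the projective line to itself induced by a rational fraction. -/
def ratMap (R : RatFunc ℂ) : P1 → P1 := fun a =>
  a.elim
    (if R.denom.natDegree < R.num.natDegree then OnePoint.infty
      else ((R.num.coeff R.denom.natDegree / R.denom.leadingCoeff : ℂ) : P1))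
    (fun z : ℂ => if R.denom.eval z = 0 then OnePoint.infty
      else ((R.num.eval z / R.denom.eval z : ℂ) : P1))

/-! ### Jets of invertible maps -/

/-- The expression of a map in charts `i` (source) and `j` (target). -/
def inCharts (i j : Chart) (f : P1 → P1) : ℂ → ℂ := fun z => j.coord (f (i.par z))

/-- `f` is holomorphic and locally invertible at `a`. -/
def IsLocalBihol (f : P1 → P1) (a : P1) : Prop :=
  ∃ i j : Chart, a ∈ i.dom ∧ f a ∈ j.dom ∧
    AnalyticAt ℂ (inCharts i j f) (i.coord a) ∧ deriv (inCharts i j f) (i.coord a) ≠ 0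

/-- The fibre coordinates of the jet of `f` at `a`, in charts `i`, `j`: entry `n ≥ 1` is
`y_n`, the `n`-th derivative, and entry `0` is the inverse `1 / y_1`. -/
def jetCoord (i j : Chart) (f : P1 → P1) (a : P1) : ℕ → ℂ
  | 0 => (deriv (inCharts i j f) (i.coord a))⁻¹
  | n + 1 => iteratedDeriv (n + 1) (inCharts i j f) (i.coord a)

/-- Near the point `p` of `P1 × P1` and in the charts `i`, `j`, the function `E` of jets is
an element of `𝒪[y_1, 1 / y_1, y_2, …, y_k]`, with `𝒪` the holomorphic functions of
`(x, y)`. (For `k = 0` neither `y_1` nor `1 / y_1` may occur.) The value `E f a` is the value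
at the jet of `f` at `a`; every jet of finite order of an invertible map is the jet of such an
`f`, so an expression is determined by these values. -/
def HasJetExpr (k : ℕ) (i j : Chart) (p : P1 × P1) (E : (P1 → P1) → P1 → ℂ) : Prop :=
  ∃ Q : MvPolynomial ℕ (ℂ × ℂ → ℂ),
    (∀ n ∈ Q.vars, n ≤ k ∧ 1 ≤ k) ∧
    (∀ m, AnalyticAt ℂ (Q.coeff m) (i.coord p.1, j.coord p.2)) ∧
    ∀ᶠ q in 𝓝 p, ∀ f a, (a, f a) = q → IsLocalBihol f a →
      E f a = Q.eval₂ (Pi.evalRingHom (fun _ : ℂ × ℂ => ℂ) (i.coord a, j.coord (f a)))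
        (jetCoord i j f a)

/-- The germs of invertible maps `(f, a)` with `(a, f a) ∈ W`. -/
abbrev GermsOver (W : Opens (P1 × P1)) : Type :=
  {γ : (P1 → P1) × P1 // IsLocalBihol γ.1 γ.2 ∧ (γ.2, γ.1 γ.2) ∈ W}

open Classical in
/-- The value of a function on `GermsOver W` at the germ of `f` at `a` (zero when this germ is
not invertible or does not lie over `W`). -/
def valueAt {W : Opens (P1 × P1)} (E : GermsOver W → ℂ) (f : P1 → P1) (a : P1) : ℂ :=
  if h : IsLocalBihol f a ∧ (a, f a) ∈ W then E ⟨(f, a), h⟩ else 0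

/-- `E` is a differential equation of order at most `k` over `W`. -/
def IsOfOrder {W : Opens (P1 × P1)} (k : ℕ) (E : GermsOver W → ℂ) : Prop :=
  ∀ p ∈ W, ∀ i j : Chart, p.1 ∈ i.dom → p.2 ∈ j.dom → HasJetExpr k i j p (valueAt E)

/-- `E` is a differential equation over `W`: it is locally of finite order. -/
def IsDiffEq {W : Opens (P1 × P1)} (E : GermsOver W → ℂ) : Prop :=
  ∀ p ∈ W, ∀ i j : Chart, p.1 ∈ i.dom → p.2 ∈ j.dom → ∃ k, HasJetExpr k i j p (valueAt E)

theorem HasJetExpr.mono {k l : ℕ} (hkl : k ≤ l) {i j : Chart} {p : P1 × P1}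
    {E : (P1 → P1) → P1 → ℂ} (h : HasJetExpr k i j p E) : HasJetExpr l i j p E := by
  obtain ⟨Q, h1, h2, h3⟩ := h
  exact ⟨Q, fun n hn => ⟨(h1 n hn).1.trans hkl, (h1 n hn).2.trans hkl⟩, h2, h3⟩

theorem HasJetExpr.add {k : ℕ} {i j : Chart} {p : P1 × P1} {E F G : (P1 → P1) → P1 → ℂ}
    (hE : HasJetExpr k i j p E) (hF : HasJetExpr k i j p F)
    (hG : ∀ f a, G f a = E f a + F f a) : HasJetExpr k i j p G := by
  classical
  obtain ⟨Q, h1, h2, h3⟩ := hE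
  obtain ⟨Q', h1', h2', h3'⟩ := hF
  refine ⟨Q + Q', ?_, ?_, ?_⟩
  · intro n hn
    rcases Finset.mem_union.1 (MvPolynomial.vars_add_subset _ _ hn) with h | h
    exacts [h1 n h, h1' n h]
  · intro m
    rw [MvPolynomial.coeff_add]
    exact (h2 m).add (h2' m)
  · filter_upwards [h3, h3'] with q hq hq' f a hfa hb
    rw [hG, hq f a hfa hb, hq' f a hfa hb, MvPolynomial.eval₂_add]

theorem HasJetExpr.mul {k : ℕ} {i j : Chart} {p : P1 × P1} {E F G : (P1 → P1) → P1 → ℂ}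
    (hE : HasJetExpr k i j p E) (hF : HasJetExpr k i j p F)
    (hG : ∀ f a, G f a = E f a * F f a) : HasJetExpr k i j p G := by
  classical
  obtain ⟨Q, h1, h2, h3⟩ := hE
  obtain ⟨Q', h1', h2', h3'⟩ := hF
  refine ⟨Q * Q', ?_, ?_, ?_⟩
  · intro n hn
    rcases Finset.mem_union.1 (MvPolynomial.vars_mul _ _ hn) with h | h
    exacts [h1 n h, h1' n h]
  · intro m
    rw [MvPolynomial.coeff_mul]
    exact Finset.analyticAt_sum _ fun x _ => (h2 x.1).mul (h2' x.2)
  · filter_upwards [h3, h3'] with q hq hq' f a hfa hb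
    rw [hG, hq f a hfa hb, hq' f a hfa hb, MvPolynomial.eval₂_mul]

theorem hasJetExpr_const (c : ℂ) {i j : Chart} {p : P1 × P1} {E : (P1 → P1) → P1 → ℂ}
    (h : ∀ᶠ q in 𝓝 p, ∀ f a, (a, f a) = q → IsLocalBihol f a → E f a = c) :
    HasJetExpr 0 i j p E := by
  classical
  refine ⟨MvPolynomial.C (fun _ => c), by simp, ?_, ?_⟩
  · intro m
    rw [MvPolynomial.coeff_C]
    split_ifs
    · exact analyticAt_const
    · exact analyticAt_const
  · filter_upwards [h] with q hq f a hfa hb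
    rw [hq f a hfa hb, MvPolynomial.eval₂_C]
    rfl

theorem eventually_valueAt_const {W : Opens (P1 × P1)} {p : P1 × P1} (hp : p ∈ W) (c : ℂ) :
    ∀ᶠ q in 𝓝 p, ∀ f a, (a, f a) = q → IsLocalBihol f a →
      valueAt (W := W) (fun _ => c) f a = c := by
  filter_upwards [W.isOpen.mem_nhds hp] with q hq f a hfa hb
  subst hfa
  simp only [valueAt]
  rw [dif_pos ⟨hb, hq⟩]

theorem valueAt_add {W : Opens (P1 × P1)} (E F : GermsOver W → ℂ) (f : P1 → P1) (a : P1) :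
    valueAt (E + F) f a = valueAt E f a + valueAt F f a := by
  simp only [valueAt]
  split_ifs <;> simp

theorem valueAt_mul {W : Opens (P1 × P1)} (E F : GermsOver W → ℂ) (f : P1 → P1) (a : P1) :
    valueAt (E * F) f a = valueAt E f a * valueAt F f a := by
  simp only [valueAt]
  split_ifs <;> simp

theorem IsDiffEq.add {W : Opens (P1 × P1)} {E F : GermsOver W → ℂ}
    (hE : IsDiffEq E) (hF : IsDiffEq F) : IsDiffEq (E + F) := by
  intro p hp i j hi hj
  obtain ⟨k, hk⟩ := hE p hp i j hi hj
  obtain ⟨l, hl⟩ := hF p hp i j hi hj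
  exact ⟨max k l, (hk.mono (le_max_left _ _)).add (hl.mono (le_max_right _ _))
    (valueAt_add E F)⟩

theorem IsDiffEq.mul {W : Opens (P1 × P1)} {E F : GermsOver W → ℂ}
    (hE : IsDiffEq E) (hF : IsDiffEq F) : IsDiffEq (E * F) := by
  intro p hp i j hi hj
  obtain ⟨k, hk⟩ := hE p hp i j hi hj
  obtain ⟨l, hl⟩ := hF p hp i j hi hj
  exact ⟨max k l, (hk.mono (le_max_left _ _)).mul (hl.mono (le_max_right _ _))
    (valueAt_mul E F)⟩

theorem isDiffEq_const {W : Opens (P1 × P1)} (c : ℂ) :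
    IsDiffEq (W := W) (fun _ => c) := fun _ hp _ _ _ _ =>
  ⟨0, hasJetExpr_const c (eventually_valueAt_const hp c)⟩

/-- The ring of sections over `W` of the sheaf of differential equations on invertible maps
of the projective line. -/
def DiffEq (W : Opens (P1 × P1)) : Subring (GermsOver W → ℂ) where
  carrier := {E | IsDiffEq E}
  mul_mem' := IsDiffEq.mul
  one_mem' := isDiffEq_const 1
  add_mem' := IsDiffEq.add
  zero_mem' := isDiffEq_const 0
  neg_mem' := by
    intro E hE
    have h : -E = (fun _ => (-1 : ℂ)) * E := by
      funext γ
      simp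
    change IsDiffEq (-E)
    rw [h]
    exact (isDiffEq_const (-1)).mul hE

/-- Restriction of functions to a smaller open set. -/
def resFun {V W : Opens (P1 × P1)} (h : V ≤ W) (E : GermsOver W → ℂ) : GermsOver V → ℂ :=
  fun γ => E ⟨γ.1, γ.2.1, h γ.2.2⟩

theorem IsDiffEq.res {V W : Opens (P1 × P1)} (h : V ≤ W) {E : GermsOver W → ℂ}
    (hE : IsDiffEq E) : IsDiffEq (resFun h E) := by
  intro p hp i j hi hj
  obtain ⟨k, Q, h1, h2, h3⟩ := hE p (h hp) i j hi hj
  refine ⟨k, Q, h1, h2, ?_⟩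
  filter_upwards [h3, V.isOpen.mem_nhds hp] with q hq hqV f a hfa hb
  rw [← hq f a hfa hb]
  subst hfa
  simp only [valueAt]
  rw [dif_pos ⟨hb, hqV⟩, dif_pos ⟨hb, h hqV⟩]
  rfl

/-- Restriction of differential equations to a smaller open set. -/
def res {V W : Opens (P1 × P1)} (h : V ≤ W) (E : DiffEq W) : DiffEq V :=
  ⟨resFun h E.1, IsDiffEq.res h E.2⟩

/-! ### Sheaves of ideals -/

/-- A sheaf of ideals of the sheaf of rings `DiffEq`. -/
structure IdealSheaf : Type where
  /-- the ideal of sections over an open set -/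
  sections : ∀ W : Opens (P1 × P1), Ideal (DiffEq W)
  res_mem : ∀ {V W : Opens (P1 × P1)} (h : V ≤ W) (E : DiffEq W),
    E ∈ sections W → res h E ∈ sections V
  mem_of_locally : ∀ {W : Opens (P1 × P1)} (E : DiffEq W),
    (∀ p ∈ W, ∃ (V : Opens (P1 × P1)) (h : V ≤ W), p ∈ V ∧ res h E ∈ sections V) →
      E ∈ sections W

namespace IdealSheaf

/-- `E` is a section over `W` of `I_k`, the intersection of `I` with the equations of order at
most `k`. -/
def MemOrder (I : IdealSheaf) (k : ℕ) {W : Opens (P1 × P1)} (E : DiffEq W) : Prop :=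
  E ∈ I.sections W ∧ IsOfOrder k E.1

/-- `I_k` is coherent. The sheaf of rings of equations of order at most `k` being coherent,
this means that its ideal sheaf `I_k` is locally generated by finitely many sections. -/
def IsCoherentAtOrder (I : IdealSheaf) (k : ℕ) : Prop :=
  ∀ p : P1 × P1, ∃ W : Opens (P1 × P1), p ∈ W ∧ ∃ (n : ℕ) (g : Fin n → DiffEq W),
    (∀ m, I.MemOrder k (g m)) ∧
    ∀ (V : Opens (P1 × P1)) (hV : V ≤ W) (E : DiffEq V), I.MemOrder k E → ∀ q ∈ V,
      ∃ (U : Opens (P1 × P1)) (hU : U ≤ V) (c : Fin n → DiffEq U), q ∈ U ∧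
        (∀ m, IsOfOrder k (c m).1) ∧
        res hU E = ∑ m, c m * res (hU.trans hV) (g m)

/-- `I` is stable under the derivation `D = ∂/∂x + y_1 ∂/∂y + y_2 ∂/∂y_1 + ⋯`, where `x` is
either of the two standard coordinates on the source. The value of `D E` at the jet of `f`
at `a` is the derivative at `a` of the value of `E` along the jets of `f`. -/
def IsDifferential (I : IdealSheaf) : Prop :=
  ∀ (i : Chart) (W : Opens (P1 × P1)), (∀ q ∈ W, q.1 ∈ i.dom) → ∀ E ∈ I.sections W,
    ∃ F ∈ I.sections W, ∀ f a, IsLocalBihol f a → (a, f a) ∈ W →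
      valueAt F.1 f a = deriv (fun t : ℂ => valueAt E.1 f (i.par t)) (i.coord a)

/-- `I_k` lies in the kernel of `e^*`, with `e` the identity section of the groupoid of jets. -/
def ContainsIdentity (I : IdealSheaf) (k : ℕ) : Prop :=
  ∀ (W : Opens (P1 × P1)) (E : DiffEq W), I.MemOrder k E → ∀ a : P1, (a, a) ∈ W →
    valueAt E.1 id a = 0

/-- `i^* I_k ⊆ I_k`, with `i` the inversion of the groupoid of jets. -/
def IsInvStable (I : IdealSheaf) (k : ℕ) : Prop :=
  ∀ (W : Opens (P1 × P1)) (E : DiffEq W), I.MemOrder k E →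
    ∃ F : DiffEq (Opens.comap ⟨Prod.swap, continuous_swap⟩ W), I.MemOrder k F ∧
      ∀ (f g : P1 → P1) (a : P1), IsLocalBihol f a → IsLocalBihol g (f a) →
        (∀ᶠ b in 𝓝 a, g (f b) = b) → (f a, a) ∈ W →
          valueAt F.1 f a = valueAt E.1 g (f a)

end IdealSheaf

/-- Near the point `(x, y, z)`, the function `A` of pairs of composable jets of order `k`
(`A f g a` is its value at the jets of `f` at `a` and of `g` at `f a`) is polynomial in
`y_1, 1 / y_1, y_2, …, y_k, z_1, 1 / z_1, z_2, …, z_k`, with coefficients holomorphic in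
`(x, y, z)`. -/
def IsPairFunction (k : ℕ) (x y z : P1) (A : (P1 → P1) → (P1 → P1) → P1 → ℂ) : Prop :=
  ∀ i j l : Chart, x ∈ i.dom → y ∈ j.dom → z ∈ l.dom →
    ∃ Q : MvPolynomial (ℕ ⊕ ℕ) (ℂ × ℂ × ℂ → ℂ),
      (∀ n, Sum.inl n ∈ Q.vars ∨ Sum.inr n ∈ Q.vars → n ≤ k ∧ 1 ≤ k) ∧
      (∀ m, AnalyticAt ℂ (Q.coeff m) (i.coord x, j.coord y, l.coord z)) ∧
      ∀ᶠ q in 𝓝 (x, y, z), ∀ f g a, (a, f a, g (f a)) = q →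
        IsLocalBihol f a → IsLocalBihol g (f a) →
          A f g a = Q.eval₂
            (Pi.evalRingHom (fun _ : ℂ × ℂ × ℂ => ℂ)
              (i.coord a, j.coord (f a), l.coord (g (f a))))
            (Sum.elim (jetCoord i j f a) (jetCoord j l g (f a)))

/-- `c^* I_k ⊆ I_k ⊗ 1 + 1 ⊗ I_k` near `(x, y, z)`, with `c` the composition of jets: the pullback
`c^* E`, whose value at the jets of `f` and `g` is that of `E` at the jet of `g ∘ f`, lies in the
ideal generated by the equations of `I_k` on the first jet and those on the second jet. -/
def IdealSheaf.IsCompStableAt (I : IdealSheaf) (k : ℕ) (x y z : P1) : Prop :=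
  ∀ (W : Opens (P1 × P1)) (E : DiffEq W), I.MemOrder k E → (x, z) ∈ W →
    ∃ (W₁ W₂ : Opens (P1 × P1)) (n : ℕ) (E₁ : Fin n → DiffEq W₁) (E₂ : Fin n → DiffEq W₂)
      (A B : Fin n → (P1 → P1) → (P1 → P1) → P1 → ℂ),
      (x, y) ∈ W₁ ∧ (y, z) ∈ W₂ ∧
      (∀ m, I.MemOrder k (E₁ m) ∧ I.MemOrder k (E₂ m) ∧
        IsPairFunction k x y z (A m) ∧ IsPairFunction k x y z (B m)) ∧
      ∀ᶠ q in 𝓝 (x, y, z), ∀ f g a, (a, f a, g (f a)) = q →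
        IsLocalBihol f a → IsLocalBihol g (f a) →
          valueAt E.1 (g ∘ f) a =
            ∑ m, (A m f g a * valueAt (E₁ m).1 f a + B m f g a * valueAt (E₂ m).1 g (f a))

/-- `I` is the ideal of a `D`-groupoid of Lie on the projective line. The proper closed analytic
subsets `Z` of the projective line are its finite subsets. -/
structure IsDGroupoid (I : IdealSheaf) : Prop where
  coherent : ∀ k, I.IsCoherentAtOrder k
  differential : I.IsDifferential
  groupoid : ∃ (k : ℕ) (Z : Set P1), Z.Finite ∧ ∀ l, k ≤ l →
    I.ContainsIdentity l ∧ I.IsInvStable l ∧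
    ∀ x y z, x ∉ Z → y ∉ Z → z ∉ Z → I.IsCompStableAt l x y z

/-- The map `f` is a solution of `I`: all equations of `I` vanish at the jets of `f` at all
points where `f` is locally invertible. -/
def IsSolution (f : P1 → P1) (I : IdealSheaf) : Prop :=
  ∀ (W : Opens (P1 × P1)), ∀ E ∈ I.sections W, ∀ a, IsLocalBihol f a → (a, f a) ∈ W →
    valueAt E.1 f a = 0

/-- `I` is the ideal of the `D`-envelope of `f`: the smallest `D`-groupoid of Lie (the one with
the largest ideal) of which `f` is a solution. -/
def IsDEnvelope (f : P1 → P1) (I : IdealSheaf) : Prop :=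
  IsDGroupoid I ∧ IsSolution f I ∧
    ∀ I' : IdealSheaf, IsDGroupoid I' → IsSolution f I' →
      ∀ W, I'.sections W ≤ I.sections W

/-! ### Equations of type (3) -/

/-- The value `ν(y) y_1² + 2 y_3 / y_1 - 3 (y_2 / y_1)² - ν(x)` at the jet of `φ` at `x`. -/
def schwarzEq (ν : RatFunc ℂ) (φ : ℂ → ℂ) (x : ℂ) : ℂ :=
  ν.eval (RingHom.id ℂ) (φ x) * deriv φ x ^ 2
    + 2 * (iteratedDeriv 3 φ x / deriv φ x)
    - 3 * (iteratedDeriv 2 φ x / deriv φ x) ^ 2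
    - ν.eval (RingHom.id ℂ) x

/-- `s` is a nonzero germ of holomorphic function at `a`. -/
def IsNonzeroGerm (s : P1 → ℂ) (a : P1) : Prop :=
  ∃ i : Chart, a ∈ i.dom ∧ AnalyticAt ℂ (fun w => s (i.par w)) (i.coord a) ∧
    ¬ ∀ᶠ b in 𝓝 a, s b = 0

/-- `a` is a point of the affine line which is not a pole of `ν`. -/
def IsRegularPoint (ν : RatFunc ℂ) (a : P1) : Prop :=
  ∃ z : ℂ, a = (z : P1) ∧ ν.denom.eval z ≠ 0

/-- The `n`-th derivative `Dⁿ` of the equation `schwarzEq ν`, at the jet of `f` at `a`, where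
`D` is the derivation for the affine coordinate `x` of the source. -/
def schwarzDeriv (ν : RatFunc ℂ) (n : ℕ) (f : P1 → P1) (a : P1) : ℂ :=
  iteratedDeriv n (schwarzEq ν (inCharts .affine .affine f)) (Chart.affine.coord a)

/-- `I` is of type (3), with rational function `ν`: the ideal generated by `I` in the sheaf of
equations which are meromorphic in `x` and in `y` is generated by the equation `schwarzEq ν`
and its derivatives. As `s(x) t(y)`, with `s` and `t` nonzero germs of holomorphic functions,
runs over the possible denominators, this reads near every point `p` of `P1 × P1`:
* every equation of `I` is, up to a factor `s(x) t(y)`, a combination of the derivatives of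
  `schwarzEq ν`;
* every derivative of `schwarzEq ν` is, up to a factor `s(x) t(y)`, an equation of `I`.
The identities hold at all jets where both sides are defined. -/
def IsTypeThree (I : IdealSheaf) (ν : RatFunc ℂ) : Prop :=
  ∀ p : P1 × P1,
    (∀ W : Opens (P1 × P1), p ∈ W → ∀ E ∈ I.sections W,
      ∃ s t : P1 → ℂ, IsNonzeroGerm s p.1 ∧ IsNonzeroGerm t p.2 ∧
      ∃ V : Opens (P1 × P1), p ∈ V ∧ V ≤ W ∧ ∃ (N : ℕ) (A : Fin N → DiffEq V),
        ∀ f a, IsLocalBihol f a → (a, f a) ∈ V →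
          IsRegularPoint ν a → IsRegularPoint ν (f a) →
          s a * t (f a) * valueAt E.1 f a =
            ∑ m : Fin N, valueAt (A m).1 f a * schwarzDeriv ν m f a) ∧
    (∀ n : ℕ,
      ∃ s t : P1 → ℂ, IsNonzeroGerm s p.1 ∧ IsNonzeroGerm t p.2 ∧
      ∃ V : Opens (P1 × P1), p ∈ V ∧ ∃ F ∈ I.sections V,
        ∀ f a, IsLocalBihol f a → (a, f a) ∈ V →
          IsRegularPoint ν a → IsRegularPoint ν (f a) →
          valueAt F.1 f a = s a * t (f a) * schwarzDeriv ν n f a)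

end JetP1

end

/-! Suppose that the $\mathcal{D}$-envelope $\mathcal{I}$ of $R$ is of type (3). As $R$ is a
solution, $\nu(R)R'^2+2R'''/R'-3(R''/R')^2=\nu$ (`isInvariantBy_of_isTypeThree`): $R$ preserves the
meromorphic projective connection $\nu$. It then preserves something finer, a meromorphic affine
structure: there is a rational $\mu$ with $\mu(R)R'^2+R''=\mu R'$ (`exists_connection`). The maps
preserving $\mu$ form a $\mathcal{D}$-groupoid of which $R$ is a solution, so by maximality of
$\mathcal{I}$ all its equations lie in $\mathcal{I}$. Among them is $\mu(y)y_1^2+y_2-\mu(x)y_1$, of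
order two. But the equation of type (3) only determines $y_3$ and leaves the jet of order two free,
so it has no such consequence (`not_isTypeThree_of_le`).

Existence of $\mu$. For $R$ of degree $d\ge 2$, a pole of $\nu$ of order $2+n$ with $n>0$ pulls back
by ramification $e$ to a pole of order $2+en$. Summing over fibres, the total excess $N$ satisfies
$dN\le N$, so $\nu$ has at most double poles, also at infinity (`connOrd_nonneg`). If $c_v$ is the
coefficient of the double pole at $v$, invariance reads $1-c_v=e^2(1-c_{R(v)})$, so
$\theta_v=\sqrt{1-c_v}$ satisfies $\theta_v=e\,\theta_{R(v)}$ (`exists_weights`). Take for $\mu$ the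
connection with residues $\theta_b-1$, whose flat coordinates behave like $(x-b)^{\theta_b}$. The
defect of invariance of $\mu$ is a combination of logarithmic derivatives of polynomials; its
residues are zero by the relation between the $\theta$, so it vanishes (`sum_logD_eq_zero`). A map
of degree one has a fixed point, and becomes affine when that point is sent to infinity. A constant
map satisfies the equation for every $\mu$.

The groupoid of $\mu$. Its ideal consists of the equations which vanish on all local biholomorphisms
that preserve $\mu$ between regular points (`idealSheaf`). Stability under $D$ and inversion and
vanishing on the identity come from the solutions, continuity along jets taking care of the singular
points. The other facts rest on two properties of solutions: on them every $y_n$ is an expression in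
$x$, $y$, $y_1$ whose only denominator is a power of the denominator of $\mu$, and every jet of
order one between regular points is the jet of a solution. They give stability under composition
(`idealSheaf_isCompStableAt`). For coherence, notably at the poles of $\mu$, the ideal is shown to
be generated near each point by the finitely many generators of an ideal of polynomials
(`anSolIdeal_map_le`); a flatness argument removes the denominators. -/

open scoped Topology
open TopologicalSpace Filter

noncomputable section

namespace JetP1

/-! ### Charts of the projective line -/

/-- The change of coordinates between two charts. -/
def trans : Chart → Chart → ℂ → ℂ
  | .affine, .affine => id
  | .infinity, .infinity => id
  | .affine, .infinity => fun z => z⁻¹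
  | .infinity, .affine => fun z => z⁻¹

theorem Chart.par_mem (i : Chart) (z : ℂ) : i.par z ∈ i.dom := by
  cases i
  · simp [Chart.par, Chart.dom]
  · simp only [Chart.par, Chart.dom]
    split_ifs with h
    · simp
    · simpa using h

theorem Chart.coord_par' (i j : Chart) (z : ℂ) : j.coord (i.par z) = trans i j z := by
  cases i <;> cases j <;> simp only [Chart.par, Chart.coord, trans]
  · rfl
  · rfl
  · split_ifs with h
    · simp [h]
    · rfl
  · split_ifs with h
    · simp [h]
    · exact inv_inv z

theorem Chart.coord_par (i : Chart) (z : ℂ) : i.coord (i.par z) = z := by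
  rw [Chart.coord_par']
  cases i <;> rfl

theorem Chart.par_coord (i : Chart) {a : P1} (ha : a ∈ i.dom) : i.par (i.coord a) = a := by
  cases i <;> induction a using OnePoint.rec
  · simp [Chart.dom] at ha
  · rfl
  · simp [Chart.par, Chart.coord]
  · rename_i z
    have hz : z ≠ 0 := by
      intro h
      exact ha (by rw [h])
    have h1 : Chart.infinity.coord (z : P1) = z⁻¹ := rfl
    simp [h1, Chart.par, hz]

theorem Chart.exists_mem (a : P1) : ∃ i : Chart, a ∈ i.dom := by
  by_cases h : a = OnePoint.infty
  · refine ⟨.infinity, ?_⟩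
    subst h
    simp [Chart.dom]
  · exact ⟨.affine, h⟩

theorem Chart.isOpen_dom (i : Chart) : IsOpen i.dom := by
  cases i
  · exact isOpen_ne
  · exact isOpen_ne

theorem Chart.continuous_par (i : Chart) : Continuous i.par := by
  cases i
  · exact OnePoint.continuous_coe
  · rw [continuous_iff_continuousAt]
    intro w
    by_cases hw : w = 0
    · subst hw
      have h1 : Tendsto (fun w : ℂ => ((w⁻¹ : ℂ) : P1)) (𝓝[≠] 0) (𝓝 OnePoint.infty) := by
        have := OnePoint.tendsto_coe_infty (X := ℂ)
        rw [Filter.coclosedCompact_eq_cocompact, ← Metric.cobounded_eq_cocompact] at this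
        exact this.comp tendsto_inv₀_nhdsNE_zero
      rw [continuousAt_iff_punctured_nhds]
      have h2 : Chart.infinity.par 0 = OnePoint.infty := by simp [Chart.par]
      rw [h2]
      refine h1.congr' ?_
      filter_upwards [self_mem_nhdsWithin] with w hw
      have : w ≠ 0 := hw
      simp [Chart.par, this]
    · have h1 : ContinuousAt (fun w : ℂ => ((w⁻¹ : ℂ) : P1)) w :=
        OnePoint.continuous_coe.continuousAt.comp (continuousAt_inv₀ hw)
      refine h1.congr ?_
      filter_upwards [isOpen_ne.mem_nhds hw] with w hw
      have : w ≠ 0 := hw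
      simp [Chart.par, this]

theorem Chart.continuousAt_coord (i : Chart) {a : P1} (ha : a ∈ i.dom) :
    ContinuousAt i.coord a := by
  cases i <;> induction a using OnePoint.rec
  · simp [Chart.dom] at ha
  · rw [OnePoint.continuousAt_coe]
    exact continuousAt_id
  · rw [OnePoint.continuousAt_infty', Filter.coclosedCompact_eq_cocompact,
      ← Metric.cobounded_eq_cocompact]
    exact tendsto_inv₀_cobounded
  · rename_i z
    have hz : z ≠ 0 := by
      intro h
      exact ha (by rw [h])
    rw [OnePoint.continuousAt_coe]
    exact continuousAt_inv₀ hz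

theorem Chart.map_par_nhds (i : Chart) {a : P1} (ha : a ∈ i.dom) :
    Filter.map i.par (𝓝 (i.coord a)) = 𝓝 a := by
  apply le_antisymm
  · have := i.continuous_par.continuousAt (x := i.coord a)
    rwa [ContinuousAt, i.par_coord ha] at this
  · intro s hs
    have h1 := i.continuousAt_coord ha hs
    filter_upwards [h1, i.isOpen_dom.mem_nhds ha] with b hb hbd
    have : i.par (i.coord b) ∈ s := hb
    rwa [i.par_coord hbd] at this

theorem Chart.eventually_par (i : Chart) {a : P1} (ha : a ∈ i.dom) {q : P1 → Prop}
    (h : ∀ᶠ b in 𝓝 a, q b) : ∀ᶠ t in 𝓝 (i.coord a), q (i.par t) := by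
  rw [← i.map_par_nhds ha] at h
  exact h

theorem Chart.eventually_of_par (i : Chart) {a : P1} (ha : a ∈ i.dom) {q : P1 → Prop}
    (h : ∀ᶠ t in 𝓝 (i.coord a), q (i.par t)) : ∀ᶠ b in 𝓝 a, q b := by
  rw [← i.map_par_nhds ha]
  exact h

theorem trans_coord (i j : Chart) {a : P1} (hi : a ∈ i.dom) :
    trans i j (i.coord a) = j.coord a := by
  rw [← Chart.coord_par', i.par_coord hi]

theorem trans_self (i : Chart) : trans i i = id := by
  cases i <;> rfl

theorem ne_zero_of_mem_dom {i j : Chart} (hij : i ≠ j) {z : ℂ} (h : i.par z ∈ j.dom) : z ≠ 0 := by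
  rintro rfl
  cases i <;> cases j <;> simp_all [Chart.par, Chart.dom]

theorem trans_of_ne {i j : Chart} (hij : i ≠ j) : trans i j = fun z => z⁻¹ := by
  cases i <;> cases j <;> first | rfl | exact absurd rfl hij

theorem analyticAt_trans {i j : Chart} {z : ℂ} (h : i.par z ∈ j.dom) :
    AnalyticAt ℂ (trans i j) z := by
  by_cases hij : i = j
  · subst hij
    rw [trans_self]
    exact analyticAt_id
  · rw [trans_of_ne hij]
    exact analyticAt_inv (ne_zero_of_mem_dom hij h)

theorem deriv_trans_ne_zero {i j : Chart} {z : ℂ} (h : i.par z ∈ j.dom) :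
    deriv (trans i j) z ≠ 0 := by
  by_cases hij : i = j
  · subst hij
    rw [trans_self, deriv_id]
    exact one_ne_zero
  · rw [trans_of_ne hij]
    have := ne_zero_of_mem_dom hij h
    simp [this]

theorem mem_dom_par_trans (i j : Chart) {z : ℂ} (h : i.par z ∈ j.dom) :
    j.par (trans i j z) = i.par z := by
  rw [← Chart.coord_par', j.par_coord h]

/-! ### Local biholomorphisms -/

theorem inCharts_par (i j : Chart) (f : P1 → P1) {a : P1} (ha : a ∈ i.dom) :
    inCharts i j f (i.coord a) = j.coord (f a) := by
  rw [inCharts, i.par_coord ha]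

theorem coord_eq_zero_of_not_mem {j : Chart} {b : P1} (hb : b ∉ j.dom) : j.coord b = 0 := by
  cases j
  · have : b = OnePoint.infty := by simpa [Chart.dom] using hb
    subst this
    rfl
  · have : b = ((0 : ℂ) : P1) := by simpa [Chart.dom] using hb
    subst this
    exact inv_zero

section LocalBihol

variable {i j : Chart} {f : P1 → P1} {a : P1}

/-- Outside its domain the coordinate takes the default value `0`. A function with nonzero
derivative at a point avoids the value `0` at the other nearby points, so a nearby image cannot lie
outside the chart. No continuity of `f` is assumed; it is deduced from this. -/
theorem eventually_mem_dom_of_inCharts (ha : a ∈ i.dom) (hfa : f a ∈ j.dom)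
    (hA : AnalyticAt ℂ (inCharts i j f) (i.coord a))
    (hd : deriv (inCharts i j f) (i.coord a) ≠ 0) : ∀ᶠ b in 𝓝 a, f b ∈ j.dom := by
  have h1 : ∀ᶠ t in 𝓝[≠] (i.coord a), inCharts i j f t ≠ 0 :=
    hA.differentiableAt.hasDerivAt.eventually_ne hd
  rw [eventually_nhdsWithin_iff] at h1
  refine i.eventually_of_par ha ?_
  filter_upwards [h1] with t ht
  by_cases hta : t = i.coord a
  · rw [hta, i.par_coord ha]
    exact hfa
  · by_contra hn
    exact ht hta (coord_eq_zero_of_not_mem hn)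

theorem continuousAt_of_inCharts (ha : a ∈ i.dom) (hfa : f a ∈ j.dom)
    (hA : AnalyticAt ℂ (inCharts i j f) (i.coord a))
    (hd : deriv (inCharts i j f) (i.coord a) ≠ 0) : ContinuousAt f a := by
  have h1 : ContinuousAt (fun b => j.par (inCharts i j f (i.coord b))) a :=
    j.continuous_par.continuousAt.comp (hA.continuousAt.comp (i.continuousAt_coord ha))
  refine h1.congr ?_
  filter_upwards [eventually_mem_dom_of_inCharts ha hfa hA hd, i.isOpen_dom.mem_nhds ha]
    with b hb hbi
  rw [inCharts_par i j f hbi, j.par_coord hb]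

theorem inCharts_trans_eventuallyEq (ha : a ∈ i.dom) (hfa : f a ∈ j.dom)
    (hf : ContinuousAt f a) {i' j' : Chart} (ha' : a ∈ i'.dom) :
    inCharts i' j' f =ᶠ[𝓝 (i'.coord a)] trans j j' ∘ inCharts i j f ∘ trans i' i := by
  have h1 : ∀ᶠ b in 𝓝 a, f b ∈ j.dom := hf (j.isOpen_dom.mem_nhds hfa)
  filter_upwards [i'.eventually_par ha' h1, i'.eventually_par ha' (i.isOpen_dom.mem_nhds ha)]
    with t ht hti
  simp only [Function.comp, inCharts]
  rw [mem_dom_par_trans _ _ hti, trans_coord _ _ ht]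

theorem IsLocalBihol.continuousAt (h : IsLocalBihol f a) : ContinuousAt f a := by
  obtain ⟨i, j, ha, hfa, hA, hd⟩ := h
  exact continuousAt_of_inCharts ha hfa hA hd

/-- The definition only provides one pair of charts; since changes of coordinates are analytic with
nonzero derivative, every pair of charts around the points will do. -/
theorem IsLocalBihol.analyticAt_and_deriv_ne_zero (h : IsLocalBihol f a) (ha : a ∈ i.dom)
    (hfa : f a ∈ j.dom) : AnalyticAt ℂ (inCharts i j f) (i.coord a) ∧
      deriv (inCharts i j f) (i.coord a) ≠ 0 := by
  have hc := h.continuousAt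
  obtain ⟨i', j', ha', hfa', hA, hd⟩ := h
  have h1 := inCharts_trans_eventuallyEq ha' hfa' hc ha (j' := j)
  have e1 : trans i i' (i.coord a) = i'.coord a := trans_coord _ _ ha
  have hi : i.par (i.coord a) ∈ i'.dom := by rwa [i.par_coord ha]
  have e2 : inCharts i' j' f (i'.coord a) = j'.coord (f a) := inCharts_par _ _ _ ha'
  have hj : j'.par (j'.coord (f a)) ∈ j.dom := by rwa [j'.par_coord hfa']
  have A1 := analyticAt_trans hi
  have A2 := analyticAt_trans hj
  have hA' : AnalyticAt ℂ (inCharts i' j' f) (trans i i' (i.coord a)) := by rwa [e1]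
  have A3 : AnalyticAt ℂ (inCharts i' j' f ∘ trans i i') (i.coord a) := hA'.comp A1
  have e3 : (inCharts i' j' f ∘ trans i i') (i.coord a) = j'.coord (f a) := by
    rw [Function.comp, e1, e2]
  have A2' : AnalyticAt ℂ (trans j' j) ((inCharts i' j' f ∘ trans i i') (i.coord a)) := by
    rwa [e3]
  refine ⟨(A2'.comp A3).congr h1.symm, ?_⟩
  rw [h1.deriv_eq, deriv_comp _ A2'.differentiableAt A3.differentiableAt,
    deriv_comp _ hA'.differentiableAt A1.differentiableAt, e3, e1]
  exact mul_ne_zero (deriv_trans_ne_zero hj) (mul_ne_zero hd (deriv_trans_ne_zero hi))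

theorem IsLocalBihol.analyticAt (h : IsLocalBihol f a) (ha : a ∈ i.dom)
    (hfa : f a ∈ j.dom) : AnalyticAt ℂ (inCharts i j f) (i.coord a) :=
  (h.analyticAt_and_deriv_ne_zero ha hfa).1

theorem IsLocalBihol.deriv_ne_zero (h : IsLocalBihol f a) (ha : a ∈ i.dom)
    (hfa : f a ∈ j.dom) : deriv (inCharts i j f) (i.coord a) ≠ 0 :=
  (h.analyticAt_and_deriv_ne_zero ha hfa).2

theorem IsLocalBihol.eventually (h : IsLocalBihol f a) : ∀ᶠ b in 𝓝 a, IsLocalBihol f b := by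
  obtain ⟨i, j, ha, hfa, hA, hd⟩ := h
  have h1 : ∀ᶠ t in 𝓝 (i.coord a), deriv (inCharts i j f) t ≠ 0 :=
    hA.deriv.continuousAt.eventually_ne hd
  refine i.eventually_of_par ha ?_
  filter_upwards [h1, hA.eventually_analyticAt, i.eventually_par ha
    (eventually_mem_dom_of_inCharts ha hfa hA hd)] with t h1 h2 h3
  refine ⟨i, j, i.par_mem t, h3, ?_, ?_⟩ <;> rwa [i.coord_par]

theorem IsLocalBihol.congr {g : P1 → P1} (h : IsLocalBihol f a) (hfg : f =ᶠ[𝓝 a] g) :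
    IsLocalBihol g a := by
  obtain ⟨i, j, ha, hfa, hA, hd⟩ := h
  have e : inCharts i j f =ᶠ[𝓝 (i.coord a)] inCharts i j g := by
    filter_upwards [i.eventually_par ha hfg] with t ht
    simp only [inCharts]
    rw [ht]
  refine ⟨i, j, ha, ?_, hA.congr e, ?_⟩
  · rwa [← hfg.eq_of_nhds]
  · rwa [← e.deriv_eq]

theorem inCharts_congr {g : P1 → P1} (ha : a ∈ i.dom) (hfg : f =ᶠ[𝓝 a] g) :
    inCharts i j f =ᶠ[𝓝 (i.coord a)] inCharts i j g := by
  filter_upwards [i.eventually_par ha hfg] with t ht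
  simp only [inCharts]
  rw [ht]

theorem jetCoord_congr {g : P1 → P1} (ha : a ∈ i.dom) (hfg : f =ᶠ[𝓝 a] g) :
    jetCoord i j f a = jetCoord i j g a := by
  funext n
  have e := inCharts_congr (j := j) ha hfg
  cases n with
  | zero => simp only [jetCoord, e.deriv_eq]
  | succ n => exact e.iteratedDeriv_eq (n + 1)

theorem inCharts_comp_eventuallyEq {g : P1 → P1} {l : Chart} (ha : a ∈ i.dom) (hfa : f a ∈ j.dom)
    (hf : ContinuousAt f a) :
    inCharts i l (g ∘ f) =ᶠ[𝓝 (i.coord a)] inCharts j l g ∘ inCharts i j f := by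
  filter_upwards [i.eventually_par ha (hf (j.isOpen_dom.mem_nhds hfa))] with t ht
  simp only [inCharts, Function.comp]
  rw [j.par_coord ht]

theorem IsLocalBihol.comp {g : P1 → P1} (hg : IsLocalBihol g (f a)) (hf : IsLocalBihol f a) :
    IsLocalBihol (g ∘ f) a := by
  obtain ⟨i, hi⟩ := Chart.exists_mem a
  obtain ⟨j, hj⟩ := Chart.exists_mem (f a)
  obtain ⟨l, hl⟩ := Chart.exists_mem (g (f a))
  have e := inCharts_comp_eventuallyEq (g := g) (l := l) hi hj hf.continuousAt
  have A1 := hf.analyticAt hi hj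
  have A2 : AnalyticAt ℂ (inCharts j l g) (inCharts i j f (i.coord a)) := by
    rw [inCharts_par i j f hi]
    exact hg.analyticAt hj hl
  refine ⟨i, l, hi, hl, (A2.comp A1).congr e.symm, ?_⟩
  rw [e.deriv_eq, deriv_comp _ A2.differentiableAt A1.differentiableAt, inCharts_par i j f hi]
  exact mul_ne_zero (hg.deriv_ne_zero hj hl) (hf.deriv_ne_zero hi hj)

theorem isLocalBihol_id (a : P1) : IsLocalBihol id a := by
  obtain ⟨i, hi⟩ := Chart.exists_mem a
  have e : inCharts i i id = id := funext fun t => i.coord_par t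
  refine ⟨i, i, hi, hi, ?_, ?_⟩
  · rw [e]
    exact analyticAt_id
  · rw [e, deriv_id]
    exact one_ne_zero

/-- The map which is given by `φ` in the charts `i` and `j`. -/
def ofCharts (i j : Chart) (φ : ℂ → ℂ) : P1 → P1 := fun a => j.par (φ (i.coord a))

theorem inCharts_ofCharts (i j : Chart) (φ : ℂ → ℂ) : inCharts i j (ofCharts i j φ) = φ := by
  funext t
  simp [inCharts, ofCharts, Chart.coord_par]

theorem isLocalBihol_ofCharts {φ : ℂ → ℂ} (ha : a ∈ i.dom) (hA : AnalyticAt ℂ φ (i.coord a))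
    (hd : deriv φ (i.coord a) ≠ 0) : IsLocalBihol (ofCharts i j φ) a := by
  refine ⟨i, j, ha, j.par_mem _, ?_, ?_⟩ <;> rwa [inCharts_ofCharts]

/-- Existence of a local inverse, which is again a local biholomorphism. -/
theorem IsLocalBihol.exists_inverse (h : IsLocalBihol f a) :
    ∃ g : P1 → P1, IsLocalBihol g (f a) ∧ (∀ᶠ b in 𝓝 a, g (f b) = b) ∧
      ∀ᶠ c in 𝓝 (f a), f (g c) = c := by
  have hc := h.continuousAt
  obtain ⟨i, j, ha, hfa, hA, hd⟩ := h
  set φ := inCharts i j f with hφ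
  set z := i.coord a with hz
  have hs : HasStrictDerivAt φ (deriv φ z) z := hA.hasStrictDerivAt
  set ψ := hs.localInverse φ (deriv φ z) z hd with hψ
  have hφz : φ z = j.coord (f a) := inCharts_par i j f ha
  have h1 : ∀ᶠ t in 𝓝 z, ψ (φ t) = t := hs.eventually_left_inverse hd
  have h2 : ∀ᶠ s in 𝓝 (φ z), φ (ψ s) = s := hs.eventually_right_inverse hd
  have h3 : HasStrictDerivAt ψ (deriv φ z)⁻¹ (φ z) := hs.to_localInverse hd
  have hψz : ψ (φ z) = z := h1.self_of_nhds
  have hA2 : AnalyticAt ℂ ψ (φ z) := hA.analyticAt_localInverse hd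
  have hl : ∀ᶠ b in 𝓝 a, ofCharts j i ψ (f b) = b := by
    refine i.eventually_of_par ha ?_
    filter_upwards [h1] with t ht
    rw [ofCharts]
    change i.par (ψ (φ t)) = i.par t
    rw [ht]
  refine ⟨ofCharts j i ψ, isLocalBihol_ofCharts hfa (hφz ▸ hA2) ?_, hl, ?_⟩
  · rw [← hφz, h3.hasDerivAt.deriv]
    exact inv_ne_zero hd
  · have hψc : ContinuousAt (fun s => i.par (ψ s)) (φ z) :=
      i.continuous_par.continuousAt.comp hA2.continuousAt
    have h4 : ∀ᶠ s in 𝓝 (φ z), f (i.par (ψ s)) ∈ j.dom := by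
      have : ∀ᶠ b in 𝓝 (i.par (ψ (φ z))), f b ∈ j.dom := by
        rw [hψz, hz, i.par_coord ha]
        exact hc (j.isOpen_dom.mem_nhds hfa)
      exact hψc.eventually this
    refine j.eventually_of_par hfa ?_
    rw [← hφz]
    filter_upwards [h2, h4] with s hs1 hs2
    rw [ofCharts, j.coord_par]
    have : j.coord (f (i.par (ψ s))) = s := hs1
    rw [← j.par_coord hs2, this]

/-- Any left inverse agrees near `f a` with the local inverse from the inverse function theorem,
because that one is continuous with value `a` at `f a`. -/
theorem IsLocalBihol.of_eventually_leftInverse {g : P1 → P1} (hf : IsLocalBihol f a)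
    (h : ∀ᶠ b in 𝓝 a, g (f b) = b) : IsLocalBihol g (f a) := by
  obtain ⟨g', hg', h1, h2⟩ := hf.exists_inverse
  refine hg'.congr ?_
  have hga : g' (f a) = a := h1.self_of_nhds
  have hc : Tendsto g' (𝓝 (f a)) (𝓝 a) := by
    have := hg'.continuousAt
    rwa [ContinuousAt, hga] at this
  filter_upwards [h2, hc.eventually h] with c hc1 hc2
  rw [← hc2, hc1]

theorem IsLocalBihol.eventually_ne (h : IsLocalBihol f a) (c : P1) :
    ∀ᶠ b in 𝓝[≠] a, f b ≠ c := by
  by_cases hc : f a = c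
  · obtain ⟨g, -, h1, -⟩ := h.exists_inverse
    have h0 := h1.self_of_nhds
    rw [eventually_nhdsWithin_iff]
    filter_upwards [h1] with b hb hba hbc
    apply hba
    rw [Set.mem_singleton_iff, ← hb, hbc, ← hc, h0]
  · exact (h.continuousAt.eventually_ne hc).filter_mono nhdsWithin_le_nhds

end LocalBihol

/-! ### Jet expressions -/

/-- A subring of functions containing the coefficients and the variables of a polynomial
contains the function obtained by evaluating the polynomial. -/
theorem eval₂_mem_of_mem {X B σ : Type*} (S : Subring (X → ℂ)) (c : X → B) (v : X → σ → ℂ)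
    (Q : MvPolynomial σ (B → ℂ)) (hc : ∀ m, (fun x => Q.coeff m (c x)) ∈ S)
    (hv : ∀ n ∈ Q.vars, (fun x => v x n) ∈ S) :
    (fun x => Q.eval₂ (Pi.evalRingHom (fun _ : B => ℂ) (c x)) (v x)) ∈ S := by
  have h : (fun x => Q.eval₂ (Pi.evalRingHom (fun _ : B => ℂ) (c x)) (v x)) =
      ∑ m ∈ Q.support, (fun x => Q.coeff m (c x)) * ∏ n ∈ m.support, (fun x => v x n) ^ m n := by
    funext x
    rw [MvPolynomial.eval₂_eq, Finset.sum_apply]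
    refine Finset.sum_congr rfl fun m _ => ?_
    rw [Pi.mul_apply, Finset.prod_apply]
    rfl
  rw [h]
  refine S.sum_mem fun m hm => S.mul_mem (hc m) (S.prod_mem fun n hn => S.pow_mem (hv n ?_) _)
  exact (MvPolynomial.mem_vars_iff_mem_support n).2 ⟨m, hm, hn⟩

section

variable {k : ℕ} {i j : Chart} {p : P1 × P1} {E F : (P1 → P1) → P1 → ℂ}

/-- Two functions of jets agree near the point `p` of `P1 × P1`. -/
def EqNear (p : P1 × P1) (E F : (P1 → P1) → P1 → ℂ) : Prop :=
  ∀ᶠ q in 𝓝 p, ∀ f a, (a, f a) = q → IsLocalBihol f a → E f a = F f a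

theorem HasJetExpr.congr (hE : HasJetExpr k i j p E) (h : EqNear p F E) :
    HasJetExpr k i j p F := by
  obtain ⟨Q, h1, h2, h3⟩ := hE
  refine ⟨Q, h1, h2, ?_⟩
  filter_upwards [h, h3] with q hq hq3 f a hfa hb
  rw [hq f a hfa hb, hq3 f a hfa hb]

theorem HasJetExpr.coeff {c : ℂ × ℂ → ℂ} (hc : AnalyticAt ℂ c (i.coord p.1, j.coord p.2)) :
    HasJetExpr k i j p (fun f a => c (i.coord a, j.coord (f a))) := by
  classical
  refine ⟨MvPolynomial.C c, by simp, ?_, ?_⟩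
  · intro m
    rw [MvPolynomial.coeff_C]
    split_ifs
    · exact hc
    · exact analyticAt_const
  · filter_upwards with q f a hfa hb
    rw [MvPolynomial.eval₂_C]
    rfl

theorem HasJetExpr.const (c : ℂ) : HasJetExpr k i j p (fun _ _ => c) :=
  HasJetExpr.coeff (c := fun _ => c) analyticAt_const

theorem HasJetExpr.jet {n : ℕ} (hn : n ≤ k) (hk : 1 ≤ k) :
    HasJetExpr k i j p (fun f a => jetCoord i j f a n) := by
  classical
  refine ⟨MvPolynomial.X n, ?_, ?_, ?_⟩
  · intro m hm
    rw [MvPolynomial.vars_X, Finset.mem_singleton] at hm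
    exact ⟨hm ▸ hn, hk⟩
  · intro m
    rw [MvPolynomial.coeff_X]
    split_ifs
    · exact analyticAt_const
    · exact analyticAt_const
  · filter_upwards with q f a hfa hb
    rw [MvPolynomial.eval₂_X]

/-- The ring of functions of jets which have an expression of order `k` near `p`. -/
def jetExprRing (k : ℕ) (i j : Chart) (p : P1 × P1) : Subring ((P1 → P1) × P1 → ℂ) where
  carrier := {E | HasJetExpr k i j p fun f a => E (f, a)}
  mul_mem' := fun hE hF => hE.mul hF fun _ _ => rfl
  add_mem' := fun hE hF => hE.add hF fun _ _ => rfl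
  one_mem' := HasJetExpr.const 1
  zero_mem' := HasJetExpr.const 0
  neg_mem' := fun hE => (HasJetExpr.const (-1)).mul hE fun _ _ => by simp

theorem HasJetExpr.mem_ring (h : HasJetExpr k i j p E) :
    (fun x : (P1 → P1) × P1 => E x.1 x.2) ∈ jetExprRing k i j p := h

/-- Induction principle for jet expressions. -/
theorem HasJetExpr.mem_of_generators (S : Subring ((P1 → P1) × P1 → ℂ))
    (hS : ∀ E F : (P1 → P1) × P1 → ℂ, E ∈ S →
      EqNear p (fun f a => F (f, a)) (fun f a => E (f, a)) → F ∈ S)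
    (hc : ∀ c : ℂ × ℂ → ℂ, AnalyticAt ℂ c (i.coord p.1, j.coord p.2) →
      (fun x : (P1 → P1) × P1 => c (i.coord x.2, j.coord (x.1 x.2))) ∈ S)
    (hv : ∀ n, n ≤ k → 1 ≤ k → (fun x : (P1 → P1) × P1 => jetCoord i j x.1 x.2 n) ∈ S)
    (h : HasJetExpr k i j p E) : (fun x : (P1 → P1) × P1 => E x.1 x.2) ∈ S := by
  obtain ⟨Q, h1, h2, h3⟩ := h
  have := eval₂_mem_of_mem S (fun x : (P1 → P1) × P1 => (i.coord x.2, j.coord (x.1 x.2)))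
    (fun x => jetCoord i j x.1 x.2) Q (fun m => hc _ (h2 m)) (fun n hn => hv n (h1 n hn).1 (h1 n hn).2)
  exact hS _ _ this h3

theorem analyticAt_coeff_of_mem {σ B : Type*} [NormedAddCommGroup B] [NormedSpace ℂ B]
    {Q : MvPolynomial σ (B → ℂ)} {b : B} (h : ∀ m, AnalyticAt ℂ (Q.coeff m) b) :
    ∀ᶠ b' in 𝓝 b, ∀ m, AnalyticAt ℂ (Q.coeff m) b' := by
  have h1 : ∀ᶠ b' in 𝓝 b, ∀ m ∈ Q.support, AnalyticAt ℂ (Q.coeff m) b' :=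
    (Finset.eventually_all _).2 fun m _ => (h m).eventually_analyticAt
  filter_upwards [h1] with b' hb m
  by_cases hm : m ∈ Q.support
  · exact hb m hm
  · rw [MvPolynomial.notMem_support_iff.1 hm]
    exact analyticAt_const

theorem tendsto_coords (hi : p.1 ∈ i.dom) (hj : p.2 ∈ j.dom) :
    Tendsto (fun q : P1 × P1 => (i.coord q.1, j.coord q.2)) (𝓝 p)
      (𝓝 (i.coord p.1, j.coord p.2)) := by
  have h1 : Tendsto (fun q : P1 × P1 => i.coord q.1) (𝓝 p) (𝓝 (i.coord p.1)) :=
    (i.continuousAt_coord hi).tendsto.comp continuous_fst.continuousAt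
  have h2 : Tendsto (fun q : P1 × P1 => j.coord q.2) (𝓝 p) (𝓝 (j.coord p.2)) :=
    (j.continuousAt_coord hj).tendsto.comp continuous_snd.continuousAt
  exact h1.prodMk_nhds h2

theorem eventually_mem_doms (hi : p.1 ∈ i.dom) (hj : p.2 ∈ j.dom) :
    ∀ᶠ q in 𝓝 p, q.1 ∈ i.dom ∧ q.2 ∈ j.dom :=
  (continuous_fst.continuousAt.eventually (i.isOpen_dom.mem_nhds hi)).and
    (continuous_snd.continuousAt.eventually (j.isOpen_dom.mem_nhds hj))

theorem HasJetExpr.eventually (h : HasJetExpr k i j p E) (hi : p.1 ∈ i.dom) (hj : p.2 ∈ j.dom) :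
    ∀ᶠ q in 𝓝 p, HasJetExpr k i j q E := by
  obtain ⟨Q, h1, h2, h3⟩ := h
  filter_upwards [(tendsto_coords hi hj).eventually (analyticAt_coeff_of_mem h2), h3.eventually_nhds]
    with q hq hq3
  exact ⟨Q, h1, hq, hq3⟩

theorem IsLocalBihol.tendsto_graph {f : P1 → P1} {a : P1} (hf : IsLocalBihol f a)
    (ha : a ∈ i.dom) : Tendsto (fun t => (i.par t, f (i.par t))) (𝓝 (i.coord a)) (𝓝 (a, f a)) := by
  have h1 : Tendsto i.par (𝓝 (i.coord a)) (𝓝 a) := by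
    rw [Tendsto, i.map_par_nhds ha]
  exact h1.prodMk_nhds (hf.continuousAt.tendsto.comp h1)

theorem EqNear.eventually_along {f : P1 → P1} {a : P1} (h : EqNear (a, f a) E F)
    (hf : IsLocalBihol f a) (ha : a ∈ i.dom) :
    ∀ᶠ t in 𝓝 (i.coord a), E f (i.par t) = F f (i.par t) := by
  filter_upwards [(hf.tendsto_graph ha).eventually h, i.eventually_par ha hf.eventually]
    with t ht hb
  exact ht f _ rfl hb

theorem EqNear.eventually (h : EqNear p E F) : ∀ᶠ q in 𝓝 p, EqNear q E F :=
  h.eventually_nhds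

/-- `F` is the derivative of `E` along jets, for the coordinate of the chart `i`, near `p`. -/
def IsDerivNear (i : Chart) (p : P1 × P1) (E F : (P1 → P1) → P1 → ℂ) : Prop :=
  ∀ᶠ q in 𝓝 p, ∀ f a, (a, f a) = q → IsLocalBihol f a →
    HasDerivAt (fun t => E f (i.par t)) (F f a) (i.coord a)

theorem hasDerivAt_iteratedDeriv {φ : ℂ → ℂ} {z : ℂ} (h : AnalyticAt ℂ φ z) (n : ℕ) :
    HasDerivAt (iteratedDeriv n φ) (iteratedDeriv (n + 1) φ z) z := by
  rw [iteratedDeriv_succ]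
  have : AnalyticAt ℂ (iteratedDeriv n φ) z := by
    rw [iteratedDeriv_eq_iterate]
    exact h.iterated_deriv n
  exact this.differentiableAt.hasDerivAt

/-- The derivative of a jet expression is a jet expression. -/
theorem HasJetExpr.exists_deriv (h : HasJetExpr k i j p E) (hi : p.1 ∈ i.dom) (hj : p.2 ∈ j.dom) :
    ∃ F, HasJetExpr (k + 1) i j p F ∧ IsDerivNear i p E F := by
  -- The functions with the desired property form a subring, so only coefficients and variables
  -- remain to be treated. The expression itself is recorded along with its derivative because the
  -- product rule involves both.
  let S : Subring ((P1 → P1) × P1 → ℂ) :=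
    { carrier := {E | HasJetExpr (k + 1) i j p (fun f a => E (f, a)) ∧
        ∃ F, HasJetExpr (k + 1) i j p F ∧ IsDerivNear i p (fun f a => E (f, a)) F}
      mul_mem' := by
        rintro E₁ E₂ ⟨h1, F₁, hF1, hd1⟩ ⟨h2, F₂, hF2, hd2⟩
        refine ⟨h1.mul h2 fun _ _ => rfl, _,
          (hF1.mul h2 fun _ _ => rfl).add (h1.mul hF2 fun _ _ => rfl) fun _ _ => rfl, ?_⟩
        filter_upwards [hd1, hd2, eventually_mem_doms hi hj] with q h1 h2 hq f a hfa hb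
        have := (h1 f a hfa hb).mul (h2 f a hfa hb)
        have ha : a ∈ i.dom := by
          have := hq.1
          rwa [← hfa] at this
        rw [i.par_coord ha] at this
        exact this
      add_mem' := by
        rintro E₁ E₂ ⟨h1, F₁, hF1, hd1⟩ ⟨h2, F₂, hF2, hd2⟩
        refine ⟨h1.add h2 fun _ _ => rfl, _, hF1.add hF2 fun _ _ => rfl, ?_⟩
        filter_upwards [hd1, hd2] with q h1 h2 f a hfa hb
        exact (h1 f a hfa hb).add (h2 f a hfa hb)
      one_mem' := ⟨HasJetExpr.const 1, _, HasJetExpr.const 0, by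
        filter_upwards with q f a _ _
        exact hasDerivAt_const _ _⟩
      zero_mem' := ⟨HasJetExpr.const 0, _, HasJetExpr.const 0, by
        filter_upwards with q f a _ _
        exact hasDerivAt_const _ _⟩
      neg_mem' := by
        rintro E₁ ⟨h1, F₁, hF1, hd1⟩
        refine ⟨(HasJetExpr.const (-1)).mul h1 fun _ _ => by simp, fun f a => -F₁ f a,
          (HasJetExpr.const (-1)).mul hF1 fun _ _ => by simp, ?_⟩
        filter_upwards [hd1] with q h1 f a hfa hb
        exact (h1 f a hfa hb).neg }
  have key : (fun x : (P1 → P1) × P1 => E x.1 x.2) ∈ S := by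
    refine HasJetExpr.mem_of_generators S ?_ ?_ ?_ h
    · rintro E F ⟨h1, G, hG, hd⟩ hEF
      refine ⟨h1.congr hEF, G, hG, ?_⟩
      filter_upwards [hd, hEF.eventually, eventually_mem_doms hi hj] with q hq hq2 hq3 f a hfa hb
      have ha : a ∈ i.dom := by
        have := hq3.1
        rwa [← hfa] at this
      refine (hq f a hfa hb).congr_of_eventuallyEq ?_
      rw [← hfa] at hq2
      exact hq2.eventually_along hb ha
    · intro c hc
      refine ⟨HasJetExpr.coeff hc, fun f a => fderiv ℂ c (i.coord a, j.coord (f a)) (1, 0)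
        + fderiv ℂ c (i.coord a, j.coord (f a)) (0, 1) * jetCoord i j f a 1, ?_, ?_⟩
      · have h1 : AnalyticAt ℂ (fun z => fderiv ℂ c z (1, 0)) (i.coord p.1, j.coord p.2) :=
          ((ContinuousLinearMap.apply ℂ ℂ ((1, 0) : ℂ × ℂ)).analyticAt _).comp hc.fderiv
        have h2 : AnalyticAt ℂ (fun z => fderiv ℂ c z (0, 1)) (i.coord p.1, j.coord p.2) :=
          ((ContinuousLinearMap.apply ℂ ℂ ((0, 1) : ℂ × ℂ)).analyticAt _).comp hc.fderiv
        exact (HasJetExpr.coeff h1).add ((HasJetExpr.coeff h2).mul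
          (HasJetExpr.jet (n := 1) (by omega) (by omega)) fun _ _ => rfl) fun _ _ => rfl
      · filter_upwards [(tendsto_coords hi hj).eventually hc.eventually_analyticAt,
          eventually_mem_doms hi hj] with q hq hq2 f a hfa hb
        subst hfa
        have A := hb.analyticAt hq2.1 hq2.2
        have e : inCharts i j f (i.coord a) = j.coord (f a) := inCharts_par i j f hq2.1
        have d1 : HasDerivAt (fun t => (t, inCharts i j f t))
            (1, deriv (inCharts i j f) (i.coord a)) (i.coord a) :=
          (hasDerivAt_id _).prodMk A.differentiableAt.hasDerivAt
        have d2 : HasFDerivAt c (fderiv ℂ c (i.coord a, j.coord (f a)))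
            (i.coord a, inCharts i j f (i.coord a)) := by
          rw [e]
          exact hq.differentiableAt.hasFDerivAt
        have d3 := d2.comp_hasDerivAt (f := fun t => (t, inCharts i j f t)) _ d1
        have e2 : (fun t => c (i.coord (i.par t), j.coord (f (i.par t)))) =
            c ∘ fun t => (t, inCharts i j f t) := by
          funext t
          simp [inCharts, i.coord_par]
        rw [e2]
        refine d3.congr_deriv ?_
        have e3 : ((1 : ℂ), deriv (inCharts i j f) (i.coord a)) =
            (1, 0) + deriv (inCharts i j f) (i.coord a) • ((0 : ℂ), (1 : ℂ)) := by
          simp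
        rw [e3, map_add, map_smul]
        simp only [jetCoord, zero_add, iteratedDeriv_one, smul_eq_mul]
        ring
    · intro n hn hk
      refine ⟨HasJetExpr.jet (by omega) (by omega), ?_⟩
      -- The variable of index `0` is `1 / y₁`, with derivative `-y₂ / y₁²`; the others satisfy `D
      -- yₙ = yₙ₊₁`.
      rcases n with _ | n
      · refine ⟨fun f a => -(jetCoord i j f a 0 * jetCoord i j f a 0 * jetCoord i j f a 2), ?_, ?_⟩
        · have h0 : HasJetExpr (k + 1) i j p fun f a => jetCoord i j f a 0 :=
            HasJetExpr.jet (by omega) (by omega)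
          have h2 : HasJetExpr (k + 1) i j p fun f a => jetCoord i j f a 2 :=
            HasJetExpr.jet (by omega) (by omega)
          exact (HasJetExpr.const (-1)).mul ((h0.mul h0 fun _ _ => rfl).mul h2 fun _ _ => rfl)
            fun _ _ => by simp
        · filter_upwards [eventually_mem_doms hi hj] with q hq2 f a hfa hb
          subst hfa
          have A := hb.analyticAt hq2.1 hq2.2
          have d := (hasDerivAt_iteratedDeriv A 1)
          rw [iteratedDeriv_one] at d
          have d2 := d.fun_inv (hb.deriv_ne_zero hq2.1 hq2.2)
          have e2 : (fun t => jetCoord i j f (i.par t) 0) =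
            fun t => (deriv (inCharts i j f) t)⁻¹ := by
            funext t
            simp [jetCoord, i.coord_par]
          rw [e2]
          refine d2.congr_deriv ?_
          simp only [jetCoord]
          ring
      · refine ⟨fun f a => jetCoord i j f a (n + 2), HasJetExpr.jet (by omega) (by omega), ?_⟩
        filter_upwards [eventually_mem_doms hi hj] with q hq2 f a hfa hb
        subst hfa
        have A := hb.analyticAt hq2.1 hq2.2
        have d := (hasDerivAt_iteratedDeriv A (n + 1))
        have e2 : (fun t => jetCoord i j f (i.par t) (n + 1)) =
            iteratedDeriv (n + 1) (inCharts i j f) := by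
          funext t
          simp [jetCoord, i.coord_par]
        rw [e2]
        exact d
  exact key.2

/-- The value along the jets of `f` is even differentiable. The continuity is what extends the
vanishing of equations from regular points to singular ones. -/
theorem HasJetExpr.continuousAt_along {f : P1 → P1} {a : P1} (h : HasJetExpr k i j (a, f a) E)
    (hf : IsLocalBihol f a) (ha : a ∈ i.dom) (hfa : f a ∈ j.dom) : ContinuousAt (E f) a := by
  obtain ⟨F, -, hF⟩ := h.exists_deriv ha hfa
  have h1 := (hF.self_of_nhds f a rfl hf).continuousAt
  have h2 : ContinuousAt (fun b => E f (i.par (i.coord b))) a :=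
    ContinuousAt.comp (f := i.coord) (g := fun t => E f (i.par t)) h1 (i.continuousAt_coord ha)
  refine h2.congr ?_
  filter_upwards [i.isOpen_dom.mem_nhds ha] with b hb
  rw [i.par_coord hb]

end

/-! ### Change of charts, inversion and composition for jet expressions -/

section

variable {k : ℕ} {i j : Chart} {p : P1 × P1} {E F : (P1 → P1) → P1 → ℂ}

theorem IsDerivNear.change_chart (h : IsDerivNear i p E F) (hi : p.1 ∈ i.dom) {i' : Chart}
    (hi' : p.1 ∈ i'.dom) :
    IsDerivNear i' p E fun f a => F f a * deriv (trans i' i) (i'.coord a) := by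
  have hd : ∀ᶠ q : P1 × P1 in 𝓝 p, q.1 ∈ i.dom ∧ q.1 ∈ i'.dom :=
    continuous_fst.continuousAt.eventually
      ((i.isOpen_dom.inter i'.isOpen_dom).mem_nhds ⟨hi, hi'⟩)
  filter_upwards [h, hd] with q hq hq2 f a hfa hb
  subst hfa
  have e1 : trans i' i (i'.coord a) = i.coord a := trans_coord _ _ hq2.2
  have hz : i'.par (i'.coord a) ∈ i.dom := by
    rw [i'.par_coord hq2.2]
    exact hq2.1
  have d1 := hq f a rfl hb
  rw [← e1] at d1
  have d2 := d1.comp _ (analyticAt_trans hz).differentiableAt.hasDerivAt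
  refine d2.congr_of_eventuallyEq ?_
  filter_upwards [i'.eventually_par hq2.2 (i.isOpen_dom.mem_nhds hq2.1)] with t ht
  simp only [Function.comp]
  rw [mem_dom_par_trans _ _ ht]

theorem analyticAt_coord_change (hi : p.1 ∈ i.dom) {i' : Chart} (hi' : p.1 ∈ i'.dom) :
    AnalyticAt ℂ (trans i i') (i.coord p.1) :=
  analyticAt_trans (by rwa [i.par_coord hi])

theorem HasJetExpr.coeff_change (hi : p.1 ∈ i.dom) (hj : p.2 ∈ j.dom) {i' j' : Chart}
    (hi' : p.1 ∈ i'.dom) (hj' : p.2 ∈ j'.dom) {c : ℂ × ℂ → ℂ}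
    (hc : AnalyticAt ℂ c (i'.coord p.1, j'.coord p.2)) :
    HasJetExpr k i j p (fun f a => c (i'.coord a, j'.coord (f a))) := by
  have a1 : AnalyticAt ℂ (fun z : ℂ × ℂ => trans i i' z.1) (i.coord p.1, j.coord p.2) :=
    AnalyticAt.fun_comp (g := trans i i') (f := Prod.fst) (analyticAt_coord_change hi hi') analyticAt_fst
  have a2 : AnalyticAt ℂ (fun z : ℂ × ℂ => trans j j' z.2) (i.coord p.1, j.coord p.2) :=
    AnalyticAt.fun_comp (g := trans j j') (f := Prod.snd)
      (analyticAt_coord_change (p := (p.2, p.1)) hj hj') analyticAt_snd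
  have a3 : AnalyticAt ℂ (fun z : ℂ × ℂ => c (trans i i' z.1, trans j j' z.2))
      (i.coord p.1, j.coord p.2) := by
    refine AnalyticAt.fun_comp (g := c) ?_ (a1.prod a2)
    rwa [trans_coord _ _ hi, trans_coord _ _ hj]
  refine (HasJetExpr.coeff a3).congr ?_
  filter_upwards [eventually_mem_doms hi hj] with q hq f a hfa _
  subst hfa
  rw [trans_coord _ _ hq.1, trans_coord _ _ hq.2]

/-- The law of transformation of higher jets is obtained by differentiating in one chart and
multiplying by the derivative of the change of coordinates, so no explicit formula is needed. -/
theorem hasJetExpr_iteratedDeriv (hi : p.1 ∈ i.dom) (hj : p.2 ∈ j.dom) {i' j' : Chart}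
    (hi' : p.1 ∈ i'.dom) (hj' : p.2 ∈ j'.dom) (n : ℕ) :
    HasJetExpr n i j p (fun f a => iteratedDeriv n (inCharts i' j' f) (i'.coord a)) := by
  induction n with
  | zero =>
    have := HasJetExpr.coeff_change (k := 0) hi hj hi' hj' (c := Prod.snd) analyticAt_snd
    refine this.congr ?_
    filter_upwards [eventually_mem_doms hi' hj'] with q hq f a hfa _
    subst hfa
    simp only [iteratedDeriv_zero]
    rw [inCharts_par i' j' f hq.1]
  | succ n ih =>
    obtain ⟨F, hF, hd⟩ := ih.exists_deriv hi hj
    have h1 : HasJetExpr (n + 1) i j p fun f a => deriv (trans i' i) (i'.coord a) := by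
      refine HasJetExpr.coeff_change hi hj hi' hj' (c := fun z => deriv (trans i' i) z.1) ?_
      exact AnalyticAt.fun_comp (g := deriv (trans i' i)) (f := Prod.fst)
        (analyticAt_coord_change hi' hi).deriv analyticAt_fst
    refine (hF.mul h1 fun _ _ => rfl).congr ?_
    filter_upwards [hd.change_chart hi hi', eventually_mem_doms hi' hj'] with q hq hq2 f a hfa hb
    subst hfa
    have d1 := hq f a rfl hb
    have e : (fun t => iteratedDeriv n (inCharts i' j' f) (i'.coord (i'.par t))) =
        iteratedDeriv n (inCharts i' j' f) := funext fun t => by rw [i'.coord_par]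
    rw [e] at d1
    exact (hasDerivAt_iteratedDeriv (hb.analyticAt hq2.1 hq2.2) n).unique d1

theorem deriv_inCharts_change {f : P1 → P1} {a : P1} (hf : IsLocalBihol f a) (hi : a ∈ i.dom)
    (hj : f a ∈ j.dom) {i' j' : Chart} (hi' : a ∈ i'.dom) (hj' : f a ∈ j'.dom) :
    deriv (inCharts i' j' f) (i'.coord a) = deriv (trans j j') (j.coord (f a)) *
      (deriv (inCharts i j f) (i.coord a) * deriv (trans i' i) (i'.coord a)) := by
  have e := inCharts_trans_eventuallyEq hi hj hf.continuousAt hi' (j' := j')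
  have hz : i'.par (i'.coord a) ∈ i.dom := by rwa [i'.par_coord hi']
  have e1 : trans i' i (i'.coord a) = i.coord a := trans_coord _ _ hi'
  have A1 := analyticAt_trans hz
  have A2 : AnalyticAt ℂ (inCharts i j f) (trans i' i (i'.coord a)) := by
    rw [e1]
    exact hf.analyticAt hi hj
  have e2 : (inCharts i j f ∘ trans i' i) (i'.coord a) = j.coord (f a) := by
    rw [Function.comp, e1, inCharts_par i j f hi]
  have A3 : AnalyticAt ℂ (trans j j') ((inCharts i j f ∘ trans i' i) (i'.coord a)) := by
    rw [e2]
    exact analyticAt_trans (by rwa [j.par_coord hj])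
  rw [e.deriv_eq, deriv_comp _ A3.differentiableAt (A2.comp A1).differentiableAt, e2,
    deriv_comp _ A2.differentiableAt A1.differentiableAt, e1]

theorem hasJetExpr_jetCoord (hi : p.1 ∈ i.dom) (hj : p.2 ∈ j.dom) {i' j' : Chart}
    (hi' : p.1 ∈ i'.dom) (hj' : p.2 ∈ j'.dom) {n : ℕ} (hn : n ≤ k) (hk : 1 ≤ k) :
    HasJetExpr k i j p (fun f a => jetCoord i' j' f a n) := by
  rcases n with _ | n
  · have hz : i'.par (i'.coord p.1) ∈ i.dom := by rwa [i'.par_coord hi']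
    have hw : j.par (j.coord p.2) ∈ j'.dom := by rwa [j.par_coord hj]
    have h1 : HasJetExpr k i j p fun f a => (deriv (trans i' i) (i'.coord a))⁻¹ := by
      refine HasJetExpr.coeff_change hi hj hi' hj' (c := fun z => (deriv (trans i' i) z.1)⁻¹) ?_
      exact AnalyticAt.fun_comp (g := fun z => (deriv (trans i' i) z)⁻¹) (f := Prod.fst)
        ((analyticAt_trans hz).deriv.inv (deriv_trans_ne_zero hz)) analyticAt_fst
    have h2 : HasJetExpr k i j p fun f a => (deriv (trans j j') (j.coord (f a)))⁻¹ := by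
      refine HasJetExpr.coeff (c := fun z => (deriv (trans j j') z.2)⁻¹) ?_
      exact AnalyticAt.fun_comp (g := fun z => (deriv (trans j j') z)⁻¹) (f := Prod.snd)
        ((analyticAt_trans hw).deriv.inv (deriv_trans_ne_zero hw)) analyticAt_snd
    refine ((HasJetExpr.jet (n := 0) (by omega) hk).mul (h1.mul h2 fun _ _ => rfl)
      fun _ _ => rfl).congr ?_
    filter_upwards [eventually_mem_doms hi hj, eventually_mem_doms hi' hj'] with q hq hq' f a hfa hb
    subst hfa
    simp only [jetCoord]
    rw [deriv_inCharts_change hb hq.1 hq.2 hq'.1 hq'.2, mul_inv, mul_inv]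
    ring
  · exact (hasJetExpr_iteratedDeriv hi hj hi' hj' (n + 1)).mono hn

/-- Jet expressions do not depend on the choice of charts. -/
theorem HasJetExpr.change_charts {i' j' : Chart} (h : HasJetExpr k i' j' p E) (hi : p.1 ∈ i.dom)
    (hj : p.2 ∈ j.dom) (hi' : p.1 ∈ i'.dom) (hj' : p.2 ∈ j'.dom) : HasJetExpr k i j p E :=
  h.mem_of_generators (jetExprRing k i j p) (fun _ _ hE hEF => HasJetExpr.congr hE hEF)
    (fun _ hc => HasJetExpr.coeff_change hi hj hi' hj' hc)
    (fun _ hn hk => hasJetExpr_jetCoord hi hj hi' hj' hn hk)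

/-! #### Inversion -/

theorem eventuallyEq_of_leftInverse {f g g' : P1 → P1} {a : P1} (hf : IsLocalBihol f a)
    (h : ∀ᶠ b in 𝓝 a, g (f b) = b) (h' : ∀ᶠ b in 𝓝 a, g' (f b) = b) : g =ᶠ[𝓝 (f a)] g' := by
  obtain ⟨g₀, hg₀, h1, h2⟩ := hf.exists_inverse
  have hc : Tendsto g₀ (𝓝 (f a)) (𝓝 a) := by
    have := hg₀.continuousAt
    rwa [ContinuousAt, h1.self_of_nhds] at this
  filter_upwards [h2, hc.eventually h, hc.eventually h'] with c hc1 hc2 hc3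
  rw [hc1] at hc2 hc3
  rw [hc2, hc3]

open Classical in
/-- A local inverse of `f` near `f a`. -/
def locInv (f : P1 → P1) (a : P1) : P1 → P1 :=
  if h : IsLocalBihol f a then h.exists_inverse.choose else id

theorem locInv_spec {f : P1 → P1} {a : P1} (hf : IsLocalBihol f a) :
    IsLocalBihol (locInv f a) (f a) ∧ (∀ᶠ b in 𝓝 a, locInv f a (f b) = b) ∧
      ∀ᶠ c in 𝓝 (f a), f (locInv f a c) = c := by
  rw [locInv, dif_pos hf]
  exact hf.exists_inverse.choose_spec

theorem locInv_apply {f : P1 → P1} {a : P1} (hf : IsLocalBihol f a) : locInv f a (f a) = a :=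
  (locInv_spec hf).2.1.self_of_nhds

/-- The local inverses are chosen independently at each point; their germs nevertheless agree at
nearby points, which allows differentiation along the jets of `f`. -/
theorem eventually_locInv_eventuallyEq {f : P1 → P1} {a : P1} (hf : IsLocalBihol f a) :
    ∀ᶠ b in 𝓝 a, locInv f b =ᶠ[𝓝 (f b)] locInv f a := by
  filter_upwards [hf.eventually, (locInv_spec hf).2.1.eventually_nhds] with b hb hb2
  exact eventuallyEq_of_leftInverse hb (locInv_spec hb).2.1 hb2

theorem hasDerivAt_locInv_jet {f : P1 → P1} {a : P1} (hf : IsLocalBihol f a) (hi : a ∈ i.dom)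
    (hj : f a ∈ j.dom) (n : ℕ) :
    HasDerivAt (fun t => iteratedDeriv n (inCharts j i (locInv f (i.par t))) (j.coord (f (i.par t))))
      (iteratedDeriv (n + 1) (inCharts j i (locInv f a)) (j.coord (f a)) *
        deriv (inCharts i j f) (i.coord a)) (i.coord a) := by
  have e1 : inCharts i j f (i.coord a) = j.coord (f a) := inCharts_par i j f hi
  have hg := (locInv_spec hf).1
  have A1 : AnalyticAt ℂ (inCharts j i (locInv f a)) (inCharts i j f (i.coord a)) := by
    rw [e1]
    exact hg.analyticAt hj (by rwa [locInv_apply hf])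
  have d1 := hasDerivAt_iteratedDeriv A1 n
  have d2 := d1.comp _ (hf.analyticAt hi hj).differentiableAt.hasDerivAt
  rw [e1] at d2
  refine d2.congr_of_eventuallyEq ?_
  filter_upwards [i.eventually_par hi (eventually_locInv_eventuallyEq hf),
    i.eventually_par hi (hf.continuousAt (j.isOpen_dom.mem_nhds hj))] with t ht ht2
  exact (inCharts_congr (j := i) ht2 ht).iteratedDeriv_eq n

theorem locInv_id_deriv {f : P1 → P1} {a : P1} (hf : IsLocalBihol f a) (hi : a ∈ i.dom)
    (hj : f a ∈ j.dom) : deriv (inCharts j i (locInv f a)) (j.coord (f a)) *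
        deriv (inCharts i j f) (i.coord a) = 1 := by
  have d := hasDerivAt_locInv_jet hf hi hj 0
  rw [zero_add, iteratedDeriv_one] at d
  refine d.unique ?_
  refine (hasDerivAt_id _).congr_of_eventuallyEq ?_
  filter_upwards [i.eventually_par hi (hf.continuousAt (j.isOpen_dom.mem_nhds hj)),
    i.eventually_par hi hf.eventually] with t ht ht2
  simp only [iteratedDeriv_zero, id]
  rw [inCharts_par j i _ ht, locInv_apply ht2, i.coord_par]

/-- By the chain rule, the derivative in `x` of the `n`-th derivative of the inverse at `f(x)` is
`y₁` times the next one. Dividing by `y₁`, which is allowed in the ring of jets, gives the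
induction. -/
theorem hasJetExpr_locInv_iteratedDeriv (hi : p.1 ∈ i.dom) (hj : p.2 ∈ j.dom) (n : ℕ) :
    HasJetExpr n i j p
      (fun f a => iteratedDeriv n (inCharts j i (locInv f a)) (j.coord (f a))) := by
  induction n with
  | zero =>
    refine (HasJetExpr.coeff (c := Prod.fst) analyticAt_fst).congr ?_
    filter_upwards [eventually_mem_doms hi hj] with q hq f a hfa hb
    subst hfa
    rw [iteratedDeriv_zero, inCharts_par _ _ _ hq.2, locInv_apply hb]
  | succ n ih =>
    obtain ⟨F, hF, hd⟩ := ih.exists_deriv hi hj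
    refine (hF.mul (HasJetExpr.jet (n := 0) (by omega) (by omega)) fun _ _ => rfl).congr ?_
    filter_upwards [hd, eventually_mem_doms hi hj] with q hq hq2 f a hfa hb
    subst hfa
    rw [(hq f a rfl hb).unique (hasDerivAt_locInv_jet hb hq2.1 hq2.2 n)]
    simp only [jetCoord]
    rw [mul_inv_cancel_right₀ (hb.deriv_ne_zero hq2.1 hq2.2)]

theorem tendsto_swap (p : P1 × P1) : Tendsto Prod.swap (𝓝 p) (𝓝 p.swap) :=
  continuous_swap.continuousAt

theorem EqNear.locInv (h : EqNear p.swap E F) :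
    EqNear p (fun f a => E (locInv f a) (f a)) (fun f a => F (locInv f a) (f a)) := by
  filter_upwards [(tendsto_swap p).eventually h] with q hq f a hfa hb
  refine hq _ _ ?_ (locInv_spec hb).1
  rw [locInv_apply hb, ← hfa]
  rfl

theorem HasJetExpr.locInv (h : HasJetExpr k j i p.swap E) (hi : p.1 ∈ i.dom) (hj : p.2 ∈ j.dom) :
    HasJetExpr k i j p fun f a => E (locInv f a) (f a) := by
  let S : Subring ((P1 → P1) × P1 → ℂ) :=
    { carrier := {E | HasJetExpr k i j p fun f a => E (JetP1.locInv f a, f a)}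
      mul_mem' := fun hE hF => hE.mul hF fun _ _ => rfl
      add_mem' := fun hE hF => hE.add hF fun _ _ => rfl
      one_mem' := HasJetExpr.const 1
      zero_mem' := HasJetExpr.const 0
      neg_mem' := fun hE => (HasJetExpr.const (-1)).mul hE fun _ _ => by simp }
  refine h.mem_of_generators S (fun _ _ hE hEF => HasJetExpr.congr hE hEF.locInv) ?_ ?_
  · intro c hc
    have h1 : AnalyticAt ℂ (fun z : ℂ × ℂ => c z.swap) (i.coord p.1, j.coord p.2) :=
      AnalyticAt.fun_comp (g := c) (f := Prod.swap) hc (analyticAt_snd.prod analyticAt_fst)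
    refine HasJetExpr.congr (HasJetExpr.coeff h1) ?_
    filter_upwards with q f a hfa hb
    rw [locInv_apply hb]
    rfl
  · intro n hn hk
    -- Inversion of jets exchanges `y₁` and `1 / y₁` up to the change of base point: the variable of
    -- index `0` of the inverse is `y₁` itself.
    rcases n with _ | n
    · refine HasJetExpr.congr (HasJetExpr.jet (n := 1) hk hk) ?_
      filter_upwards [eventually_mem_doms hi hj] with q hq f a hfa hb
      subst hfa
      simp only [jetCoord, zero_add, iteratedDeriv_one]
      exact inv_eq_of_mul_eq_one_right (locInv_id_deriv hb hq.1 hq.2)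
    · exact (hasJetExpr_locInv_iteratedDeriv hi hj (n + 1)).mono hn

/-! #### Composition -/

/-- This is the formula of Faà di Bruno with unspecified coefficients: all that matters is that the
derivatives of `ψ` occur linearly, with coefficients which are jet expressions in `f`. -/
theorem exists_iteratedDeriv_comp (hi : p.1 ∈ i.dom) (hj : p.2 ∈ j.dom) (n : ℕ) :
    ∃ B : ℕ → (P1 → P1) → P1 → ℂ, (∀ l, HasJetExpr n i j p (B l)) ∧
      ∀ᶠ q in 𝓝 p, ∀ f a, (a, f a) = q → IsLocalBihol f a →
        ∀ ψ : ℂ → ℂ, AnalyticAt ℂ ψ (j.coord (f a)) →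
          iteratedDeriv n (ψ ∘ inCharts i j f) (i.coord a) =
            ∑ l ∈ Finset.range (n + 1), iteratedDeriv l ψ (j.coord (f a)) * B l f a := by
  induction n with
  | zero =>
    refine ⟨fun _ _ _ => 1, fun _ => HasJetExpr.const 1, ?_⟩
    filter_upwards [eventually_mem_doms hi hj] with q hq f a hfa hb ψ hψ
    subst hfa
    simp [inCharts_par i j f hq.1]
  | succ n ih =>
    obtain ⟨B, hB, h⟩ := ih
    choose D hD hd using fun l => (hB l).exists_deriv hi hj
    have hy : HasJetExpr (n + 1) i j p fun f a => jetCoord i j f a 1 :=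
      HasJetExpr.jet (by omega) (by omega)
    -- Differentiating the term of index `l` contributes `B l * y₁` to the index `l + 1` and the
    -- derivative of `B l` to the index `l`. The functions `B l` with `l > n` do not occur in the
    -- formula of order `n` and are arbitrary, hence the condition `l + 1 ≤ n`.
    refine ⟨fun l => match l with
      | 0 => fun f a => D 0 f a
      | l + 1 => fun f a => B l f a * jetCoord i j f a 1 + if l + 1 ≤ n then D (l + 1) f a else 0,
      ?_, ?_⟩
    · intro l
      rcases l with _ | l
      · exact hD 0
      · refine (((hB l).mono (Nat.le_succ n)).mul hy fun _ _ => rfl).add (F := fun f a =>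
          if l + 1 ≤ n then D (l + 1) f a else 0) ?_ fun _ _ => rfl
        split_ifs
        · exact hD _
        · exact HasJetExpr.const 0
    · have hd' : ∀ᶠ q in 𝓝 p, ∀ l ∈ Finset.range (n + 1), ∀ f a, (a, f a) = q →
          IsLocalBihol f a → HasDerivAt (fun t => B l f (i.par t)) (D l f a) (i.coord a) :=
        (Finset.eventually_all _).2 fun l _ => hd l
      filter_upwards [hd', h.eventually_nhds, eventually_mem_doms hi hj] with q hq hq2 hq3 f a hfa
        hb ψ hψ
      subst hfa
      have A := hb.analyticAt hq3.1 hq3.2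
      have e1 : inCharts i j f (i.coord a) = j.coord (f a) := inCharts_par i j f hq3.1
      have hψ' : AnalyticAt ℂ ψ (inCharts i j f (i.coord a)) := by rwa [e1]
      have d1 := hasDerivAt_iteratedDeriv (hψ'.comp A) n
      have d2 : HasDerivAt (fun t => ∑ l ∈ Finset.range (n + 1),
          iteratedDeriv l ψ (inCharts i j f t) * B l f (i.par t))
          (∑ l ∈ Finset.range (n + 1), (iteratedDeriv (l + 1) ψ (inCharts i j f (i.coord a)) *
            deriv (inCharts i j f) (i.coord a) * B l f (i.par (i.coord a)) +
            iteratedDeriv l ψ (inCharts i j f (i.coord a)) * D l f a)) (i.coord a) := by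
        refine HasDerivAt.fun_sum fun l hl => ?_
        exact ((hasDerivAt_iteratedDeriv hψ' l).comp _ A.differentiableAt.hasDerivAt).mul
          (hq l hl f a rfl hb)
      have e : iteratedDeriv n (ψ ∘ inCharts i j f) =ᶠ[𝓝 (i.coord a)] fun t =>
          ∑ l ∈ Finset.range (n + 1), iteratedDeriv l ψ (inCharts i j f t) * B l f (i.par t) := by
        filter_upwards [(hb.tendsto_graph hq3.1).eventually hq2,
          i.eventually_par hq3.1 hb.eventually,
          A.continuousAt.eventually hψ'.eventually_analyticAt] with t h1 h2 h3
        have := h1 f (i.par t) rfl h2 ψ h3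
        rwa [i.coord_par] at this
      rw [(d1.congr_of_eventuallyEq e.symm).unique d2, Finset.sum_range_succ' _ (n + 1)]
      simp only [e1, i.par_coord hq3.1, mul_add, Finset.sum_add_distrib]
      have e3 : ∑ l ∈ Finset.range (n + 1), iteratedDeriv l ψ (j.coord (f a)) * D l f a =
          ∑ l ∈ Finset.range (n + 1), iteratedDeriv (l + 1) ψ (j.coord (f a)) *
            (if l + 1 ≤ n then D (l + 1) f a else 0) + iteratedDeriv 0 ψ (j.coord (f a)) * D 0 f a := by
        rw [Finset.sum_range_succ' _ n, Finset.sum_range_succ _ n]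
        simp only [add_le_iff_nonpos_right, nonpos_iff_eq_zero, one_ne_zero, if_false, mul_zero,
          add_zero]
        congr 1
        refine Finset.sum_congr rfl fun l hl => ?_
        rw [if_pos (by have := Finset.mem_range.1 hl; omega)]
      rw [e3, add_assoc]
      congr 1
      refine Finset.sum_congr rfl fun l _ => ?_
      simp only [jetCoord, zero_add, iteratedDeriv_one]
      ring

end

/-! ### Functions of pairs of composable jets -/

section

variable {k : ℕ} {i j l : Chart} {x y z : P1}

/-- Two functions of pairs of composable jets agree near the point `(x, y, z)`. -/
def PairEqNear (x y z : P1) (A A' : (P1 → P1) → (P1 → P1) → P1 → ℂ) : Prop :=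
  ∀ᶠ q in 𝓝 (x, y, z), ∀ f g a, (a, f a, g (f a)) = q →
    IsLocalBihol f a → IsLocalBihol g (f a) → A f g a = A' f g a

/-- `A` is polynomial in the coordinates of pairs of jets of order `k`, in the charts
`i`, `j`, `l`. -/
def HasPairExpr (k : ℕ) (i j l : Chart) (x y z : P1) (A : (P1 → P1) → (P1 → P1) → P1 → ℂ) : Prop :=
  ∃ Q : MvPolynomial (ℕ ⊕ ℕ) (ℂ × ℂ × ℂ → ℂ),
    (∀ n, Sum.inl n ∈ Q.vars ∨ Sum.inr n ∈ Q.vars → n ≤ k ∧ 1 ≤ k) ∧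
    (∀ m, AnalyticAt ℂ (Q.coeff m) (i.coord x, j.coord y, l.coord z)) ∧
    PairEqNear x y z A fun f g a => Q.eval₂
      (Pi.evalRingHom (fun _ : ℂ × ℂ × ℂ => ℂ) (i.coord a, j.coord (f a), l.coord (g (f a))))
      (Sum.elim (jetCoord i j f a) (jetCoord j l g (f a)))

theorem tendsto_pair₁ (x y z : P1) :
    Tendsto (fun q : P1 × P1 × P1 => (q.1, q.2.1)) (𝓝 (x, y, z)) (𝓝 (x, y)) :=
  (continuous_fst.prodMk continuous_snd.fst).continuousAt

theorem tendsto_pair₂ (x y z : P1) :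
    Tendsto (fun q : P1 × P1 × P1 => (q.2.1, q.2.2)) (𝓝 (x, y, z)) (𝓝 (y, z)) :=
  continuous_snd.continuousAt

theorem tendsto_pair₃ (x y z : P1) :
    Tendsto (fun q : P1 × P1 × P1 => (q.1, q.2.2)) (𝓝 (x, y, z)) (𝓝 (x, z)) :=
  (continuous_fst.prodMk continuous_snd.snd).continuousAt

theorem EqNear.pair₁ {E F : (P1 → P1) → P1 → ℂ} (h : EqNear (x, y) E F) :
    PairEqNear x y z (fun f _ a => E f a) (fun f _ a => F f a) := by
  filter_upwards [(tendsto_pair₁ x y z).eventually h] with q hq f g a hfa hf _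
  subst hfa
  exact hq f a rfl hf

theorem EqNear.pair₂ {E F : (P1 → P1) → P1 → ℂ} (h : EqNear (y, z) E F) :
    PairEqNear x y z (fun f g a => E g (f a)) (fun f g a => F g (f a)) := by
  filter_upwards [(tendsto_pair₂ x y z).eventually h] with q hq f g a hfa _ hg
  subst hfa
  exact hq g (f a) rfl hg

theorem EqNear.pair₃ {E F : (P1 → P1) → P1 → ℂ} (h : EqNear (x, z) E F) :
    PairEqNear x y z (fun f g a => E (g ∘ f) a) (fun f g a => F (g ∘ f) a) := by
  filter_upwards [(tendsto_pair₃ x y z).eventually h] with q hq f g a hfa hf hg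
  subst hfa
  exact hq (g ∘ f) a rfl (hg.comp hf)

variable {A A' A'' : (P1 → P1) → (P1 → P1) → P1 → ℂ}

theorem PairEqNear.trans (h : PairEqNear x y z A A') (h' : PairEqNear x y z A' A'') :
    PairEqNear x y z A A'' := by
  filter_upwards [h, h'] with q h1 h2 f g a hfa hf hg
  rw [h1 f g a hfa hf hg, h2 f g a hfa hf hg]

theorem PairEqNear.of_forall (h : ∀ f g a, IsLocalBihol f a → IsLocalBihol g (f a) →
    A f g a = A' f g a) : PairEqNear x y z A A' :=
  Eventually.of_forall fun _ f g a _ hf hg => h f g a hf hg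

theorem HasPairExpr.congr (h : HasPairExpr k i j l x y z A) (h' : PairEqNear x y z A' A) :
    HasPairExpr k i j l x y z A' := by
  obtain ⟨Q, h1, h2, h3⟩ := h
  exact ⟨Q, h1, h2, h'.trans h3⟩

theorem HasPairExpr.add (h : HasPairExpr k i j l x y z A) (h' : HasPairExpr k i j l x y z A') :
    HasPairExpr k i j l x y z fun f g a => A f g a + A' f g a := by
  classical
  obtain ⟨Q, h1, h2, h3⟩ := h
  obtain ⟨Q', h1', h2', h3'⟩ := h'
  refine ⟨Q + Q', ?_, ?_, ?_⟩
  · rintro n (hn | hn)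
    · rcases Finset.mem_union.1 (MvPolynomial.vars_add_subset _ _ hn) with h | h
      exacts [h1 n (Or.inl h), h1' n (Or.inl h)]
    · rcases Finset.mem_union.1 (MvPolynomial.vars_add_subset _ _ hn) with h | h
      exacts [h1 n (Or.inr h), h1' n (Or.inr h)]
  · intro m
    rw [MvPolynomial.coeff_add]
    exact (h2 m).add (h2' m)
  · filter_upwards [h3, h3'] with q hq hq' f g a hfa hf hg
    rw [hq f g a hfa hf hg, hq' f g a hfa hf hg, MvPolynomial.eval₂_add]

theorem HasPairExpr.mul (h : HasPairExpr k i j l x y z A) (h' : HasPairExpr k i j l x y z A') :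
    HasPairExpr k i j l x y z fun f g a => A f g a * A' f g a := by
  classical
  obtain ⟨Q, h1, h2, h3⟩ := h
  obtain ⟨Q', h1', h2', h3'⟩ := h'
  refine ⟨Q * Q', ?_, ?_, ?_⟩
  · rintro n (hn | hn)
    · rcases Finset.mem_union.1 (MvPolynomial.vars_mul _ _ hn) with h | h
      exacts [h1 n (Or.inl h), h1' n (Or.inl h)]
    · rcases Finset.mem_union.1 (MvPolynomial.vars_mul _ _ hn) with h | h
      exacts [h1 n (Or.inr h), h1' n (Or.inr h)]
  · intro m
    rw [MvPolynomial.coeff_mul]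
    exact Finset.analyticAt_sum _ fun x _ => (h2 x.1).mul (h2' x.2)
  · filter_upwards [h3, h3'] with q hq hq' f g a hfa hf hg
    rw [hq f g a hfa hf hg, hq' f g a hfa hf hg, MvPolynomial.eval₂_mul]

theorem HasPairExpr.coeff {c : ℂ × ℂ × ℂ → ℂ}
    (hc : AnalyticAt ℂ c (i.coord x, j.coord y, l.coord z)) :
    HasPairExpr k i j l x y z
      (fun f g a => c (i.coord a, j.coord (f a), l.coord (g (f a)))) := by
  classical
  refine ⟨MvPolynomial.C c, by simp, ?_, ?_⟩
  · intro m
    rw [MvPolynomial.coeff_C]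
    split_ifs
    · exact hc
    · exact analyticAt_const
  · refine PairEqNear.of_forall fun f g a _ _ => ?_
    rw [MvPolynomial.eval₂_C]
    rfl

theorem HasPairExpr.const (c : ℂ) : HasPairExpr k i j l x y z (fun _ _ _ => c) :=
  HasPairExpr.coeff (c := fun _ => c) analyticAt_const

theorem HasPairExpr.var {s : ℕ ⊕ ℕ} (hs : s.elim id id ≤ k) (hk : 1 ≤ k) :
    HasPairExpr k i j l x y z
      (fun f g a => Sum.elim (jetCoord i j f a) (jetCoord j l g (f a)) s) := by
  classical
  refine ⟨MvPolynomial.X s, ?_, ?_, ?_⟩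
  · intro n hn
    rw [MvPolynomial.vars_X, Finset.mem_singleton, Finset.mem_singleton] at hn
    refine ⟨?_, hk⟩
    rcases hn with rfl | rfl <;> exact hs
  · intro m
    rw [MvPolynomial.coeff_X]
    split_ifs
    · exact analyticAt_const
    · exact analyticAt_const
  · refine PairEqNear.of_forall fun f g a _ _ => ?_
    rw [MvPolynomial.eval₂_X]

/-- The ring of functions which are polynomial in the coordinates of pairs of jets. -/
def pairExprRing (k : ℕ) (i j l : Chart) (x y z : P1) :
    Subring ((P1 → P1) × (P1 → P1) × P1 → ℂ) where
  carrier := {A | HasPairExpr k i j l x y z fun f g a => A (f, g, a)}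
  mul_mem' := fun hE hF => HasPairExpr.mul hE hF
  add_mem' := fun hE hF => HasPairExpr.add hE hF
  one_mem' := HasPairExpr.const 1
  zero_mem' := HasPairExpr.const 0
  neg_mem' := fun hE => ((HasPairExpr.const (-1)).mul hE).congr
    (PairEqNear.of_forall fun _ _ _ _ _ => by simp)

theorem HasPairExpr.mem_ring (h : HasPairExpr k i j l x y z A) :
    (fun w : (P1 → P1) × (P1 → P1) × P1 => A w.1 w.2.1 w.2.2) ∈ pairExprRing k i j l x y z := h

theorem HasPairExpr.of_mem_ring {A : (P1 → P1) × (P1 → P1) × P1 → ℂ}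
    (h : A ∈ pairExprRing k i j l x y z) : HasPairExpr k i j l x y z fun f g a => A (f, g, a) := h

theorem HasPairExpr.sum {ι : Type*} (s : Finset ι) {A : ι → (P1 → P1) → (P1 → P1) → P1 → ℂ}
    (h : ∀ m ∈ s, HasPairExpr k i j l x y z (A m)) :
    HasPairExpr k i j l x y z fun f g a => ∑ m ∈ s, A m f g a := by
  have := ((pairExprRing k i j l x y z).sum_mem fun m hm => (h m hm).mem_ring)
  simpa [Finset.sum_apply] using HasPairExpr.of_mem_ring this

theorem HasPairExpr.mem_of_generators (S : Subring ((P1 → P1) × (P1 → P1) × P1 → ℂ))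
    (hS : ∀ A A' : (P1 → P1) × (P1 → P1) × P1 → ℂ, A ∈ S →
      PairEqNear x y z (fun f g a => A' (f, g, a)) (fun f g a => A (f, g, a)) → A' ∈ S)
    (hc : ∀ c : ℂ × ℂ × ℂ → ℂ, AnalyticAt ℂ c (i.coord x, j.coord y, l.coord z) →
      (fun w : (P1 → P1) × (P1 → P1) × P1 =>
        c (i.coord w.2.2, j.coord (w.1 w.2.2), l.coord (w.2.1 (w.1 w.2.2)))) ∈ S)
    (hv₁ : ∀ n, n ≤ k → 1 ≤ k →
      (fun w : (P1 → P1) × (P1 → P1) × P1 => jetCoord i j w.1 w.2.2 n) ∈ S)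
    (hv₂ : ∀ n, n ≤ k → 1 ≤ k →
      (fun w : (P1 → P1) × (P1 → P1) × P1 => jetCoord j l w.2.1 (w.1 w.2.2) n) ∈ S)
    (h : HasPairExpr k i j l x y z A) :
    (fun w : (P1 → P1) × (P1 → P1) × P1 => A w.1 w.2.1 w.2.2) ∈ S := by
  obtain ⟨Q, h1, h2, h3⟩ := h
  have := eval₂_mem_of_mem S (fun w : (P1 → P1) × (P1 → P1) × P1 =>
      (i.coord w.2.2, j.coord (w.1 w.2.2), l.coord (w.2.1 (w.1 w.2.2))))
    (fun w => Sum.elim (jetCoord i j w.1 w.2.2) (jetCoord j l w.2.1 (w.1 w.2.2))) Q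
    (fun m => hc _ (h2 m)) (by
      rintro (n | n) hn
      · exact hv₁ n (h1 n (Or.inl hn)).1 (h1 n (Or.inl hn)).2
      · exact hv₂ n (h1 n (Or.inr hn)).1 (h1 n (Or.inr hn)).2)
  exact hS _ _ this h3

theorem eventually_mem_doms₃ (hi : x ∈ i.dom) (hj : y ∈ j.dom) (hl : z ∈ l.dom) :
    ∀ᶠ q in 𝓝 (x, y, z), q.1 ∈ i.dom ∧ q.2.1 ∈ j.dom ∧ q.2.2 ∈ l.dom :=
  (i.isOpen_dom.prod (j.isOpen_dom.prod l.isOpen_dom)).mem_nhds ⟨hi, hj, hl⟩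

theorem HasJetExpr.pair₁ {E : (P1 → P1) → P1 → ℂ} (h : HasJetExpr k i j (x, y) E) :
    HasPairExpr k i j l x y z fun f _ a => E f a := by
  let S : Subring ((P1 → P1) × P1 → ℂ) :=
    { carrier := {E | HasPairExpr k i j l x y z fun f _ a => E (f, a)}
      mul_mem' := fun hE hF => HasPairExpr.mul hE hF
      add_mem' := fun hE hF => HasPairExpr.add hE hF
      one_mem' := HasPairExpr.const 1
      zero_mem' := HasPairExpr.const 0
      neg_mem' := fun hE => ((HasPairExpr.const (-1)).mul hE).congr
        (PairEqNear.of_forall fun _ _ _ _ _ => by simp) }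
  refine h.mem_of_generators S (fun _ _ hE hEF => HasPairExpr.congr hE hEF.pair₁) ?_ ?_
  · intro c hc
    exact HasPairExpr.coeff (c := fun w => c (w.1, w.2.1))
      (AnalyticAt.fun_comp (g := c) (f := fun w : ℂ × ℂ × ℂ => (w.1, w.2.1)) hc
        (analyticAt_fst.prod (analyticAt_fst.fun_comp analyticAt_snd)))
  · intro n hn hk
    exact HasPairExpr.var (s := Sum.inl n) hn hk

theorem HasJetExpr.pair₂ {E : (P1 → P1) → P1 → ℂ} (h : HasJetExpr k j l (y, z) E) :
    HasPairExpr k i j l x y z fun f g a => E g (f a) := by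
  let S : Subring ((P1 → P1) × P1 → ℂ) :=
    { carrier := {E | HasPairExpr k i j l x y z fun f g a => E (g, f a)}
      mul_mem' := fun hE hF => HasPairExpr.mul hE hF
      add_mem' := fun hE hF => HasPairExpr.add hE hF
      one_mem' := HasPairExpr.const 1
      zero_mem' := HasPairExpr.const 0
      neg_mem' := fun hE => ((HasPairExpr.const (-1)).mul hE).congr
        (PairEqNear.of_forall fun _ _ _ _ _ => by simp) }
  refine h.mem_of_generators S (fun _ _ hE hEF => HasPairExpr.congr hE hEF.pair₂) ?_ ?_
  · intro c hc
    exact HasPairExpr.coeff (c := fun w => c w.2)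
      (AnalyticAt.fun_comp (g := c) (f := fun w : ℂ × ℂ × ℂ => w.2) hc analyticAt_snd)
  · intro n hn hk
    exact HasPairExpr.var (s := Sum.inr n) hn hk

/-- Expressions for functions of pairs of jets do not depend on the choice of charts. -/
theorem HasPairExpr.isPairFunction (h : HasPairExpr k i j l x y z A) (hi : x ∈ i.dom)
    (hj : y ∈ j.dom) (hl : z ∈ l.dom) : IsPairFunction k x y z A := by
  intro i' j' l' hi' hj' hl'
  refine h.mem_of_generators (pairExprRing k i' j' l' x y z)
    (fun _ _ hE hEF => HasPairExpr.congr hE hEF) ?_ ?_ ?_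
  · intro c hc
    have a1 : AnalyticAt ℂ (fun w : ℂ × ℂ × ℂ => trans i' i w.1)
        (i'.coord x, j'.coord y, l'.coord z) :=
      AnalyticAt.fun_comp (g := trans i' i) (f := Prod.fst)
        (analyticAt_coord_change (p := (x, y)) hi' hi) analyticAt_fst
    have a2 : AnalyticAt ℂ (fun w : ℂ × ℂ × ℂ => trans j' j w.2.1)
        (i'.coord x, j'.coord y, l'.coord z) :=
      AnalyticAt.fun_comp (g := trans j' j) (f := fun w : ℂ × ℂ × ℂ => w.2.1)
        (analyticAt_coord_change (p := (y, x)) hj' hj) (analyticAt_fst.fun_comp analyticAt_snd)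
    have a3 : AnalyticAt ℂ (fun w : ℂ × ℂ × ℂ => trans l' l w.2.2)
        (i'.coord x, j'.coord y, l'.coord z) :=
      AnalyticAt.fun_comp (g := trans l' l) (f := fun w : ℂ × ℂ × ℂ => w.2.2)
        (analyticAt_coord_change (p := (z, x)) hl' hl) (analyticAt_snd.fun_comp analyticAt_snd)
    have a4 : AnalyticAt ℂ (fun w : ℂ × ℂ × ℂ => c (trans i' i w.1, trans j' j w.2.1,
        trans l' l w.2.2)) (i'.coord x, j'.coord y, l'.coord z) := by
      refine AnalyticAt.fun_comp (g := c) ?_ (a1.prod (a2.prod a3))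
      rwa [trans_coord _ _ hi', trans_coord _ _ hj', trans_coord _ _ hl']
    refine HasPairExpr.congr (HasPairExpr.coeff a4) ?_
    filter_upwards [eventually_mem_doms₃ hi' hj' hl'] with q hq f g a hfa _ _
    subst hfa
    rw [trans_coord _ _ hq.1, trans_coord _ _ hq.2.1, trans_coord _ _ hq.2.2]
  · intro n hn hk
    exact (hasJetExpr_jetCoord (p := (x, y)) hi' hj' hi hj hn hk).pair₁
  · intro n hn hk
    exact (hasJetExpr_jetCoord (p := (y, z)) hj' hl' hj hl hn hk).pair₂

/-- The coordinates of a composed jet are polynomial in those of the two jets: the inverse first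
derivatives multiply, and the higher derivatives are given by `exists_iteratedDeriv_comp`. -/
theorem HasJetExpr.pair_comp {E : (P1 → P1) → P1 → ℂ} (h : HasJetExpr k i l (x, z) E)
    (hi : x ∈ i.dom) (hj : y ∈ j.dom) (hl : z ∈ l.dom) :
    HasPairExpr k i j l x y z fun f g a => E (g ∘ f) a := by
  let S : Subring ((P1 → P1) × P1 → ℂ) :=
    { carrier := {E | HasPairExpr k i j l x y z fun f g a => E (g ∘ f, a)}
      mul_mem' := fun hE hF => HasPairExpr.mul hE hF
      add_mem' := fun hE hF => HasPairExpr.add hE hF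
      one_mem' := HasPairExpr.const 1
      zero_mem' := HasPairExpr.const 0
      neg_mem' := fun hE => ((HasPairExpr.const (-1)).mul hE).congr
        (PairEqNear.of_forall fun _ _ _ _ _ => by simp) }
  refine h.mem_of_generators S (fun _ _ hE hEF => HasPairExpr.congr hE hEF.pair₃) ?_ ?_
  · intro c hc
    exact HasPairExpr.coeff (c := fun w => c (w.1, w.2.2))
      (AnalyticAt.fun_comp (g := c) (f := fun w : ℂ × ℂ × ℂ => (w.1, w.2.2)) hc
        (analyticAt_fst.prod (analyticAt_snd.fun_comp analyticAt_snd)))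
  · intro n hn hk
    rcases n with _ | n
    · refine HasPairExpr.congr ((HasPairExpr.var (s := Sum.inl 0) (by simp) hk).mul
        (HasPairExpr.var (s := Sum.inr 0) (by simp) hk)) ?_
      filter_upwards [eventually_mem_doms₃ hi hj hl] with q hq f g a hfa hf hg
      subst hfa
      simp only [Sum.elim_inl, Sum.elim_inr, jetCoord]
      have e := inCharts_comp_eventuallyEq (g := g) (l := l) hq.1 hq.2.1 hf.continuousAt
      have e1 : inCharts i j f (i.coord a) = j.coord (f a) := inCharts_par i j f hq.1
      have A2 : AnalyticAt ℂ (inCharts j l g) (inCharts i j f (i.coord a)) := by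
        rw [e1]
        exact hg.analyticAt hq.2.1 hq.2.2
      rw [e.deriv_eq, deriv_comp _ A2.differentiableAt
        (hf.analyticAt hq.1 hq.2.1).differentiableAt, e1, mul_inv, mul_comm]
    · obtain ⟨B, hB, h⟩ := exists_iteratedDeriv_comp (p := (x, y)) hi hj (n + 1)
      have hsum : HasPairExpr k i j l x y z fun f g a => ∑ r ∈ Finset.range (n + 1 + 1),
          iteratedDeriv r (inCharts j l g) (j.coord (f a)) * B r f a := by
        refine HasPairExpr.sum _ fun r hr => HasPairExpr.mul ?_ ((hB r).mono hn).pair₁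
        have := hasJetExpr_iteratedDeriv (p := (y, z)) hj hl hj hl r
        exact (this.mono (by have := Finset.mem_range.1 hr; omega)).pair₂
      refine HasPairExpr.congr hsum ?_
      filter_upwards [eventually_mem_doms₃ hi hj hl, (tendsto_pair₁ x y z).eventually h]
        with q hq hq2 f g a hfa hf hg
      subst hfa
      have e := inCharts_comp_eventuallyEq (g := g) (l := l) hq.1 hq.2.1 hf.continuousAt
      simp only [jetCoord]
      rw [e.iteratedDeriv_eq]
      exact hq2 f a rfl hf _ (hg.analyticAt hq.2.1 hq.2.2)

end

/-! ### Meromorphic affine structures -/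

open Polynomial in
/-- A meromorphic affine structure on the projective line: its local flat coordinates `φ` satisfy
`φ'' / φ' = num / den` in the affine chart. -/
structure AffineData : Type where
  /-- the numerator of the connection coefficient -/
  num : ℂ[X]
  /-- the denominator of the connection coefficient -/
  den : ℂ[X]
  den_ne_zero : den ≠ 0

/-- The equation `μ₂(φ) φ'² + φ'' = μ₁ φ'` at the point `t`. -/
def ConnEq (μ₁ μ₂ φ : ℂ → ℂ) (t : ℂ) : Prop :=
  μ₂ (φ t) * deriv φ t ^ 2 + deriv (deriv φ) t = μ₁ t * deriv φ t

theorem deriv_comp_eventuallyEq {φ ψ : ℂ → ℂ} {t : ℂ} (hφ : AnalyticAt ℂ φ t)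
    (hψ : AnalyticAt ℂ ψ (φ t)) :
    deriv (ψ ∘ φ) =ᶠ[𝓝 t] fun s => deriv ψ (φ s) * deriv φ s := by
  filter_upwards [hφ.eventually_analyticAt, hφ.continuousAt.eventually hψ.eventually_analyticAt]
    with s h1 h2
  exact deriv_comp _ h2.differentiableAt h1.differentiableAt

theorem deriv_deriv_comp {φ ψ : ℂ → ℂ} {t : ℂ} (hφ : AnalyticAt ℂ φ t)
    (hψ : AnalyticAt ℂ ψ (φ t)) :
    deriv (deriv (ψ ∘ φ)) t =
      deriv (deriv ψ) (φ t) * deriv φ t ^ 2 + deriv ψ (φ t) * deriv (deriv φ) t := by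
  rw [(deriv_comp_eventuallyEq hφ hψ).deriv_eq]
  have h1 : HasDerivAt (fun s => deriv ψ (φ s)) (deriv (deriv ψ) (φ t) * deriv φ t) t :=
    hψ.deriv.differentiableAt.hasDerivAt.comp t hφ.differentiableAt.hasDerivAt
  rw [(h1.fun_mul hφ.deriv.differentiableAt.hasDerivAt).deriv]
  ring

section ConnEq

variable {μ₁ μ₂ μ₃ φ ψ : ℂ → ℂ} {t : ℂ}

theorem ConnEq.congr {φ' : ℂ → ℂ} (h : ConnEq μ₁ μ₂ φ t) (e : φ =ᶠ[𝓝 t] φ') :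
    ConnEq μ₁ μ₂ φ' t := by
  rw [ConnEq] at h ⊢
  rwa [← e.eq_of_nhds, ← e.deriv_eq, ← e.deriv.deriv_eq]

/-- The equation says that `φ` carries the connection `μ₁` to `μ₂`, a relation which is transitive
by the chain rule. With `μ₂ = 0` it says that `φ` is a flat coordinate for `μ₁`. -/
theorem ConnEq.comp (hφ : AnalyticAt ℂ φ t) (hψ : AnalyticAt ℂ ψ (φ t))
    (h : ConnEq μ₁ μ₂ φ t) (h' : ConnEq μ₂ μ₃ ψ (φ t)) : ConnEq μ₁ μ₃ (ψ ∘ φ) t := by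
  rw [ConnEq] at h h' ⊢
  rw [deriv_deriv_comp hφ hψ, deriv_comp _ hψ.differentiableAt hφ.differentiableAt]
  simp only [Function.comp]
  linear_combination deriv φ t ^ 2 * h' + deriv ψ (φ t) * h

theorem ConnEq.of_comp (hφ : AnalyticAt ℂ φ t) (hψ : AnalyticAt ℂ ψ (φ t))
    (h : ConnEq μ₁ μ₂ φ t) (h' : ConnEq μ₁ μ₃ (ψ ∘ φ) t) (hd : deriv φ t ≠ 0) :
    ConnEq μ₂ μ₃ ψ (φ t) := by
  rw [ConnEq] at h h' ⊢
  rw [deriv_deriv_comp hφ hψ, deriv_comp _ hψ.differentiableAt hφ.differentiableAt] at h'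
  simp only [Function.comp] at h'
  have h2 : deriv φ t ^ 2 ≠ 0 := pow_ne_zero _ hd
  apply mul_left_cancel₀ h2
  linear_combination h' - deriv ψ (φ t) * h

theorem connEq_id (μ : ℂ → ℂ) (t : ℂ) : ConnEq μ μ id t := by
  have : deriv (id : ℂ → ℂ) = fun _ => 1 := deriv_id'
  simp [ConnEq, this]

end ConnEq

namespace AffineData

variable (D : AffineData)

/-- The connection coefficient in a chart. -/
def mu : Chart → ℂ → ℂ
  | .affine => fun z => D.num.eval z / D.den.eval z
  | .infinity => fun w => -(D.num.eval w⁻¹ / D.den.eval w⁻¹) / w ^ 2 - 2 / w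

/-- A bound for the degrees of the numerator and the denominator. -/
def deg : ℕ := max D.num.natDegree D.den.natDegree

open Polynomial in
/-- A polynomial denominator for the connection coefficient in a chart. -/
def cden : Chart → ℂ[X]
  | .affine => D.den
  | .infinity => X ^ 2 * D.den.reflect D.deg

open Polynomial in
/-- A polynomial numerator for the connection coefficient in a chart. -/
def cnum : Chart → ℂ[X]
  | .affine => D.num
  | .infinity => -D.num.reflect D.deg - 2 * X * D.den.reflect D.deg

/-- The regular points: those of `ℂ \ {0}` which are not zeros of the denominator. -/
def Reg (a : P1) : Prop := ∃ z : ℂ, z ≠ 0 ∧ D.den.eval z ≠ 0 ∧ a = (z : P1)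

variable {D}

theorem cden_ne_zero (i : Chart) : D.cden i ≠ 0 := by
  cases i
  · exact D.den_ne_zero
  · exact mul_ne_zero (pow_ne_zero _ Polynomial.X_ne_zero)
      (by rw [Ne, Polynomial.reflect_eq_zero_iff]; exact D.den_ne_zero)

/-- The point `0` is excluded from the regular points, besides infinity, so that a regular point
lies in both charts and the charts may be chosen freely. -/
theorem Reg.mem_dom {a : P1} (h : D.Reg a) (i : Chart) : a ∈ i.dom := by
  obtain ⟨z, h0, -, rfl⟩ := h
  cases i
  · simp [Chart.dom]
  · simpa [Chart.dom] using h0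

theorem eval_reflect {q : Polynomial ℂ} {n : ℕ} (hn : q.natDegree ≤ n) {z : ℂ} (hz : z ≠ 0) :
    (q.reflect n).eval z⁻¹ * z ^ n = q.eval z := by
  have := invertibleOfNonzero hz
  have := Polynomial.eval₂_reflect_mul_pow (RingHom.id ℂ) z n q hn
  rwa [invOf_eq_inv] at this

theorem Reg.cden_ne_zero {a : P1} (h : D.Reg a) (i : Chart) : (D.cden i).eval (i.coord a) ≠ 0 := by
  obtain ⟨z, h0, hz, rfl⟩ := h
  cases i
  · exact hz
  · have h1 := eval_reflect (le_max_right D.num.natDegree D.den.natDegree) h0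
    have h2 : Chart.infinity.coord (z : P1) = z⁻¹ := rfl
    rw [h2]
    simp only [cden, Polynomial.eval_mul, Polynomial.eval_pow, Polynomial.eval_X]
    refine mul_ne_zero (pow_ne_zero _ (inv_ne_zero h0)) fun h3 => hz ?_
    rw [← h1]
    change (D.den.reflect D.deg).eval z⁻¹ * _ = 0
    rw [h3, zero_mul]

theorem Reg.mu_eq {a : P1} (h : D.Reg a) (i : Chart) :
    D.mu i (i.coord a) = (D.cnum i).eval (i.coord a) / (D.cden i).eval (i.coord a) := by
  have hne := h.cden_ne_zero i
  obtain ⟨z, h0, hz, rfl⟩ := h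
  cases i
  · rfl
  · have h1 : (D.den.reflect D.deg).eval z⁻¹ * z ^ D.deg = D.den.eval z :=
      eval_reflect (le_max_right D.num.natDegree D.den.natDegree) h0
    have h3 : (D.num.reflect D.deg).eval z⁻¹ * z ^ D.deg = D.num.eval z :=
      eval_reflect (le_max_left D.num.natDegree D.den.natDegree) h0
    have h2 : Chart.infinity.coord (z : P1) = z⁻¹ := rfl
    rw [h2] at hne ⊢
    simp only [cden, cnum, mu, Polynomial.eval_mul, Polynomial.eval_pow, Polynomial.eval_X,
      Polynomial.eval_sub, Polynomial.eval_neg, Polynomial.eval_ofNat, inv_inv] at hne ⊢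
    rw [← h1, ← h3]
    have h4 : (D.den.reflect D.deg).eval z⁻¹ ≠ 0 := right_ne_zero_of_mul hne
    have h5 : z ^ D.deg ≠ 0 := pow_ne_zero _ h0
    generalize (D.den.reflect D.deg).eval z⁻¹ = b at h4 ⊢
    generalize (D.num.reflect D.deg).eval z⁻¹ = c
    field_simp

theorem finite_not_reg : {a : P1 | ¬ D.Reg a}.Finite := by
  have h1 : ({OnePoint.infty, ((0 : ℂ) : P1)} ∪
      ((↑) : ℂ → P1) '' {z | D.den.IsRoot z} : Set P1).Finite :=
    (Set.toFinite _).union ((Polynomial.finite_setOfPred_isRoot D.den_ne_zero).image _)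
  refine h1.subset fun a ha => ?_
  induction a using OnePoint.rec
  · exact Or.inl (Or.inl rfl)
  · rename_i z
    by_cases h0 : z = 0
    · exact Or.inl (Or.inr (by rw [h0]; rfl))
    · refine Or.inr ⟨z, ?_, rfl⟩
      by_contra hz
      exact ha ⟨z, h0, hz, rfl⟩

theorem isOpen_reg : IsOpen {a : P1 | D.Reg a} := by
  have := (finite_not_reg (D := D)).isClosed.isOpen_compl
  convert this using 1
  ext a
  simp

theorem Reg.eventually {a : P1} (h : D.Reg a) : ∀ᶠ b in 𝓝 a, D.Reg b :=
  isOpen_reg.mem_nhds h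

theorem eventually_reg (a : P1) : ∀ᶠ b in 𝓝[≠] a, D.Reg b := by
  have h1 : ({b : P1 | ¬ D.Reg b} \ {a})ᶜ ∈ 𝓝 a :=
    (finite_not_reg (D := D)).sdiff.isClosed.isOpen_compl.mem_nhds (by simp)
  rw [eventually_nhdsWithin_iff]
  filter_upwards [h1] with b hb hba
  by_contra h
  exact hb ⟨h, hba⟩

/-- This relation is what dictates the formula `-μ(1 / w) / w² - 2 / w` for the connection
coefficient at infinity; the term `-2 / w` comes from the second derivative of `1 / w`. -/
theorem connEq_trans (i j : Chart) {z : ℂ} (hz : i.par z ∈ j.dom) :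
    ConnEq (D.mu i) (D.mu j) (trans i j) z := by
  by_cases hij : i = j
  · subst hij
    rw [trans_self]
    exact connEq_id _ _
  · have h0 := ne_zero_of_mem_dom hij hz
    rw [trans_of_ne hij]
    have d1 : deriv (fun z : ℂ => z⁻¹) = fun z => -(z ^ 2)⁻¹ := by
      funext w
      exact deriv_inv
    have d2 : deriv (fun z : ℂ => -(z ^ 2)⁻¹) z = 2 * z / (z ^ 2) ^ 2 := by
      have : HasDerivAt (fun z : ℂ => z ^ 2) (2 * z) z := by
        simpa using hasDerivAt_pow 2 z
      have := (this.fun_inv (pow_ne_zero 2 h0)).fun_neg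
      rw [this.deriv]
      ring
    rw [ConnEq, d1, d2]
    cases i <;> cases j
    · exact absurd rfl hij
    · simp only [mu, inv_inv]
      field_simp
      ring
    · simp only [mu]
      field_simp
      ring
    · exact absurd rfl hij

variable (D)

/-- `f` is, at `a`, a local biholomorphism between regular points which preserves the affine
structure. -/
def Sol (f : P1 → P1) (a : P1) : Prop :=
  D.Reg a ∧ D.Reg (f a) ∧ IsLocalBihol f a ∧
    ∀ᶠ t in 𝓝 (Chart.affine.coord a),
      ConnEq (D.mu .affine) (D.mu .affine) (inCharts .affine .affine f) t

variable {D} {f g : P1 → P1} {a : P1}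

theorem connEq_change {i j i' j' : Chart} (hf : IsLocalBihol f a) (hi : a ∈ i.dom)
    (hj : f a ∈ j.dom) (hi' : a ∈ i'.dom) (hj' : f a ∈ j'.dom)
    (h : ConnEq (D.mu i) (D.mu j) (inCharts i j f) (i.coord a)) :
    ConnEq (D.mu i') (D.mu j') (inCharts i' j' f) (i'.coord a) := by
  have e := inCharts_trans_eventuallyEq hi hj hf.continuousAt hi' (j' := j')
  have hz : i'.par (i'.coord a) ∈ i.dom := by rwa [i'.par_coord hi']
  have hw : j.par (j.coord (f a)) ∈ j'.dom := by rwa [j.par_coord hj]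
  have e1 : trans i' i (i'.coord a) = i.coord a := trans_coord _ _ hi'
  have A2 : AnalyticAt ℂ (inCharts i j f) (trans i' i (i'.coord a)) := by
    rw [e1]
    exact hf.analyticAt hi hj
  have h2 : ConnEq (D.mu i) (D.mu j) (inCharts i j f) (trans i' i (i'.coord a)) := by rwa [e1]
  have e2 : (inCharts i j f ∘ trans i' i) (i'.coord a) = j.coord (f a) := by
    rw [Function.comp, e1, inCharts_par i j f hi]
  refine ConnEq.congr ?_ e.symm
  refine ConnEq.comp (A2.comp (analyticAt_trans hz)) ?_
    (ConnEq.comp (analyticAt_trans hz) A2 (connEq_trans _ _ hz) h2) ?_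
  · rw [e2]
    exact analyticAt_trans hw
  · rw [e2]
    exact connEq_trans _ _ hw

theorem Sol.connEq (h : D.Sol f a) (i j : Chart) :
    ConnEq (D.mu i) (D.mu j) (inCharts i j f) (i.coord a) :=
  connEq_change h.2.2.1 (h.1.mem_dom _) (h.2.1.mem_dom _) (h.1.mem_dom _) (h.2.1.mem_dom _)
    h.2.2.2.self_of_nhds

theorem sol_of_connEq {i j : Chart} (ha : D.Reg a) (hfa : D.Reg (f a)) (hf : IsLocalBihol f a)
    (h : ∀ᶠ b in 𝓝 a, ConnEq (D.mu i) (D.mu j) (inCharts i j f) (i.coord b)) : D.Sol f a := by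
  refine ⟨ha, hfa, hf, ?_⟩
  have hev : ∀ᶠ b in 𝓝 a, ConnEq (D.mu .affine) (D.mu .affine) (inCharts .affine .affine f)
      (Chart.affine.coord b) := by
    filter_upwards [ha.eventually, hf.continuousAt.eventually hfa.eventually, h, hf.eventually]
      with b h1 h2 h3 h4
    exact connEq_change h4 (h1.mem_dom _) (h2.mem_dom _) (h1.mem_dom _) (h2.mem_dom _) h3
  have := Chart.affine.eventually_par (ha.mem_dom _) hev
  filter_upwards [this] with t ht
  rwa [Chart.coord_par] at ht

theorem Sol.eventually (h : D.Sol f a) : ∀ᶠ b in 𝓝 a, D.Sol f b := by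
  obtain ⟨h1, h2, h3, h4⟩ := h
  filter_upwards [h1.eventually, h3.continuousAt.eventually h2.eventually, h3.eventually,
    (Chart.affine.continuousAt_coord (h1.mem_dom _)).eventually h4.eventually_nhds]
    with b b1 b2 b3 b4
  exact ⟨b1, b2, b3, b4⟩

theorem Sol.comp (hg : D.Sol g (f a)) (hf : D.Sol f a) : D.Sol (g ∘ f) a := by
  refine sol_of_connEq (i := .affine) (j := .affine) hf.1 hg.2.1 (hg.2.2.1.comp hf.2.2.1) ?_
  filter_upwards [hf.eventually, hf.2.2.1.continuousAt.eventually hg.eventually] with b h1 h2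
  refine ConnEq.congr ?_ (inCharts_comp_eventuallyEq (h1.1.mem_dom .affine) (h1.2.1.mem_dom .affine)
    h1.2.2.1.continuousAt).symm
  have e : inCharts .affine .affine f (Chart.affine.coord b) = Chart.affine.coord (f b) :=
    inCharts_par _ _ _ (h1.1.mem_dom _)
  refine ConnEq.comp (h1.2.2.1.analyticAt (h1.1.mem_dom _) (h1.2.1.mem_dom _)) ?_ (h1.connEq _ _) ?_
  · rw [e]
    exact h2.2.2.1.analyticAt (h2.1.mem_dom _) (h2.2.1.mem_dom _)
  · rw [e]
    exact h2.connEq _ _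

theorem Sol.inv (hf : D.Sol f a) (hg : ∀ᶠ b in 𝓝 a, g (f b) = b) : D.Sol g (f a) := by
  have hga : g (f a) = a := hg.self_of_nhds
  have hgb : IsLocalBihol g (f a) := hf.2.2.1.of_eventually_leftInverse hg
  refine sol_of_connEq (i := .affine) (j := .affine) hf.2.1 (by rw [hga]; exact hf.1) hgb ?_
  obtain ⟨g', hg', h1, h2⟩ := hf.2.2.1.exists_inverse
  have hc : Tendsto g' (𝓝 (f a)) (𝓝 a) := by
    have := hg'.continuousAt
    rwa [ContinuousAt, h1.self_of_nhds] at this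
  -- The equation for `g` is first obtained at the points `f b`, by cancelling `f` in `g ∘ f = id`;
  -- the local inverse of `f` then shows that these points fill a neighbourhood of `f a`.
  have key : ∀ᶠ b in 𝓝 a, ConnEq (D.mu .affine) (D.mu .affine) (inCharts .affine .affine g)
      (Chart.affine.coord (f b)) := by
    filter_upwards [hf.eventually, hg.eventually_nhds] with b hb hgb
    have hbg := hb.2.2.1.of_eventually_leftInverse hgb
    have e : inCharts .affine .affine f (Chart.affine.coord b) = Chart.affine.coord (f b) :=
      inCharts_par _ _ _ (hb.1.mem_dom _)
    have A := hb.2.2.1.analyticAt (hb.1.mem_dom .affine) (hb.2.1.mem_dom .affine)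
    rw [← e]
    refine ConnEq.of_comp A ?_ (hb.connEq _ _) ?_
      (hb.2.2.1.deriv_ne_zero (hb.1.mem_dom _) (hb.2.1.mem_dom _))
    · rw [e]
      refine hbg.analyticAt (hb.2.1.mem_dom _) ?_
      rw [hgb.self_of_nhds]
      exact hb.1.mem_dom _
    · refine (connEq_id (D.mu .affine) _).congr ?_
      have e2 := inCharts_comp_eventuallyEq (g := g) (l := .affine) (hb.1.mem_dom .affine)
        (hb.2.1.mem_dom .affine) hb.2.2.1.continuousAt
      refine EventuallyEq.trans ?_ e2
      filter_upwards [Chart.affine.eventually_par (hb.1.mem_dom _) hgb] with t ht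
      simp only [inCharts, Function.comp, id]
      rw [ht, Chart.coord_par]
  filter_upwards [h2, hc.eventually key] with c hc1 hc2
  rwa [hc1] at hc2

theorem sol_id (ha : D.Reg a) : D.Sol id a := by
  refine sol_of_connEq (i := .affine) (j := .affine) ha ha (isLocalBihol_id a) ?_
  filter_upwards with b
  have : inCharts .affine .affine id = id := funext fun t => Chart.affine.coord_par t
  rw [this]
  exact connEq_id _ _

/-! #### Existence of flat coordinates and of solutions -/

/-- On a disc free of poles, integrate twice: with `M` a primitive of `μ`, a primitive `Φ` of `exp
M` satisfies `Φ'' = μ Φ'` and `Φ' ≠ 0`. -/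
theorem exists_flat {z : ℂ} (hz : D.den.eval z ≠ 0) :
    ∃ Φ : ℂ → ℂ, AnalyticAt ℂ Φ z ∧ deriv Φ z ≠ 0 ∧
      ∀ᶠ t in 𝓝 z, ConnEq (D.mu .affine) (fun _ => 0) Φ t := by
  have hop : IsOpen {w : ℂ | D.den.eval w ≠ 0} :=
    isOpen_ne_fun D.den.continuous continuous_const
  obtain ⟨r, hr, hball⟩ := Metric.isOpen_iff.1 hop z hz
  have hd : DifferentiableOn ℂ (D.mu .affine) (Metric.ball z r) := fun w hw =>
    (D.num.differentiableAt.div D.den.differentiableAt (hball hw)).differentiableWithinAt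
  obtain ⟨M, hM⟩ := hd.isExactOn_ball
  have hM' : DifferentiableOn ℂ M (Metric.ball z r) := fun w hw =>
    (hM w hw).differentiableAt.differentiableWithinAt
  obtain ⟨Φ, hΦ⟩ := (hM'.cexp).isExactOn_ball
  have hΦ' : DifferentiableOn ℂ Φ (Metric.ball z r) := fun w hw =>
    (hΦ w hw).differentiableAt.differentiableWithinAt
  have hzr : Metric.ball z r ∈ 𝓝 z := Metric.ball_mem_nhds z hr
  refine ⟨Φ, hΦ'.analyticAt hzr, ?_, ?_⟩
  · rw [(hΦ z (Metric.mem_ball_self hr)).deriv]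
    exact Complex.exp_ne_zero _
  · filter_upwards [hzr] with t ht
    have htr : Metric.ball z r ∈ 𝓝 t := Metric.isOpen_ball.mem_nhds ht
    have e : deriv Φ =ᶠ[𝓝 t] fun s => Complex.exp (M s) := by
      filter_upwards [htr] with s hs
      exact (hΦ s hs).deriv
    rw [ConnEq, e.deriv_eq, e.eq_of_nhds, ((hM t ht).cexp).deriv]
    ring

/-- In flat coordinates `Φ` at the source and `Ψ` at the target, the solutions are the affine maps.
The solution is `Ψ⁻¹ ∘ α ∘ Φ` with `α` affine, which leaves the image point and the first derivative
free. -/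
theorem exists_connEq {z w c : ℂ} (hz : D.den.eval z ≠ 0) (hw : D.den.eval w ≠ 0) (hc : c ≠ 0) :
    ∃ φ : ℂ → ℂ, AnalyticAt ℂ φ z ∧ φ z = w ∧ deriv φ z = c ∧
      ∀ᶠ t in 𝓝 z, ConnEq (D.mu .affine) (D.mu .affine) φ t := by
  obtain ⟨Φ, hΦ, hΦd, hΦe⟩ := exists_flat hz
  obtain ⟨Ψ, hΨ, hΨd, hΨe⟩ := exists_flat hw
  set inv := hΨ.hasStrictDerivAt.localInverse Ψ (deriv Ψ w) w hΨd with hinv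
  have A : AnalyticAt ℂ inv (Ψ w) := hΨ.analyticAt_localInverse hΨd
  have h1 : ∀ᶠ s in 𝓝 w, inv (Ψ s) = s := hΨ.hasStrictDerivAt.eventually_left_inverse hΨd
  have h2 : ∀ᶠ s in 𝓝 (Ψ w), Ψ (inv s) = s := hΨ.hasStrictDerivAt.eventually_right_inverse hΨd
  have h3 : HasDerivAt inv (deriv Ψ w)⁻¹ (Ψ w) :=
    (hΨ.hasStrictDerivAt.to_localInverse hΨd).hasDerivAt
  have hiw : inv (Ψ w) = w := h1.self_of_nhds
  -- The slope of `α` that makes the derivative of `Ψ⁻¹ ∘ α ∘ Φ` at `z` equal to `c`.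
  set k := c * deriv Ψ w / deriv Φ z with hk
  set α : ℂ → ℂ := fun s => k * (s - Φ z) + Ψ w with hα
  have hαA : ∀ s, AnalyticAt ℂ α s := fun s => by
    have : Differentiable ℂ α := by fun_prop
    exact this.analyticAt s
  have hαd : deriv α = fun _ => k := by
    funext s
    have : HasDerivAt α (k * 1 + 0) s :=
      (((hasDerivAt_id s).sub_const _).const_mul k).add (hasDerivAt_const _ _)
    rw [this.deriv]
    ring
  have hαz : α (Φ z) = Ψ w := by simp [hα]
  have hαe : ∀ s, ConnEq (fun _ => 0) (fun _ => 0) α s := fun s => by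
    rw [ConnEq, hαd]
    simp
  have hinve : ∀ᶠ s in 𝓝 (Ψ w), ConnEq (fun _ => 0) (D.mu .affine) inv s := by
    have hcont : Tendsto inv (𝓝 (Ψ w)) (𝓝 w) := by
      have := A.continuousAt
      rwa [ContinuousAt, hiw] at this
    have key : ∀ᶠ t in 𝓝 w, ConnEq (fun _ => 0) (D.mu .affine) inv (Ψ t) := by
      filter_upwards [hΨe, hΨ.eventually_analyticAt, h1.eventually_nhds,
        hΨ.deriv.continuousAt.eventually_ne hΨd, hΨ.continuousAt.eventually A.eventually_analyticAt]
        with t t1 t2 t3 t4 t5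
      refine ConnEq.of_comp t2 t5 t1 ((connEq_id _ t).congr ?_) t4
      filter_upwards [t3] with s hs
      exact hs.symm
    filter_upwards [h2, hcont.eventually key] with s hs1 hs2
    rwa [hs1] at hs2
  have hA1 : AnalyticAt ℂ (α ∘ Φ) z := (hαA _).comp hΦ
  have hA2 : AnalyticAt ℂ inv ((α ∘ Φ) z) := by
    rw [Function.comp, hαz]
    exact A
  refine ⟨inv ∘ α ∘ Φ, hA2.comp hA1, ?_, ?_, ?_⟩
  · simp only [Function.comp, hαz, hiw]
  · rw [deriv_comp _ hA2.differentiableAt hA1.differentiableAt,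
      deriv_comp _ (hαA _).differentiableAt hΦ.differentiableAt, hαd]
    simp only [Function.comp, hαz]
    rw [h3.deriv, hk]
    field_simp
  · have hcont : Tendsto (α ∘ Φ) (𝓝 z) (𝓝 (Ψ w)) := by
      have := hA1.continuousAt
      rwa [ContinuousAt, Function.comp, hαz] at this
    filter_upwards [hΦ.eventually_analyticAt, hΦe, hcont.eventually hinve,
      hcont.eventually A.eventually_analyticAt] with t t1 t2 t3 t4
    exact ConnEq.comp ((hαA _).comp t1) t4 (ConnEq.comp t1 (hαA _) t2 (hαe _)) t3

/-- Every jet of order one between regular points is the jet of a solution. -/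
theorem exists_sol (i j : Chart) {a b : P1} (ha : D.Reg a) (hb : D.Reg b) {c : ℂ} (hc : c ≠ 0) :
    ∃ f, D.Sol f a ∧ f a = b ∧ deriv (inCharts i j f) (i.coord a) = c := by
  have ha' := ha
  have hb' := hb
  obtain ⟨z, hz0, hz, rfl⟩ := ha
  obtain ⟨w, hw0, hw, rfl⟩ := hb
  set A := Chart.affine
  have hzi : A.par (A.coord (z : P1)) ∈ i.dom := by
    rw [A.par_coord (ha'.mem_dom A)]
    exact ha'.mem_dom i
  have hzi' : i.par (i.coord (z : P1)) ∈ A.dom := by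
    rw [i.par_coord (ha'.mem_dom i)]
    exact ha'.mem_dom A
  have hwj : A.par (A.coord (w : P1)) ∈ j.dom := by
    rw [A.par_coord (hb'.mem_dom A)]
    exact hb'.mem_dom j
  set u := deriv (trans A j) (A.coord (w : P1)) with hu
  set v := deriv (trans i A) (i.coord (z : P1)) with hv
  have hu0 : u ≠ 0 := deriv_trans_ne_zero hwj
  have hv0 : v ≠ 0 := deriv_trans_ne_zero hzi'
  -- The solution is built in the affine charts; dividing `c` by `u * v` makes up for the change to
  -- the charts `i` and `j`.
  obtain ⟨φ, hφ, hφz, hφd, hφe⟩ := exists_connEq hz hw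
    (div_ne_zero hc (mul_ne_zero hu0 hv0))
  have hfz : ofCharts A A φ (z : P1) = (w : P1) := by
    change ((φ z : ℂ) : P1) = w
    rw [hφz]
  have hbih : IsLocalBihol (ofCharts A A φ) (z : P1) := by
    refine isLocalBihol_ofCharts (ha'.mem_dom _) hφ ?_
    change deriv φ z ≠ 0
    rw [hφd]
    exact div_ne_zero hc (mul_ne_zero hu0 hv0)
  refine ⟨ofCharts A A φ, ⟨ha', ?_, hbih, ?_⟩, hfz, ?_⟩
  · rwa [hfz]
  · rw [inCharts_ofCharts]
    exact hφe
  · rw [deriv_inCharts_change (i := A) (j := A) hbih (ha'.mem_dom _) (by rw [hfz]; exact hb'.mem_dom _)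
      (ha'.mem_dom _) (by rw [hfz]; exact hb'.mem_dom _), inCharts_ofCharts, hfz]
    change u * (deriv φ z * v) = c
    rw [hφd]
    field_simp

end AffineData

/-! ### The ideal of equations satisfied by the solutions -/

section valueAt

variable {W : Opens (P1 × P1)} {f : P1 → P1} {a : P1}

theorem valueAt_of {E : GermsOver W → ℂ} (hf : IsLocalBihol f a) (hW : (a, f a) ∈ W) :
    valueAt E f a = E ⟨(f, a), hf, hW⟩ := dif_pos ⟨hf, hW⟩

theorem valueAt_zero : valueAt (0 : GermsOver W → ℂ) f a = 0 := by
  simp only [valueAt, Pi.zero_apply, dite_eq_ite, ite_self]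

theorem valueAt_resFun {V : Opens (P1 × P1)} (h : V ≤ W) (E : GermsOver W → ℂ)
    (hV : (a, f a) ∈ V) : valueAt (resFun h E) f a = valueAt E f a := by
  by_cases hf : IsLocalBihol f a
  · rw [valueAt_of hf hV, valueAt_of hf (h hV)]
    rfl
  · simp only [valueAt, hf, false_and, dif_neg, not_false_eq_true]

/-- A function of germs given by a function of maps and points. -/
def ofGermFun (W : Opens (P1 × P1)) (E : (P1 → P1) → P1 → ℂ) : GermsOver W → ℂ :=
  fun γ => E γ.1.1 γ.1.2

theorem eqNear_valueAt_ofGermFun {p : P1 × P1} (hp : p ∈ W) (E : (P1 → P1) → P1 → ℂ) :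
    EqNear p (valueAt (ofGermFun W E)) E := by
  filter_upwards [W.isOpen.mem_nhds hp] with q hq f a hfa hf
  subst hfa
  rw [valueAt_of hf hq]
  rfl

theorem valueAt_ofGermFun {E : (P1 → P1) → P1 → ℂ} (hf : IsLocalBihol f a) (hW : (a, f a) ∈ W) :
    valueAt (ofGermFun W E) f a = E f a := valueAt_of hf hW

theorem isOfOrder_ofGermFun {k : ℕ} {E : (P1 → P1) → P1 → ℂ}
    (h : ∀ p ∈ W, ∃ i j : Chart, p.1 ∈ i.dom ∧ p.2 ∈ j.dom ∧ HasJetExpr k i j p E) :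
    IsOfOrder k (ofGermFun W E) := by
  intro p hp i j hi hj
  obtain ⟨i', j', hi', hj', hE⟩ := h p hp
  exact (hE.change_charts hi hj hi' hj').congr (eqNear_valueAt_ofGermFun hp E)

theorem IsOfOrder.isDiffEq {k : ℕ} {E : GermsOver W → ℂ} (h : IsOfOrder k E) : IsDiffEq E :=
  fun p hp i j hi hj => ⟨k, h p hp i j hi hj⟩

theorem HasJetExpr.eq_of_eventuallyEq {k : ℕ} {i j : Chart} {E : (P1 → P1) → P1 → ℂ}
    {g : P1 → P1} (h : HasJetExpr k i j (a, f a) E) (hi : a ∈ i.dom)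
    (hf : IsLocalBihol f a) (hfg : f =ᶠ[𝓝 a] g) : E f a = E g a := by
  obtain ⟨Q, -, -, h3⟩ := h
  have e := hfg.eq_of_nhds
  rw [h3.self_of_nhds f a rfl hf, h3.self_of_nhds g a (by rw [e]) (hf.congr hfg),
    jetCoord_congr hi hfg, e]

theorem valueAt_congr (E : DiffEq W) {g : P1 → P1} (hf : IsLocalBihol f a) (hW : (a, f a) ∈ W)
    (hfg : f =ᶠ[𝓝 a] g) : valueAt E.1 f a = valueAt E.1 g a := by
  obtain ⟨i, hi⟩ := Chart.exists_mem a
  obtain ⟨j, hj⟩ := Chart.exists_mem (f a)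
  obtain ⟨k, hk⟩ := E.2 (a, f a) hW i j hi hj
  exact hk.eq_of_eventuallyEq hi hf hfg

instance (a : P1) : (𝓝[≠] a).NeBot := by
  obtain ⟨i, hi⟩ := Chart.exists_mem a
  have h1 : (𝓝[≠] (i.coord a)).NeBot := inferInstance
  have h2 : Tendsto i.par (𝓝[≠] (i.coord a)) (𝓝[≠] a) := by
    refine tendsto_nhdsWithin_iff.2 ⟨?_, ?_⟩
    · have : Tendsto i.par (𝓝 (i.coord a)) (𝓝 a) := by rw [Tendsto, i.map_par_nhds hi]
      exact this.mono_left nhdsWithin_le_nhds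
    · filter_upwards [self_mem_nhdsWithin] with t ht h
      apply ht
      have h' : i.par t = a := h
      rw [Set.mem_singleton_iff, ← h', i.coord_par]
  exact h2.neBot

/-- An equation is continuous along the jets of a map, and the projective line has no isolated
point. Vanishing at the nearby points other than `a` is therefore enough, and a finite set of
singular points does no harm. -/
theorem valueAt_eq_zero_of_eventually (E : DiffEq W) (hf : IsLocalBihol f a) (hW : (a, f a) ∈ W)
    (h : ∀ᶠ b in 𝓝[≠] a, (b, f b) ∈ W → valueAt E.1 f b = 0) : valueAt E.1 f a = 0 := by
  obtain ⟨i, hi⟩ := Chart.exists_mem a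
  obtain ⟨j, hj⟩ := Chart.exists_mem (f a)
  obtain ⟨k, hk⟩ := E.2 (a, f a) hW i j hi hj
  have hc := (hk.continuousAt_along hf hi hj).tendsto.mono_left (nhdsWithin_le_nhds (s := {a}ᶜ))
  have hgr : ∀ᶠ b in 𝓝 a, (b, f b) ∈ W :=
    (continuousAt_id.prodMk hf.continuousAt).eventually (W.isOpen.mem_nhds hW)
  refine tendsto_nhds_unique hc (tendsto_const_nhds.congr' ?_)
  filter_upwards [h, hgr.filter_mono nhdsWithin_le_nhds] with b hb1 hb2
  exact (hb1 hb2).symm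

end valueAt

namespace AffineData

variable (D : AffineData)

/-- The sheaf of ideals of equations which vanish on the jets of solutions. -/
def idealSheaf : IdealSheaf where
  sections W :=
    { carrier := {E | ∀ f a, D.Sol f a → (a, f a) ∈ W → valueAt E.1 f a = 0}
      add_mem' := by
        intro E F hE hF f a hf hW
        change valueAt (E.1 + F.1) f a = 0
        rw [valueAt_add, hE f a hf hW, hF f a hf hW, add_zero]
      zero_mem' := fun f a _ _ => valueAt_zero
      smul_mem' := by
        intro c E hE f a hf hW
        change valueAt (c.1 * E.1) f a = 0
        rw [valueAt_mul, hE f a hf hW, mul_zero] }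
  res_mem := by
    intro V W h E hE f a hf hV
    change valueAt (resFun h E.1) f a = 0
    rw [valueAt_resFun h E.1 hV]
    exact hE f a hf (h hV)
  mem_of_locally := by
    intro W E hE f a hf hW
    obtain ⟨V, h, hV, hEV⟩ := hE _ hW
    have := hEV f a hf hV
    change valueAt (resFun h E.1) f a = 0 at this
    rwa [valueAt_resFun h E.1 hV] at this

variable {D}

theorem mem_idealSheaf {W : Opens (P1 × P1)} {E : DiffEq W} :
    E ∈ D.idealSheaf.sections W ↔ ∀ f a, D.Sol f a → (a, f a) ∈ W → valueAt E.1 f a = 0 := Iff.rfl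

/-- A solution at `a` is a solution at all nearby points, so an equation of the ideal is identically
zero along its jets and has zero derivative. The remaining content is that the derivative is again
given by jet expressions. -/
theorem idealSheaf_isDifferential : D.idealSheaf.IsDifferential := by
  intro i W hW E hE
  let F : (P1 → P1) → P1 → ℂ := fun f a =>
    deriv (fun t : ℂ => valueAt E.1 f (i.par t)) (i.coord a)
  have hF : IsDiffEq (ofGermFun W F) := by
    intro p hp i' j' hi' hj'
    obtain ⟨k, hk⟩ := E.2 p hp i' j' hi' hj'
    obtain ⟨G, hG, hd⟩ := hk.exists_deriv hi' hj'
    have h1 : HasJetExpr (k + 1) i' j' p fun f a => deriv (trans i i') (i.coord a) := by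
      refine HasJetExpr.coeff_change (j' := j') hi' hj' (hW p hp) hj'
        (c := fun z => deriv (trans i i') z.1) ?_
      exact AnalyticAt.fun_comp (g := deriv (trans i i')) (f := Prod.fst)
        (analyticAt_coord_change (hW p hp) hi').deriv analyticAt_fst
    refine ⟨k + 1, ((hG.mul h1 fun _ _ => rfl).congr ?_).congr (eqNear_valueAt_ofGermFun hp F)⟩
    filter_upwards [hd.change_chart hi' (hW p hp)] with q hq f a hfa hf
    exact (hq f a hfa hf).deriv
  refine ⟨⟨ofGermFun W F, hF⟩, ?_, fun f a hf ha => valueAt_ofGermFun (E := F) hf ha⟩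
  intro f a hf ha
  rw [valueAt_ofGermFun hf.2.2.1 ha]
  have hev : ∀ᶠ b in 𝓝 a, valueAt E.1 f b = 0 := by
    filter_upwards [hf.eventually,
      (continuousAt_id.prodMk hf.2.2.1.continuousAt).eventually (W.isOpen.mem_nhds ha)] with b h1 h2
    exact hE f b h1 h2
  have : (fun t : ℂ => valueAt E.1 f (i.par t)) =ᶠ[𝓝 (i.coord a)] fun _ => 0 :=
    i.eventually_par (hf.1.mem_dom i) hev
  change deriv _ _ = 0
  rw [this.deriv_eq, deriv_const]

theorem valueAt_eq_zero_of_eventually_sol {W : Opens (P1 × P1)} {E : DiffEq W}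
    (hE : E ∈ D.idealSheaf.sections W) {f : P1 → P1} {a : P1} (hf : IsLocalBihol f a)
    (hW : (a, f a) ∈ W) (h : ∀ᶠ b in 𝓝[≠] a, D.Sol f b) : valueAt E.1 f a = 0 := by
  refine valueAt_eq_zero_of_eventually E hf hW ?_
  filter_upwards [h] with b hb hbW
  exact hE f b hb hbW

theorem idealSheaf_containsIdentity (k : ℕ) : D.idealSheaf.ContainsIdentity k := by
  intro W E hE a ha
  refine valueAt_eq_zero_of_eventually_sol hE.1 (isLocalBihol_id a) ha ?_
  filter_upwards [eventually_reg (D := D) a] with b hb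
  exact sol_id hb

/-- The inverted equation is defined by means of the chosen inverse `locInv`. This is harmless
because a differential equation only sees the germ of the inverse, which is unique. -/
theorem idealSheaf_isInvStable (k : ℕ) : D.idealSheaf.IsInvStable k := by
  intro W E hE
  let F : (P1 → P1) → P1 → ℂ := fun f a => valueAt E.1 (locInv f a) (f a)
  have hF : IsOfOrder k (ofGermFun (Opens.comap ⟨Prod.swap, continuous_swap⟩ W) F) := by
    refine isOfOrder_ofGermFun fun p hp => ?_
    obtain ⟨i, hi⟩ := Chart.exists_mem p.1
    obtain ⟨j, hj⟩ := Chart.exists_mem p.2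
    exact ⟨i, j, hi, hj, (hE.2 p.swap hp j i hj hi).locInv hi hj⟩
  refine ⟨⟨_, hF.isDiffEq⟩, ⟨?_, hF⟩, ?_⟩
  · intro f a hf ha
    rw [valueAt_ofGermFun hf.2.2.1 ha]
    refine hE.1 _ _ (hf.inv (locInv_spec hf.2.2.1).2.1) ?_
    rw [locInv_apply hf.2.2.1]
    exact ha
  · intro f g a hf hg hgf ha
    rw [valueAt_ofGermFun hf ha]
    refine valueAt_congr E (locInv_spec hf).1 ?_ ?_
    · rw [locInv_apply hf]
      exact ha
    · exact eventuallyEq_of_leftInverse hf (locInv_spec hf).2.1 hgf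

theorem isSolution_idealSheaf {f : P1 → P1}
    (h : ∀ a, IsLocalBihol f a → ∀ᶠ b in 𝓝[≠] a, D.Sol f b) : IsSolution f D.idealSheaf := by
  intro W E hE a hf ha
  exact valueAt_eq_zero_of_eventually_sol hE hf ha (h a hf)

/-! #### Reduction of the jets of solutions -/

open MvPolynomial in
/-- Evaluation of a polynomial in `x`, `y`. -/
def ev (x y : ℂ) : MvPolynomial (Fin 2) ℂ →+* ℂ := MvPolynomial.eval ![x, y]

theorem hasDerivAt_ev {φ : ℂ → ℂ} {z : ℂ} (hφ : AnalyticAt ℂ φ z) (q : MvPolynomial (Fin 2) ℂ) :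
    HasDerivAt (fun t => ev t (φ t) q) (ev z (φ z) (MvPolynomial.pderiv 0 q) +
      deriv φ z * ev z (φ z) (MvPolynomial.pderiv 1 q)) z := by
  induction q using MvPolynomial.induction_on with
  | C c =>
    simpa [ev] using hasDerivAt_const z c
  | add q r hq hr =>
    simp only [map_add]
    refine (hq.add hr).congr_deriv ?_
    ring
  | mul_X q n hq =>
    simp only [map_mul, Derivation.leibniz, map_add, smul_eq_mul]
    have hX : HasDerivAt (fun t => ev t (φ t) (MvPolynomial.X n))
        (ev z (φ z) (MvPolynomial.pderiv 0 (MvPolynomial.X n)) +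
          deriv φ z * ev z (φ z) (MvPolynomial.pderiv 1 (MvPolynomial.X n))) z := by
      fin_cases n
      · simpa [ev] using hasDerivAt_id' z
      · simpa [ev] using hφ.differentiableAt.hasDerivAt
    refine (hq.mul hX).congr_deriv ?_
    ring

variable (D) in
/-- The common denominator of the connection coefficients, in the charts `i`, `j`. -/
def denom₂ (i j : Chart) : MvPolynomial (Fin 2) ℂ :=
  Polynomial.aeval (MvPolynomial.X 0) (D.cden i) * Polynomial.aeval (MvPolynomial.X 1) (D.cden j)

theorem ev_aeval_zero (x y : ℂ) (q : Polynomial ℂ) :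
    ev x y (Polynomial.aeval (MvPolynomial.X 0) q) = q.eval x := by
  induction q using Polynomial.induction_on' with
  | add q r hq hr => simp [hq, hr]
  | monomial n c => simp [ev, Polynomial.aeval_monomial]

theorem ev_aeval_one (x y : ℂ) (q : Polynomial ℂ) :
    ev x y (Polynomial.aeval (MvPolynomial.X 1) q) = q.eval y := by
  induction q using Polynomial.induction_on' with
  | add q r hq hr => simp [hq, hr]
  | monomial n c => simp [ev, Polynomial.aeval_monomial]

theorem ev_denom₂ (i j : Chart) (x y : ℂ) :
    ev x y (D.denom₂ i j) = (D.cden i).eval x * (D.cden j).eval y := by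
  rw [denom₂, map_mul, ev_aeval_zero, ev_aeval_one]

/-- Evaluation of a polynomial in `x`, `y`, `y₁` at the jet of `f` at `a`. -/
def ev₁ (i j : Chart) (Ψ : Polynomial (MvPolynomial (Fin 2) ℂ)) (f : P1 → P1) (a : P1) : ℂ :=
  Ψ.eval₂ (ev (i.coord a) (j.coord (f a))) (deriv (inCharts i j f) (i.coord a))

/-- The equation of the affine structure solved for `y₂`, with denominators cleared so as to remain
polynomial in `x`, `y`, `y₁`. -/
theorem Sol.denom_mul_deriv {i j : Chart} {f : P1 → P1} {a : P1} (hf : D.Sol f a) :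
    ev (i.coord a) (j.coord (f a)) (D.denom₂ i j) * deriv (deriv (inCharts i j f)) (i.coord a) =
      (D.cnum i).eval (i.coord a) * (D.cden j).eval (j.coord (f a)) *
          deriv (inCharts i j f) (i.coord a) -
        (D.cnum j).eval (j.coord (f a)) * (D.cden i).eval (i.coord a) *
          deriv (inCharts i j f) (i.coord a) ^ 2 := by
  have h := hf.connEq i j
  rw [ConnEq, inCharts_par i j f (hf.1.mem_dom i), hf.1.mu_eq, hf.2.1.mu_eq] at h
  have h1 := hf.1.cden_ne_zero i
  have h2 := hf.2.1.cden_ne_zero j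
  rw [ev_denom₂]
  have h3 : deriv (deriv (inCharts i j f)) (i.coord a) =
    (D.cnum i).eval (i.coord a) / (D.cden i).eval (i.coord a) *
      deriv (inCharts i j f) (i.coord a) - (D.cnum j).eval (j.coord (f a)) /
      (D.cden j).eval (j.coord (f a)) * deriv (inCharts i j f) (i.coord a) ^ 2 := by
    linear_combination h
  rw [h3]
  field_simp

/-- The derivative of a polynomial in `x`, `y`, `y₁` along solutions. -/
theorem exists_deriv_along (i j : Chart) (Ψ : Polynomial (MvPolynomial (Fin 2) ℂ)) :
    ∃ Ψ' : Polynomial (MvPolynomial (Fin 2) ℂ), ∀ f a, D.Sol f a →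
      ∃ d : ℂ, HasDerivAt (fun t => ev₁ i j Ψ f (i.par t)) d (i.coord a) ∧
        ev (i.coord a) (j.coord (f a)) (D.denom₂ i j) * d = ev₁ i j Ψ' f a := by
  induction Ψ using Polynomial.induction_on' with
  | add Ψ Φ h1 h2 =>
    obtain ⟨Ψ', h1⟩ := h1
    obtain ⟨Φ', h2⟩ := h2
    refine ⟨Ψ' + Φ', fun f a hf => ?_⟩
    obtain ⟨d, hd, hd'⟩ := h1 f a hf
    obtain ⟨e, he, he'⟩ := h2 f a hf
    refine ⟨d + e, ?_, ?_⟩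
    · simpa only [ev₁, Polynomial.eval₂_add] using hd.fun_add he
    · rw [mul_add, hd', he', ev₁, ev₁, ev₁, Polynomial.eval₂_add]
  | monomial n q =>
    -- The derivative of `q y₁ⁿ` is `(∂ₓq + y₁ ∂ᵧq) y₁ⁿ + q n y₁ⁿ⁻¹ y₂`. After multiplication by the
    -- common denominator, `y₂` is replaced by the polynomial of `Sol.denom_mul_deriv`.
    refine ⟨Polynomial.C (D.denom₂ i j) * (Polynomial.C (MvPolynomial.pderiv 0 q) +
      Polynomial.X * Polynomial.C (MvPolynomial.pderiv 1 q)) * Polynomial.X ^ n +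
      Polynomial.C q * ((n : Polynomial (MvPolynomial (Fin 2) ℂ)) * Polynomial.X ^ (n - 1)) *
      (Polynomial.C (Polynomial.aeval (MvPolynomial.X 0) (D.cnum i) *
          Polynomial.aeval (MvPolynomial.X 1) (D.cden j)) * Polynomial.X -
        Polynomial.C (Polynomial.aeval (MvPolynomial.X 1) (D.cnum j) *
          Polynomial.aeval (MvPolynomial.X 0) (D.cden i)) * Polynomial.X ^ 2), fun f a hf => ?_⟩
    have A := hf.2.2.1.analyticAt (hf.1.mem_dom i) (hf.2.1.mem_dom j)
    have e : (fun t => ev₁ i j (Polynomial.monomial n q) f (i.par t)) = fun t =>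
        ev t (inCharts i j f t) q * deriv (inCharts i j f) t ^ n := by
      funext t
      simp [ev₁, Polynomial.eval₂_monomial, i.coord_par, inCharts]
    rw [e]
    refine ⟨_, (hasDerivAt_ev A q).mul (A.deriv.differentiableAt.hasDerivAt.pow n), ?_⟩
    rw [inCharts_par i j f (hf.1.mem_dom i)]
    have h := hf.denom_mul_deriv (i := i) (j := j)
    simp only [ev₁, Polynomial.eval₂_add, Polynomial.eval₂_mul, Polynomial.eval₂_sub,
      Polynomial.eval₂_C, Polynomial.eval₂_X, Polynomial.eval₂_pow, map_mul, ev_aeval_zero,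
      ev_aeval_one, Polynomial.eval₂_natCast]
    rw [← h]
    ring

/-- On solutions, `y_n` is a function of `x`, `y`, `y₁`. -/
theorem exists_jet_reduction (i j : Chart) (n : ℕ) :
    ∃ (N : ℕ) (Ψ : Polynomial (MvPolynomial (Fin 2) ℂ)), ∀ f a, D.Sol f a →
      ev (i.coord a) (j.coord (f a)) (D.denom₂ i j) ^ N *
        iteratedDeriv (n + 1) (inCharts i j f) (i.coord a) = ev₁ i j Ψ f a := by
  induction n with
  | zero =>
    refine ⟨0, Polynomial.X, fun f a _ => ?_⟩
    simp [ev₁]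
  | succ n ih =>
    obtain ⟨N, Ψ, h⟩ := ih
    set H : MvPolynomial (Fin 2) ℂ := D.denom₂ i j with hH
    obtain ⟨Ψ', hΨ'⟩ := exists_deriv_along (D := D) i j Ψ
    obtain ⟨Θ, hΘ⟩ := exists_deriv_along (D := D) i j (Polynomial.C (H ^ N))
    -- Differentiating `Hᴺ yₙ₊₁ = Ψ` gives `Hᴺ yₙ₊₂ = DΨ - D(Hᴺ) yₙ₊₁`. Multiplication by `H` turns
    -- the two derivatives into the polynomials `Ψ'` and `Θ`, and multiplication by another `Hᴺ`
    -- turns `yₙ₊₁` into `Ψ`.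
    refine ⟨2 * N + 1, Polynomial.C (H ^ N) * Ψ' - Θ * Ψ, fun f a hf => ?_⟩
    obtain ⟨d, hd, hd'⟩ := hΨ' f a hf
    obtain ⟨e, he, he'⟩ := hΘ f a hf
    have A := hf.2.2.1.analyticAt (hf.1.mem_dom i) (hf.2.1.mem_dom j)
    have h1 := he.mul (hasDerivAt_iteratedDeriv A (n + 1))
    have hev : (fun t => ev₁ i j Ψ f (i.par t)) =ᶠ[𝓝 (i.coord a)]
        fun t => ev₁ i j (Polynomial.C (H ^ N)) f (i.par t) *
          iteratedDeriv (n + 1) (inCharts i j f) t := by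
      filter_upwards [i.eventually_par (hf.1.mem_dom i) hf.eventually] with t ht
      rw [← h f _ ht, i.coord_par, ev₁, Polynomial.eval₂_C, map_pow, i.coord_par]
    have h2 := (h1.congr_of_eventuallyEq hev).unique hd
    have h3 := h f a hf
    rw [i.par_coord (hf.1.mem_dom i)] at h2
    simp only [ev₁, Polynomial.eval₂_sub, Polynomial.eval₂_mul, Polynomial.eval₂_C, Polynomial.eval₂_pow,
      map_pow] at h2 h3 hd' he' ⊢
    rw [← h3, ← hd', ← he', ← h2, ← hH]
    ring

end AffineData

namespace AffineData

variable {D : AffineData}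

/-! #### Stability under composition -/

theorem analyticAt_ev (q : MvPolynomial (Fin 2) ℂ) (w : ℂ × ℂ) :
    AnalyticAt ℂ (fun z : ℂ × ℂ => ev z.1 z.2 q) w := by
  induction q using MvPolynomial.induction_on with
  | C c => simpa [ev] using analyticAt_const
  | add q r hq hr => simpa only [map_add] using hq.fun_add hr
  | mul_X q n hq =>
    simp only [map_mul]
    refine hq.fun_mul ?_
    fin_cases n
    · simpa [ev] using analyticAt_fst
    · simpa [ev] using analyticAt_snd

theorem hasJetExpr_ev₁ {k : ℕ} (hk : 1 ≤ k) {i j : Chart} (p : P1 × P1)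
    (Ψ : Polynomial (MvPolynomial (Fin 2) ℂ)) : HasJetExpr k i j p (ev₁ i j Ψ) := by
  induction Ψ using Polynomial.induction_on' with
  | add Ψ Φ h1 h2 =>
    exact h1.add h2 fun f a => by rw [ev₁, Polynomial.eval₂_add]; rfl
  | monomial n q =>
    have h1 : HasJetExpr k i j p fun f a => jetCoord i j f a 1 := HasJetExpr.jet hk hk
    have h2 : HasJetExpr k i j p fun f a => jetCoord i j f a 1 ^ n :=
      (jetExprRing k i j p).pow_mem h1.mem_ring n
    refine (HasJetExpr.coeff (analyticAt_ev q _)).mul h2 fun f a => ?_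
    simp [ev₁, Polynomial.eval₂_monomial, jetCoord]

variable (D) in
/-- The pairs of regular points. -/
def regOpens : Opens (P1 × P1) :=
  ⟨{p | D.Reg p.1 ∧ D.Reg p.2}, isOpen_reg.prod isOpen_reg⟩

theorem mem_regOpens {p : P1 × P1} : p ∈ D.regOpens ↔ D.Reg p.1 ∧ D.Reg p.2 := Iff.rfl

/-- The value of `G` depends only on the jet of order one. -/
def DependsOnOneJet (G : (P1 → P1) → P1 → ℂ) : Prop :=
  ∀ f g a, f a = g a → deriv (inCharts .affine .affine f) (Chart.affine.coord a) =
    deriv (inCharts .affine .affine g) (Chart.affine.coord a) → G f a = G g a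

/-- Near regular points, each `y_n` is the sum of a function of the jet of order one and of an
equation. -/
theorem exists_reduction_eq {n k : ℕ} (hn : n ≤ k) (hk : 1 ≤ k) :
    ∃ (G : (P1 → P1) → P1 → ℂ) (E : DiffEq D.regOpens), D.idealSheaf.MemOrder k E ∧
      (∀ p ∈ D.regOpens, HasJetExpr k .affine .affine p G) ∧ DependsOnOneJet G ∧
      ∀ f a, IsLocalBihol f a → (a, f a) ∈ D.regOpens →
        jetCoord .affine .affine f a n = G f a + valueAt E.1 f a := by
  set A := Chart.affine
  rcases n with _ | n
  -- The variable `1 / y₁` is already a function of the jet of order one, so the equation is zero.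
  · refine ⟨fun f a => jetCoord A A f a 0, 0, ⟨Ideal.zero_mem _, ?_⟩,
      fun _ _ => HasJetExpr.jet hn hk, ?_, fun f a _ _ => ?_⟩
    · intro p hp i j hi hj
      exact ((HasJetExpr.const 0).mono (Nat.zero_le k)).congr
        (Eventually.of_forall fun _ f a _ _ => valueAt_zero)
    · intro f g a _ hd
      simp only [jetCoord]
      rw [hd]
    · have : valueAt (0 : DiffEq D.regOpens).1 f a = 0 := valueAt_zero
      rw [this, add_zero]
  · obtain ⟨N, Ψ, h⟩ := exists_jet_reduction (D := D) A A n
    have hne : ∀ a b : P1, D.Reg a → D.Reg b → ev (A.coord a) (A.coord b) (D.denom₂ A A) ≠ 0 := by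
      intro a b ha hb
      rw [ev_denom₂]
      exact mul_ne_zero (ha.cden_ne_zero A) (hb.cden_ne_zero A)
    let G : (P1 → P1) → P1 → ℂ := fun f a =>
      (ev (A.coord a) (A.coord (f a)) (D.denom₂ A A) ^ N)⁻¹ * ev₁ A A Ψ f a
    have hG : ∀ p ∈ D.regOpens, HasJetExpr k A A p G := by
      intro p hp
      refine HasJetExpr.mul (HasJetExpr.coeff
        (c := fun z : ℂ × ℂ => (ev z.1 z.2 (D.denom₂ A A) ^ N)⁻¹) ?_) (hasJetExpr_ev₁ hk p Ψ)
        fun _ _ => rfl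
      exact ((analyticAt_ev _ _).fun_pow N).fun_inv (pow_ne_zero _ (hne _ _ hp.1 hp.2))
    let E : (P1 → P1) → P1 → ℂ := fun f a => jetCoord A A f a (n + 1) - G f a
    have hE : IsOfOrder k (ofGermFun D.regOpens E) := by
      refine isOfOrder_ofGermFun fun p hp => ⟨A, A, hp.1.mem_dom A, hp.2.mem_dom A, ?_⟩
      refine (HasJetExpr.jet hn hk).add ((HasJetExpr.const (-1)).mul (hG p hp) fun _ _ => rfl) ?_
      intro f a
      simp only [E]
      ring
    refine ⟨G, ⟨_, hE.isDiffEq⟩, ⟨?_, hE⟩, hG, ?_, ?_⟩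
    · intro f a hf ha
      rw [valueAt_ofGermFun hf.2.2.1 ha]
      have h1 := h f a hf
      have h2 := pow_ne_zero N (hne _ _ hf.1 hf.2.1)
      simp only [E, G, jetCoord]
      rw [← h1, inv_mul_cancel_left₀ h2, sub_self]
    · intro f g a hfg hd
      simp only [G, ev₁]
      rw [hfg, hd]
    · intro f a hf ha
      rw [valueAt_ofGermFun hf ha]
      simp only [E]
      ring

/-- Modulo the equations on the two factors, each coordinate of a pair of jets reduces to a function
of the two jets of order one, and hence so does the pullback of `E` by composition. This reduced
function vanishes at pairs of solutions, because their composite is a solution. As every pair of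
composable jets of order one between regular points comes from solutions, the reduced function is
zero, and the pullback lies in the required ideal. -/
theorem idealSheaf_isCompStableAt (k : ℕ) {x y z : P1} (hx : D.Reg x) (hy : D.Reg y)
    (hz : D.Reg z) : D.idealSheaf.IsCompStableAt k x y z := by
  intro W E hE hW
  set A := Chart.affine
  set R := pairExprRing k A A A x y z with hR
  have hreg : ∀ᶠ q in 𝓝 (x, y, z), D.Reg q.1 ∧ D.Reg q.2.1 ∧ D.Reg q.2.2 :=
    (isOpen_reg.prod (isOpen_reg.prod isOpen_reg)).mem_nhds ⟨hx, hy, hz⟩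
  -- Generators of the ideal `I ⊗ 1 + 1 ⊗ I`. They are specified only near `(x, y, z)`; in
  -- particular, taking `E₁ = E₂ = 0`, every function vanishing near that point is in the ideal `J`.
  let S : Set R := {s | ∃ E₁ E₂ : DiffEq D.regOpens, D.idealSheaf.MemOrder k E₁ ∧
    D.idealSheaf.MemOrder k E₂ ∧ PairEqNear x y z (fun f g a => s.1 (f, g, a))
      fun f g a => valueAt E₁.1 f a + valueAt E₂.1 g (f a)}
  have hzero : D.idealSheaf.MemOrder k (0 : DiffEq D.regOpens) := by
    refine ⟨Ideal.zero_mem _, fun p hp i j hi hj => ?_⟩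
    exact ((HasJetExpr.const 0).mono (Nat.zero_le k)).congr
      (Eventually.of_forall fun _ f a _ _ => valueAt_zero)
  have hzv : ∀ f a, valueAt (0 : DiffEq D.regOpens).1 f a = 0 := fun f a => valueAt_zero
  let J : Ideal R := Ideal.span S
  -- functions of the two jets of order one
  let R₁ : Subring R :=
    { carrier := {s | ∀ f g f' g' a, f a = f' a → g (f a) = g' (f' a) →
        deriv (inCharts A A f) (A.coord a) = deriv (inCharts A A f') (A.coord a) →
        deriv (inCharts A A g) (A.coord (f a)) = deriv (inCharts A A g') (A.coord (f' a)) →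
        s.1 (f, g, a) = s.1 (f', g', a)}
      mul_mem' := by
        intro s t hs ht f g f' g' a h1 h2 h3 h4
        change s.1 (f, g, a) * t.1 (f, g, a) = s.1 (f', g', a) * t.1 (f', g', a)
        rw [hs f g f' g' a h1 h2 h3 h4, ht f g f' g' a h1 h2 h3 h4]
      add_mem' := by
        intro s t hs ht f g f' g' a h1 h2 h3 h4
        change s.1 (f, g, a) + t.1 (f, g, a) = s.1 (f', g', a) + t.1 (f', g', a)
        rw [hs f g f' g' a h1 h2 h3 h4, ht f g f' g' a h1 h2 h3 h4]
      neg_mem' := by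
        intro s hs f g f' g' a h1 h2 h3 h4
        change -s.1 (f, g, a) = -s.1 (f', g', a)
        rw [hs f g f' g' a h1 h2 h3 h4]
      one_mem' := fun _ _ _ _ _ _ _ _ _ => rfl
      zero_mem' := fun _ _ _ _ _ _ _ _ _ => rfl }
  -- The functions congruent modulo `J` to a function of the two jets of order one. They form a
  -- subring, so it suffices to reduce the generators of the ring of pair functions.
  let T : Subring R := (R₁.map (Ideal.Quotient.mk J)).comap (Ideal.Quotient.mk J)
  have hT : ∀ s : R, s ∈ T ↔ ∃ s₁ ∈ R₁, s - s₁ ∈ J := by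
    intro s
    simp only [T, Subring.mem_comap, Subring.mem_map]
    constructor
    · rintro ⟨s₁, h1, h2⟩
      exact ⟨s₁, h1, Ideal.Quotient.eq.1 h2.symm⟩
    · rintro ⟨s₁, h1, h2⟩
      exact ⟨s₁, h1, (Ideal.Quotient.eq.2 h2).symm⟩
  have hT' : ∀ s s₁ : R, s₁ ∈ R₁ → ∀ E₁ E₂ : DiffEq D.regOpens, D.idealSheaf.MemOrder k E₁ →
      D.idealSheaf.MemOrder k E₂ → PairEqNear x y z (fun f g a => s.1 (f, g, a) - s₁.1 (f, g, a))
      (fun f g a => valueAt E₁.1 f a + valueAt E₂.1 g (f a)) → s ∈ T := by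
    intro s s₁ h1 E₁ E₂ hE₁ hE₂ h
    exact (hT s).2 ⟨s₁, h1, Ideal.subset_span ⟨E₁, E₂, hE₁, hE₂, h⟩⟩
  have hExpr : HasPairExpr k A A A x y z fun f g a => valueAt E.1 (g ∘ f) a :=
    (hE.2 (x, z) hW A A (hx.mem_dom A) (hz.mem_dom A)).pair_comp (hx.mem_dom A) (hy.mem_dom A)
      (hz.mem_dom A)
  have key : (fun w : (P1 → P1) × (P1 → P1) × P1 => valueAt E.1 (w.2.1 ∘ w.1) w.2.2) ∈
      T.map R.subtype := by
    refine hExpr.mem_of_generators (T.map R.subtype) ?_ ?_ ?_ ?_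
    · rintro _ B ⟨s, hs, rfl⟩ hB
      have hB' : HasPairExpr k A A A x y z fun f g a => B (f, g, a) :=
        HasPairExpr.congr (HasPairExpr.of_mem_ring s.2) hB
      refine ⟨⟨B, hB'⟩, ?_, rfl⟩
      obtain ⟨s₁, h1, h2⟩ := (hT s).1 hs
      refine (hT _).2 ⟨s₁, h1, ?_⟩
      have h3 : (⟨B, hB'⟩ : R) - s ∈ J := by
        refine Ideal.subset_span ⟨0, 0, hzero, hzero, ?_⟩
        filter_upwards [hB] with q hq f g a hfa hf hg
        rw [hzv, hzv, add_zero]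
        change B (f, g, a) - s.1 (f, g, a) = 0
        rw [hq f g a hfa hf hg]
        exact sub_self _
      have : (⟨B, hB'⟩ : R) - s₁ = (⟨B, hB'⟩ - s) + (s - s₁) := by ring
      rw [this]
      exact J.add_mem h3 h2
    · intro c hc
      have hc' : (fun w : (P1 → P1) × (P1 → P1) × P1 =>
          c (A.coord w.2.2, A.coord (w.1 w.2.2), A.coord (w.2.1 (w.1 w.2.2)))) ∈ R :=
        HasPairExpr.coeff hc
      refine ⟨⟨_, hc'⟩, hT' _ ⟨_, hc'⟩ ?_ 0 0 hzero hzero ?_, rfl⟩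
      · intro f g f' g' a h1 h2 _ _
        simp only [h1]
        rw [← h1, h2, h1]
      · refine PairEqNear.of_forall fun f g a _ _ => ?_
        rw [hzv, hzv, add_zero]
        exact sub_self _
    · intro n hn hk
      obtain ⟨G, E₁, hE₁, hG, hG1, h⟩ := exists_reduction_eq (D := D) hn hk
      refine ⟨⟨_, HasPairExpr.var (s := Sum.inl n) hn hk⟩,
        hT' _ ⟨fun w => G w.1 w.2.2, (hG (x, y) ⟨hx, hy⟩).pair₁⟩ ?_ E₁ 0 hE₁ hzero ?_, rfl⟩
      · intro f g f' g' a h1 _ h3 _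
        exact hG1 f f' a h1 h3
      · filter_upwards [hreg] with q hq f g a hfa hf hg
        subst hfa
        rw [hzv, add_zero]
        change jetCoord A A f a n - G f a = _
        rw [h f a hf ⟨hq.1, hq.2.1⟩]
        ring
    · intro n hn hk
      obtain ⟨G, E₁, hE₁, hG, hG1, h⟩ := exists_reduction_eq (D := D) hn hk
      refine ⟨⟨_, HasPairExpr.var (s := Sum.inr n) hn hk⟩,
        hT' _ ⟨fun w => G w.2.1 (w.1 w.2.2), (hG (y, z) ⟨hy, hz⟩).pair₂⟩ ?_ 0 E₁ hzero hE₁ ?_, rfl⟩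
      · intro f g f' g' a h1 h2 _ h4
        change G g (f a) = G g' (f' a)
        rw [← h1] at h2 h4 ⊢
        exact hG1 g g' (f a) h2 h4
      · filter_upwards [hreg] with q hq f g a hfa hf hg
        subst hfa
        rw [hzv, zero_add]
        change jetCoord A A g (f a) n - G g (f a) = _
        rw [h g (f a) hg ⟨hq.2.1, hq.2.2⟩]
        ring
  obtain ⟨s, hs, hsE⟩ := key
  obtain ⟨s₁, hs₁, hJ⟩ := (hT s).1 hs
  obtain ⟨n, c, γ, hsum⟩ := Submodule.mem_span_set'.1 hJ
  choose E₁ E₂ hE₁ hE₂ hγ using fun m => (γ m).2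
  have hγ' : ∀ᶠ q in 𝓝 (x, y, z), ∀ m, ∀ f g a, (a, f a, g (f a)) = q → IsLocalBihol f a →
      IsLocalBihol g (f a) →
      (γ m).1.1 (f, g, a) = valueAt (E₁ m).1 f a + valueAt (E₂ m).1 g (f a) :=
    eventually_all.2 hγ
  have hpair : ∀ m, IsPairFunction k x y z fun f g a => (c m).1 (f, g, a) := fun m =>
    HasPairExpr.isPairFunction (HasPairExpr.of_mem_ring (c m).2) (hx.mem_dom A) (hy.mem_dom A)
      (hz.mem_dom A)
  have hW' : ∀ᶠ q : P1 × P1 × P1 in 𝓝 (x, y, z), (q.1, q.2.2) ∈ W :=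
    (tendsto_pair₃ x y z).eventually (W.isOpen.mem_nhds hW)
  have hdec : ∀ f g a, valueAt E.1 (g ∘ f) a = s₁.1 (f, g, a) +
      ∑ m, (c m).1 (f, g, a) * (γ m).1.1 (f, g, a) := by
    intro f g a
    have h1 : s.1 (f, g, a) = valueAt E.1 (g ∘ f) a := congrFun hsE (f, g, a)
    have h2 := congrArg (fun r : R => r.1 (f, g, a)) hsum
    have h3 : (∑ m, c m • (γ m).1 : R).1 (f, g, a) =
        ∑ m, (c m).1 (f, g, a) * (γ m).1.1 (f, g, a) := by
      have : (∑ m, c m • (γ m).1 : R).1 = ∑ m, (c m).1 * (γ m).1.1 := by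
        rw [← Subring.coe_subtype, map_sum]
        rfl
      rw [this, Finset.sum_apply]
      rfl
    have h4 : (s - s₁ : R).1 (f, g, a) = s.1 (f, g, a) - s₁.1 (f, g, a) := rfl
    rw [h3, h4, h1] at h2
    rw [h2]
    ring
  refine ⟨D.regOpens, D.regOpens, n, E₁, E₂, fun m f g a => (c m).1 (f, g, a),
    fun m f g a => (c m).1 (f, g, a), ⟨hx, hy⟩, ⟨hy, hz⟩,
    fun m => ⟨hE₁ m, hE₂ m, hpair m, hpair m⟩, ?_⟩
  filter_upwards [hγ', hreg, hW'] with q hq hq2 hq3 f g a hfa hf hg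
  subst hfa
  -- The value of `s₁` is unchanged when `f` and `g` are replaced by solutions with the same jets of
  -- order one. There both the pullback of `E` and the generators of `J` vanish, so `s₁` does too.
  have h0 : s₁.1 (f, g, a) = 0 := by
    obtain ⟨f', hf', hfa, hfd⟩ := exists_sol A A hq2.1 hq2.2.1
      (hf.deriv_ne_zero (hq2.1.mem_dom A) (hq2.2.1.mem_dom A))
    obtain ⟨g', hg', hga, hgd⟩ := exists_sol A A hq2.2.1 hq2.2.2
      (hg.deriv_ne_zero (hq2.2.1.mem_dom A) (hq2.2.2.mem_dom A))
    have hga' : g' (f' a) = g (f a) := by rw [hfa, hga]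
    rw [hs₁ f g f' g' a hfa.symm hga'.symm hfd.symm (by rw [hfa, hgd])]
    have h1 := hdec f' g' a
    have hg'' : D.Sol g' (f' a) := by rwa [hfa]
    rw [hE.1 _ _ (hg''.comp hf') (by simp only [Function.comp, hga']; exact hq3)] at h1
    rw [Finset.sum_eq_zero, add_zero] at h1
    · exact h1.symm
    · intro m _
      rw [hq m f' g' a (by rw [hga', hfa]) hf'.2.2.1 hg''.2.2.1,
        (hE₁ m).1 f' a hf' ⟨hf'.1, hf'.2.1⟩, (hE₂ m).1 g' (f' a) hg'' ⟨hg''.1, hg''.2.1⟩,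
        add_zero, mul_zero]
  rw [hdec, h0, zero_add]
  refine Finset.sum_congr rfl fun m _ => ?_
  rw [hq m f g a rfl hf hg]
  ring

end AffineData

/-! ### Division of analytic functions by a linear form -/

section Division

variable {E : Type*} [NormedAddCommGroup E] [NormedSpace ℂ E]

/-- The coefficients of the quotient by a linear form `ℓ` of an analytic function vanishing on its
kernel, where `π z = z - ℓ z • e`. -/
def divSeries (p : FormalMultilinearSeries ℂ E ℂ) (e : E) (π : E →L[ℂ] E) :
    FormalMultilinearSeries ℂ E ℂ := fun n =>
  ∑ k : Fin (n + 1), ((p (n + 1)).curryMid k e).compContinuousLinearMap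
    fun i => if i.castSucc < k then ContinuousLinearMap.id ℂ E else π

theorem norm_divSeries_le (p : FormalMultilinearSeries ℂ E ℂ) {e : E} {π : E →L[ℂ] E}
    (he : ‖e‖ ≤ 1) (hπ : ‖π‖ ≤ 1) (n : ℕ) : ‖divSeries p e π n‖ ≤ (n + 1) * ‖p (n + 1)‖ := by
  have h : ∀ k : Fin (n + 1), ‖((p (n + 1)).curryMid k e).compContinuousLinearMap
      fun i => if i.castSucc < k then ContinuousLinearMap.id ℂ E else π‖ ≤ ‖p (n + 1)‖ := by
    intro k
    refine (ContinuousMultilinearMap.norm_compContinuousLinearMap_le _ _).trans ?_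
    have h1 : ‖(p (n + 1)).curryMid k e‖ ≤ ‖p (n + 1)‖ := by
      refine (ContinuousLinearMap.le_opNorm _ _).trans ?_
      rw [ContinuousMultilinearMap.norm_curryMid]
      exact mul_le_of_le_one_right (norm_nonneg _) he
    have h2 : ∏ i : Fin n, ‖(if i.castSucc < k then ContinuousLinearMap.id ℂ E else π)‖ ≤ 1 := by
      refine Finset.prod_le_one (fun _ _ => norm_nonneg _) fun i _ => ?_
      split_ifs
      · exact ContinuousLinearMap.norm_id_le
      · exact hπ
    calc _ ≤ ‖(p (n + 1)).curryMid k e‖ * 1 :=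
          mul_le_mul_of_nonneg_left h2 (norm_nonneg _)
      _ ≤ _ := by rwa [mul_one]
  refine (norm_sum_le _ _).trans ((Finset.sum_le_sum fun k _ => h k).trans ?_)
  simp

theorem insertNth_eq {E : Type*} {n : ℕ} (k : Fin (n + 1)) (v z w : E) :
    k.insertNth (α := fun _ => E) v (fun i => if i.castSucc < k then z else w) =
      Function.update (fun j : Fin (n + 1) => if j < k then z else w) k v := by
  funext j
  rcases eq_or_ne j k with rfl | hj
  · simp
  · obtain ⟨i, rfl⟩ := Fin.exists_succAbove_eq hj
    rw [Fin.insertNth_apply_succAbove, Function.update_of_ne hj]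
    congr 1
    rw [eq_iff_iff]
    exact (Fin.succAbove_lt_iff_castSucc_lt k i).symm

/-- Replace the arguments `z` by `π z` one at a time. By multilinearity, each step of this
telescoping sum changes the value by `c` times the value with `e` in one slot, and these are the
terms of `divSeries`. -/
theorem divSeries_apply (p : FormalMultilinearSeries ℂ E ℂ) {e : E} {π : E →L[ℂ] E} {c : ℂ} {z : E}
    (hz : z = π z + c • e) (n : ℕ) :
    c * divSeries p e π n (fun _ => z) =
      p (n + 1) (fun _ => z) - p (n + 1) (fun _ => π z) := by
  let T : ℕ → ℂ := fun k => p (n + 1) fun j : Fin (n + 1) => if (j : ℕ) < k then z else π z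
  have h0 : T 0 = p (n + 1) (fun _ => π z) := by simp [T]
  have h1 : T (n + 1) = p (n + 1) (fun _ => z) := by
    simp only [T]
    congr 1
    funext j
    rw [if_pos j.2]
  rw [← h0, ← h1, ← Finset.sum_range_sub, ← Fin.sum_univ_eq_sum_range (fun k => T (k + 1) - T k),
    divSeries, sum_apply, Finset.mul_sum]
  refine Finset.sum_congr rfl fun k _ => ?_
  have e1 : (fun j : Fin (n + 1) => if (j : ℕ) < (k : ℕ) + 1 then z else π z) =
      Function.update (fun j : Fin (n + 1) => if j < k then z else π z) k z := by
    funext j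
    rcases eq_or_ne j k with rfl | hj
    · simp
    · rw [Function.update_of_ne hj]
      have : ((j : ℕ) < (k : ℕ) + 1) ↔ j < k := by
        have : (j : ℕ) ≠ k := fun h => hj (Fin.ext h)
        rw [Fin.lt_def]
        omega
      simp only [this]
  have e2 : (fun j : Fin (n + 1) => if (j : ℕ) < (k : ℕ) then z else π z) =
      Function.update (fun j : Fin (n + 1) => if j < k then z else π z) k (π z) := by
    funext j
    rcases eq_or_ne j k with rfl | hj
    · simp
    · rw [Function.update_of_ne hj]
      rfl
  simp only [T]
  rw [e1, e2, ← ContinuousMultilinearMap.map_update_sub]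
  have e3 : z - π z = c • e := by
    nth_rewrite 1 [hz]
    abel
  rw [e3, ContinuousMultilinearMap.map_update_smul, smul_eq_mul]
  congr 1
  rw [ContinuousMultilinearMap.compContinuousLinearMap_apply,
    ContinuousMultilinearMap.curryMid_apply, ← insertNth_eq]
  congr 2
  funext i
  split_ifs <;> rfl

/-- As `f (w + π z) = 0`, one has `f (w + z) = f (w + z) - f (w + π z)`. In the power series, each
homogeneous term of this difference is divisible by `l z` according to `divSeries_apply`, and the
quotients form a convergent series. -/
theorem exists_eq_mul_of_vanish {f : E → ℂ} {w : E} (hf : AnalyticAt ℂ f w) (l : E →L[ℂ] ℂ)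
    {e : E} {π : E →L[ℂ] E} (hz : ∀ z, z = π z + l z • e) (he : ‖e‖ ≤ 1) (hπ : ‖π‖ ≤ 1)
    (hv : ∀ᶠ z in 𝓝 (0 : E), f (w + π z) = 0) :
    ∃ g : E → ℂ, AnalyticAt ℂ g w ∧ ∀ᶠ z in 𝓝 w, f z = l (z - w) * g z := by
  obtain ⟨p, r, hp⟩ := hf
  obtain ⟨s, hs0, hsr⟩ := ENNReal.lt_iff_exists_nnreal_btwn.1 hp.r_pos
  have hs0' : 0 < s := by exact_mod_cast hs0
  obtain ⟨a, ha, C, hC, hpa⟩ := p.norm_mul_pow_le_mul_pow_of_lt_radius (hsr.trans_le hp.r_le)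
  set q := divSeries p e π with hq
  have hrad : (s : ENNReal) ≤ q.radius := by
    -- The bound on the terms of `divSeries` loses a factor `n + 1`, which the geometric decay `aⁿ`
    -- available strictly inside the disc of convergence absorbs.
    have hb : BddAbove (Set.range fun n : ℕ => (n : ℝ) * a ^ n) :=
      (tendsto_self_mul_const_pow_of_lt_one ha.1.le ha.2).bddAbove_range
    obtain ⟨M, hM⟩ := hb
    refine q.le_radius_of_bound (M * C / s) fun n => ?_
    have h1 := norm_divSeries_le p he hπ n
    have h2 := hpa (n + 1)
    have h3 : ((n + 1 : ℕ) : ℝ) * a ^ (n + 1) ≤ M := hM ⟨n + 1, rfl⟩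
    have hs : (0 : ℝ) < s := by exact_mod_cast hs0'
    rw [le_div_iff₀ hs]
    calc ‖q n‖ * (s : ℝ) ^ n * s = ‖q n‖ * (s : ℝ) ^ (n + 1) := by ring
      _ ≤ ((n + 1) * ‖p (n + 1)‖) * (s : ℝ) ^ (n + 1) :=
          mul_le_mul_of_nonneg_right h1 (by positivity)
      _ = (n + 1) * (‖p (n + 1)‖ * (s : ℝ) ^ (n + 1)) := by ring
      _ ≤ (n + 1) * (C * a ^ (n + 1)) := mul_le_mul_of_nonneg_left h2 (by positivity)
      _ = (((n + 1 : ℕ) : ℝ) * a ^ (n + 1)) * C := by push_cast; ring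
      _ ≤ M * C := mul_le_mul_of_nonneg_right h3 hC.le
  have hqpos : 0 < q.radius := lt_of_lt_of_le hs0 hrad
  have hqb := q.hasFPowerSeriesOnBall hqpos
  have hqA : AnalyticAt ℂ q.sum 0 := hqb.analyticAt
  refine ⟨fun z => q.sum (z - w), ?_, ?_⟩
  · have h1 : AnalyticAt ℂ (fun z : E => z - w) w := analyticAt_id.sub analyticAt_const
    exact AnalyticAt.fun_comp (g := q.sum) (f := fun z : E => z - w) (by simpa using hqA) h1
  · have hsub : Tendsto (fun z : E => z - w) (𝓝 w) (𝓝 0) := by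
      have : Tendsto (fun z : E => z - w) (𝓝 w) (𝓝 (w - w)) :=
        (continuous_id.sub continuous_const).continuousAt
      rwa [sub_self] at this
    have hball : Metric.eball (0 : E) s ∈ 𝓝 (0 : E) := Metric.eball_mem_nhds _ hs0
    have hπ0 : Tendsto (fun z : E => π z) (𝓝 0) (𝓝 0) := by
      have := π.continuous.tendsto 0
      rwa [map_zero] at this
    have key : ∀ᶠ z in 𝓝 (0 : E), f (w + z) = l z * q.sum z := by
      filter_upwards [hball, hπ0.eventually hball, hv] with z hz1 hz2 hz3
      have hzr : z ∈ Metric.eball (0 : E) r := Metric.eball_subset_eball hsr.le hz1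
      have hzr2 : π z ∈ Metric.eball (0 : E) r := Metric.eball_subset_eball hsr.le hz2
      have s1 := hp.hasSum hzr
      have s2 := hp.hasSum hzr2
      have s3 : HasSum (fun n => q n fun _ => z) (q.sum z) := by
        have := hqb.hasSum (y := z) (Metric.eball_subset_eball hrad hz1)
        rwa [zero_add] at this
      rw [hz3] at s2
      have s4 := s1.sub s2
      rw [sub_zero] at s4
      have s5 := s3.mul_left (l z)
      simp only [hq, divSeries_apply p (hz z)] at s5
      have s6 := (hasSum_nat_add_iff' (f := fun n => (p n fun _ => z) - p n fun _ => π z) 1).2 s4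
      have e0 : (p 0 fun _ => z) - (p 0 fun _ => π z) = 0 := by
        rw [sub_eq_zero]
        congr 1
        funext i
        exact i.elim0
      rw [Finset.sum_range_one, e0, sub_zero] at s6
      exact s6.unique s5
    filter_upwards [hsub.eventually key] with z hz
    rwa [add_sub_cancel] at hz

end Division

/-! ### Removing denominators from ideals generated over a flat extension -/

section Desaturation

variable {A O A₀ O₀ : Type*} [CommRing A] [CommRing O] [CommRing A₀] [CommRing O₀]

attribute [local instance] MvPolynomial.algebraMvPolynomial in
-- Polynomials over `O₀` are the base change of polynomials over `A₀`, and flatness is preserved by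
-- base change.
theorem flat_mvPolynomial (σ : Type*) [Algebra A₀ O₀] [Module.Flat A₀ O₀] :
    Module.Flat (MvPolynomial σ A₀) (MvPolynomial σ O₀) :=
  Module.Flat.isBaseChange A₀ (MvPolynomial σ A₀) O₀ (MvPolynomial σ O₀)
    (Algebra.IsPushout.out (R := A₀) (S := MvPolynomial σ A₀) (R' := O₀)
      (S' := MvPolynomial σ O₀))

theorem exists_trivial_relation_of_algebra {B C : Type*} [CommRing B] [CommRing C] [Algebra B C]
    [Module.Flat B C] {n : ℕ} {T : Fin n → B} {c : Fin n → C}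
    (h : ∑ i, c i * algebraMap B C (T i) = 0) :
    ∃ (m : ℕ) (a : Fin n → Fin m → B) (y : Fin m → C),
      (∀ i, c i = ∑ j, algebraMap B C (a i j) * y j) ∧ ∀ j, ∑ i, T i * a i j = 0 := by
  have h' : ∑ i, T i • c i = 0 := by
    rw [← h]
    exact Finset.sum_congr rfl fun i _ => by rw [Algebra.smul_def, mul_comm]
  obtain ⟨m, a, y, h1, h2⟩ := Module.Flat.isTrivialRelation_of_sum_smul_eq_zero
    (R := B) (M := C) (f := T) (x := c) h'
  exact ⟨m, a, y, fun i => by simp only [h1 i, Algebra.smul_def], h2⟩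

attribute [local instance] MvPolynomial.algebraMvPolynomial in
theorem exists_trivial_relation {σ : Type*} [Algebra A₀ O₀] [Module.Flat A₀ O₀] {n : ℕ}
    {T : Fin n → MvPolynomial σ A₀} {c : Fin n → MvPolynomial σ O₀}
    (h : ∑ i, c i * MvPolynomial.map (algebraMap A₀ O₀) (T i) = 0) :
    ∃ (m : ℕ) (a : Fin n → Fin m → MvPolynomial σ A₀) (y : Fin m → MvPolynomial σ O₀),
      (∀ i, c i = ∑ j, MvPolynomial.map (algebraMap A₀ O₀) (a i j) * y j) ∧
        ∀ j, ∑ i, T i * a i j = 0 := by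
  have := flat_mvPolynomial (A₀ := A₀) (O₀ := O₀) σ
  rw [← MvPolynomial.algebraMap_def] at h ⊢
  exact exists_trivial_relation_of_algebra h

/-- The extension to `O` of an ideal saturated with respect to `u` is again saturated, provided that
`O / u` is flat over `A / u`; flatness of `O` over `A` itself is not needed. If `u G = ∑ cᵢ Tᵢ` with
`Tᵢ ∈ J`, the `cᵢ` form a relation modulo `u` between the `Tᵢ`, hence by flatness a combination of
relations over `A / u`. Lifting these, `cᵢ = u dᵢ + ∑ aᵢⱼ yⱼ` and `∑ Tᵢ aᵢⱼ = u Sⱼ`. Saturation of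
`J` gives `Sⱼ ∈ J`, and cancelling `u` yields `G = ∑ dᵢ Tᵢ + ∑ yⱼ Sⱼ`. -/
theorem mem_map_of_C_mul_mem {σ : Type*} [Algebra A₀ O₀] [Module.Flat A₀ O₀]
    {ι : A →+* O} {πA : A →+* A₀} {πO : O →+* O₀}
    (hcomm : ∀ a, πO (ι a) = algebraMap A₀ O₀ (πA a))
    (hA : Function.Surjective πA) (hO : Function.Surjective πO) {u : A}
    (hkA : ∀ a, πA a = 0 ↔ u ∣ a) (hkO : ∀ c, πO c = 0 ↔ ι u ∣ c)
    (hreg : ∀ c, ι u * c = 0 → c = 0)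
    {J : Ideal (MvPolynomial σ A)} (hJ : ∀ T, MvPolynomial.C u * T ∈ J → T ∈ J)
    {G : MvPolynomial σ O}
    (hG : MvPolynomial.C (ι u) * G ∈ J.map (MvPolynomial.map ι)) :
    G ∈ J.map (MvPolynomial.map ι) := by
  obtain ⟨n, c, g, hg⟩ := Submodule.mem_span_set'.1 hG
  choose T hTJ hT using fun i => (g i).2
  simp only [smul_eq_mul, ← hT] at hg
  have hcomm' : ∀ P : MvPolynomial σ A, MvPolynomial.map πO (MvPolynomial.map ι P)
      = MvPolynomial.map (algebraMap A₀ O₀) (MvPolynomial.map πA P) := by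
    intro P
    rw [MvPolynomial.map_map, MvPolynomial.map_map]
    congr 2
    exact RingHom.ext hcomm
  have hu : πO (ι u) = 0 := (hkO _).2 dvd_rfl
  -- The reduction modulo `u` of the expression of `u G`, to which the equational criterion of
  -- flatness applies.
  have h0 : ∑ i, MvPolynomial.map πO (c i) *
      MvPolynomial.map (algebraMap A₀ O₀) (MvPolynomial.map πA (T i)) = 0 := by
    have := congrArg (MvPolynomial.map πO) hg
    rw [map_mul, MvPolynomial.map_C, hu, map_zero, zero_mul, map_sum] at this
    rw [← this]
    exact Finset.sum_congr rfl fun i _ => by rw [map_mul, ← hcomm']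
  obtain ⟨m, a, y, h1, h2⟩ := exists_trivial_relation h0
  choose a' ha' using fun i j => MvPolynomial.map_surjective πA hA (a i j)
  choose y' hy' using fun j => MvPolynomial.map_surjective πO hO (y j)
  have hd : ∀ i, MvPolynomial.C (ι u) ∣ c i - ∑ j, MvPolynomial.map ι (a' i j) * y' j := by
    intro i
    rw [MvPolynomial.C_dvd_iff_map_hom_eq_zero πO _ hkO, map_sub, h1 i, map_sum, sub_eq_zero]
    exact Finset.sum_congr rfl fun j _ => by rw [map_mul, hcomm', ha', hy']
  have hS : ∀ j, MvPolynomial.C u ∣ ∑ i, T i * a' i j := by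
    intro j
    rw [MvPolynomial.C_dvd_iff_map_hom_eq_zero πA _ hkA, map_sum, ← h2 j]
    exact Finset.sum_congr rfl fun i _ => by rw [map_mul, ha']
  choose d hd using hd
  choose S hS using hS
  -- The only use of the saturation of `J`: the product of `u` and `S j` is a combination of the `T
  -- i`.
  have hSJ : ∀ j, S j ∈ J := fun j => hJ _ (by
    rw [← hS j]
    exact J.sum_mem fun i _ => J.mul_mem_right _ (hTJ i))
  have key : MvPolynomial.C (ι u) * G = MvPolynomial.C (ι u) *
      (∑ i, d i * MvPolynomial.map ι (T i) + ∑ j, y' j * MvPolynomial.map ι (S j)) := by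
    have e : ∀ j, MvPolynomial.C (ι u) * MvPolynomial.map ι (S j)
        = ∑ i, MvPolynomial.map ι (T i) * MvPolynomial.map ι (a' i j) := by
      intro j
      have := congrArg (MvPolynomial.map ι) (hS j)
      rw [map_mul, MvPolynomial.map_C, map_sum] at this
      rw [← this]
      simp
    have e2 : ∀ i, c i = MvPolynomial.C (ι u) * d i + ∑ j, MvPolynomial.map ι (a' i j) * y' j :=
      fun i => by rw [← hd i]; ring
    rw [← hg, mul_add, Finset.mul_sum, Finset.mul_sum]
    have e3 : ∀ j, MvPolynomial.C (ι u) * (y' j * MvPolynomial.map ι (S j))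
        = ∑ i, y' j * (MvPolynomial.map ι (T i) * MvPolynomial.map ι (a' i j)) := by
      intro j
      rw [mul_left_comm, e, Finset.mul_sum]
    simp only [e3]
    rw [Finset.sum_comm, ← Finset.sum_add_distrib]
    refine Finset.sum_congr rfl fun i _ => ?_
    rw [e2 i, add_mul, Finset.sum_mul]
    congr 1
    · ring
    · exact Finset.sum_congr rfl fun j _ => by ring
  have hreg' : ∀ P : MvPolynomial σ O, MvPolynomial.C (ι u) * P = 0 → P = 0 := by
    intro P hP
    ext m
    have := congrArg (MvPolynomial.coeff m) hP
    rw [MvPolynomial.coeff_C_mul, MvPolynomial.coeff_zero] at this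
    rw [hreg _ this, MvPolynomial.coeff_zero]
  have key' := sub_eq_zero.1 (hreg' _ ((mul_sub _ _ _).trans (sub_eq_zero.2 key)))
  rw [key']
  exact Ideal.add_mem _
    (Ideal.sum_mem _ fun i _ => Ideal.mul_mem_left _ _ (Ideal.mem_map_of_mem _ (hTJ i)))
    (Ideal.sum_mem _ fun j _ => Ideal.mul_mem_left _ _ (Ideal.mem_map_of_mem _ (hSJ j)))

/-- Over the complex numbers a nonzero polynomial is a constant times linear factors, so a
multiplicative property need only be checked on those. -/
theorem aeval_mem_of_linear_mem {τ : Type*} (S : Submonoid (MvPolynomial τ ℂ))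
    (x : MvPolynomial τ ℂ) {c : Polynomial ℂ} (hc : c ≠ 0)
    (hconst : ∀ r : ℂ, r ≠ 0 → MvPolynomial.C r ∈ S)
    (h : ∀ r : ℂ, c.IsRoot r → x - MvPolynomial.C r ∈ S) : Polynomial.aeval x c ∈ S := by
  induction hn : c.natDegree generalizing c with
  | zero =>
    obtain ⟨a, rfl⟩ : ∃ a, c = Polynomial.C a := ⟨_, Polynomial.eq_C_of_natDegree_eq_zero hn⟩
    rw [Polynomial.aeval_C]
    exact hconst a fun h0 => hc (by rw [h0, map_zero])
  | succ n ih =>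
    obtain ⟨r, hr⟩ := IsAlgClosed.exists_root c (by
      intro h0
      rw [Polynomial.degree_eq_natDegree hc, hn] at h0
      norm_cast at h0)
    obtain ⟨c', rfl⟩ := Polynomial.dvd_iff_isRoot.2 hr
    have hc' : c' ≠ 0 := right_ne_zero_of_mul hc
    rw [Polynomial.natDegree_mul (Polynomial.X_sub_C_ne_zero r) hc',
      Polynomial.natDegree_X_sub_C] at hn
    rw [map_mul, map_sub, Polynomial.aeval_X, Polynomial.aeval_C]
    refine S.mul_mem (h r hr) (ih hc' (fun r' hr' => h r' ?_) (by omega))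
    rw [Polynomial.IsRoot, Polynomial.eval_mul, hr', mul_zero]

/-- Modulo relations making `y₁` invertible and expressing `hᴺ y` through `y₁` for each further
variable `y`, every element becomes an expression in `y₁` after multiplication by powers of
`h` and `y₁`. -/
theorem exists_pow_mul_mem {B O' : Type*} [CommRing B] (S : Subring B) {σ : Type*}
    [CommRing O'] (φ : MvPolynomial σ O' →+* B) {h y : B} (hh : h ∈ S) (hy : y ∈ S)
    (hC : ∀ c, φ (MvPolynomial.C c) ∈ S)
    (hX : ∀ s, ∃ M N : ℕ, h ^ M * y ^ N * φ (MvPolynomial.X s) ∈ S) (G : MvPolynomial σ O') :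
    ∃ M N : ℕ, h ^ M * y ^ N * φ G ∈ S := by
  induction G using MvPolynomial.induction_on with
  | C c => exact ⟨0, 0, by simpa using hC c⟩
  | add P Q hP hQ =>
    obtain ⟨M, N, h1⟩ := hP
    obtain ⟨M', N', h2⟩ := hQ
    refine ⟨M + M', N + N', ?_⟩
    have : h ^ (M + M') * y ^ (N + N') * φ (P + Q)
        = h ^ M' * y ^ N' * (h ^ M * y ^ N * φ P) + h ^ M * y ^ N * (h ^ M' * y ^ N' * φ Q) := by
      rw [map_add]
      ring
    rw [this]
    have hp : ∀ a b, h ^ a * y ^ b ∈ S := fun a b => S.mul_mem (S.pow_mem hh a) (S.pow_mem hy b)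
    exact S.add_mem (S.mul_mem (hp _ _) h1) (S.mul_mem (hp _ _) h2)
  | mul_X P s hP =>
    obtain ⟨M, N, h1⟩ := hP
    obtain ⟨M', N', h2⟩ := hX s
    refine ⟨M + M', N + N', ?_⟩
    have : h ^ (M + M') * y ^ (N + N') * φ (P * MvPolynomial.X s)
        = (h ^ M * y ^ N * φ P) * (h ^ M' * y ^ N' * φ (MvPolynomial.X s)) := by
      rw [map_mul]
      ring
    rw [this]
    exact S.mul_mem h1 h2

end Desaturation

/-! ### Rings of germs of analytic functions -/

section Germs

/-- The functions which are analytic at `w`. -/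
def anFun {E : Type*} [NormedAddCommGroup E] [NormedSpace ℂ E] (w : E) : Subring (E → ℂ) where
  carrier := {f | AnalyticAt ℂ f w}
  mul_mem' := fun h h' => AnalyticAt.mul h h'
  one_mem' := analyticAt_const
  add_mem' := fun h h' => AnalyticAt.add h h'
  zero_mem' := analyticAt_const
  neg_mem' := fun h => AnalyticAt.neg h

/-- The germs at `w` of analytic functions. -/
def anGerm {E : Type*} [NormedAddCommGroup E] [NormedSpace ℂ E] (w : E) :
    Subring (Germ (𝓝 w) ℂ) :=
  (anFun w).map (Germ.coeRingHom (𝓝 w))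

variable {E : Type*} [NormedAddCommGroup E] [NormedSpace ℂ E]

/-- The germ at `w` of an analytic function. -/
def toGerm (w : E) : anFun w →+* anGerm w :=
  ((Germ.coeRingHom (𝓝 w)).comp (anFun w).subtype).codRestrict (anGerm w)
    fun f => ⟨f.1, f.2, rfl⟩

theorem toGerm_surjective (w : E) : Function.Surjective (toGerm w) := by
  rintro ⟨_, f, hf, rfl⟩
  exact ⟨⟨f, hf⟩, rfl⟩

theorem toGerm_eq_iff {w : E} {f g : anFun w} : toGerm w f = toGerm w g ↔ f.1 =ᶠ[𝓝 w] g.1 := by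
  rw [Subtype.ext_iff]
  exact Germ.coe_eq

theorem toGerm_eq_zero_iff {w : E} {f : anFun w} :
    toGerm w f = 0 ↔ ∀ᶠ z in 𝓝 w, f.1 z = 0 := by
  rw [← map_zero (toGerm w), toGerm_eq_iff]
  rfl

theorem toGerm_dvd_iff {w : E} {f g : anFun w} :
    toGerm w f ∣ toGerm w g ↔
      ∃ c, AnalyticAt ℂ c w ∧ ∀ᶠ z in 𝓝 w, g.1 z = f.1 z * c z := by
  constructor
  · rintro ⟨c, hc⟩
    obtain ⟨c, rfl⟩ := toGerm_surjective w c
    rw [← map_mul, toGerm_eq_iff] at hc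
    exact ⟨c.1, c.2, hc⟩
  · rintro ⟨c, hc, h⟩
    exact ⟨toGerm w ⟨c, hc⟩, by rw [← map_mul, toGerm_eq_iff]; exact h⟩

/-- Pullback of germs of analytic functions by an analytic map. -/
def pullGerm {F : Type*} [NormedAddCommGroup F] [NormedSpace ℂ F] {v : F} {w : E} (j : F → E)
    (hj : AnalyticAt ℂ j v) (hv : j v = w) : anGerm w →+* anGerm v where
  toFun g := ⟨g.1.compTendsto j (hv ▸ hj.continuousAt.tendsto), by
    obtain ⟨f, hf, hg⟩ := g.2
    refine ⟨f ∘ j, ?_, ?_⟩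
    · subst hv
      exact AnalyticAt.comp hf hj
    · rw [← hg]
      rfl⟩
  map_one' := rfl
  map_zero' := rfl
  map_mul' := by
    rintro ⟨_, f, hf, rfl⟩ ⟨_, f', hf', rfl⟩
    rfl
  map_add' := by
    rintro ⟨_, f, hf, rfl⟩ ⟨_, f', hf', rfl⟩
    rfl

theorem pullGerm_toGerm {F : Type*} [NormedAddCommGroup F] [NormedSpace ℂ F] {v : F} {w : E}
    {j : F → E} (hj : AnalyticAt ℂ j v) (hv : j v = w) (f : anFun w) (hf : AnalyticAt ℂ (f.1 ∘ j) v) :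
    pullGerm j hj hv (toGerm w f) = toGerm v ⟨f.1 ∘ j, hf⟩ := rfl

/-- An analytic function vanishing on a dense set vanishes. -/
theorem eventually_eq_zero_of_dense {f : E → ℂ} {w : E} (hf : AnalyticAt ℂ f w) {S : Set E}
    (hS : Dense S) (h : ∀ᶠ z in 𝓝 w, z ∈ S → f z = 0) : ∀ᶠ z in 𝓝 w, f z = 0 := by
  obtain ⟨U, hU, hUo, hwU⟩ := eventually_nhds_iff.1 (h.and hf.eventually_analyticAt)
  refine eventually_nhds_iff.2 ⟨U, fun z hz => ?_, hUo, hwU⟩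
  have hc : ContinuousOn f U := fun y hy => (hU y hy).2.continuousAt.continuousWithinAt
  by_contra hne
  have hV : IsOpen (U ∩ f ⁻¹' {0}ᶜ) := hc.isOpen_inter_preimage hUo isOpen_compl_singleton
  obtain ⟨y, hy, hyS⟩ := hS.inter_open_nonempty _ hV ⟨z, hz, hne⟩
  exact hy.2 ((hU y hy.1).1 hyS)

end Germs

/-! ### Polynomials as germs -/

section PolyGerm

/-- The germ at `γ` of a polynomial in one variable. -/
def polyGerm₁ (γ : ℂ) : Polynomial ℂ →+* anGerm γ :=
  (toGerm γ).comp ((RingHom.pi fun z => Polynomial.evalRingHom z).codRestrict (anFun γ)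
    fun p => p.differentiable.analyticAt γ)

theorem polyGerm₁_apply (γ : ℂ) (p : Polynomial ℂ) :
    polyGerm₁ γ p = toGerm γ ⟨fun z => p.eval z, p.differentiable.analyticAt γ⟩ := rfl

/-- The germ at `w` of a polynomial in two variables. -/
def polyGerm (w : ℂ × ℂ) : MvPolynomial (Fin 2) ℂ →+* anGerm w :=
  (toGerm w).comp ((RingHom.pi fun z : ℂ × ℂ => AffineData.ev z.1 z.2).codRestrict (anFun w)
    fun p => AffineData.analyticAt_ev p w)

theorem polyGerm_apply (w : ℂ × ℂ) (p : MvPolynomial (Fin 2) ℂ) :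
    polyGerm w p = toGerm w ⟨fun z => AffineData.ev z.1 z.2 p, AffineData.analyticAt_ev p w⟩ := rfl

theorem polyGerm₁_injective (γ : ℂ) : Function.Injective (polyGerm₁ γ) := by
  rw [injective_iff_map_eq_zero]
  intro p hp
  rw [polyGerm₁_apply, toGerm_eq_zero_iff] at hp
  by_contra hne
  have hfin := Polynomial.finite_setOfPred_isRoot hne
  exact (infinite_of_mem_nhds γ hp) hfin

instance anGerm_isDomain (γ : ℂ) : IsDomain (anGerm γ) := by
  have : NoZeroDivisors (anGerm γ) := by
    refine ⟨?_⟩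
    intro f g hfg
    obtain ⟨f, rfl⟩ := toGerm_surjective γ f
    obtain ⟨g, rfl⟩ := toGerm_surjective γ g
    rw [← map_mul, toGerm_eq_zero_iff] at hfg
    rw [toGerm_eq_zero_iff, toGerm_eq_zero_iff]
    rcases f.2.eventually_eq_zero_or_eventually_ne_zero with h | h
    · exact Or.inl h
    rcases g.2.eventually_eq_zero_or_eventually_ne_zero with h' | h'
    · exact Or.inr h'
    obtain ⟨z, h1, h2, h3⟩ := ((hfg.filter_mono nhdsWithin_le_nhds).and (h.and h')).exists
    exact absurd h1 (mul_ne_zero h2 h3)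
  have : Nontrivial (anGerm γ) := (polyGerm₁_injective γ).nontrivial
  exact NoZeroDivisors.to_isDomain _

/-- A torsion-free module over a principal ideal domain is flat. Torsion-freeness holds because
germs in one variable form a domain in which the polynomials embed. -/
theorem flat_anGerm (γ : ℂ) :
    let := (polyGerm₁ γ).toAlgebra
    Module.Flat (Polynomial ℂ) (anGerm γ) := by
  let := (polyGerm₁ γ).toAlgebra
  have : Module.IsTorsionFree (Polynomial ℂ) (anGerm γ) := by
    rw [Module.isTorsionFree_iff_algebraMap_injective]
    exact polyGerm₁_injective γ
  infer_instance

/-- The coordinates of the plane. -/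
def planeCoord (s : Fin 2) : ℂ × ℂ →L[ℂ] ℂ :=
  (![ContinuousLinearMap.fst ℂ ℂ ℂ, ContinuousLinearMap.snd ℂ ℂ ℂ] : Fin 2 → _) s

/-- The standard basis of the plane. -/
def planeBasis (s : Fin 2) : ℂ × ℂ := (![(1, 0), (0, 1)] : Fin 2 → ℂ × ℂ) s

theorem ev_X (z : ℂ × ℂ) (s : Fin 2) :
    AffineData.ev z.1 z.2 (MvPolynomial.X s) = planeCoord s z := by
  fin_cases s <;> simp [AffineData.ev, planeCoord]

theorem plane_decomposition (s : Fin 2) (z : ℂ × ℂ) :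
    z = planeCoord (1 - s) z • planeBasis (1 - s) + planeCoord s z • planeBasis s := by
  fin_cases s <;> simp [planeCoord, planeBasis]

theorem norm_planeBasis (s : Fin 2) : ‖planeBasis s‖ ≤ 1 := by
  fin_cases s <;> simp [planeBasis, Prod.norm_def]

theorem norm_planeCoord_le (s : Fin 2) (z : ℂ × ℂ) : ‖planeCoord s z‖ ≤ ‖z‖ := by
  fin_cases s
  · exact norm_fst_le z
  · exact norm_snd_le z

theorem planeCoord_line (s : Fin 2) (r v : ℂ) :
    planeCoord s (r • planeBasis s + v • planeBasis (1 - s)) = r ∧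
      planeCoord (1 - s) (r • planeBasis s + v • planeBasis (1 - s)) = v := by
  fin_cases s <;> simp [planeCoord, planeBasis]

/-- Restriction of polynomials to the line where coordinate `s` is `r`. -/
def restrictLine (s : Fin 2) (r : ℂ) : MvPolynomial (Fin 2) ℂ →ₐ[ℂ] Polynomial ℂ :=
  MvPolynomial.aeval fun t => if t = s then Polynomial.C r else Polynomial.X

theorem eval_restrictLine (s : Fin 2) (r v : ℂ) (a : MvPolynomial (Fin 2) ℂ) :
    (restrictLine s r a).eval v =
      AffineData.ev (r • planeBasis s + v • planeBasis (1 - s)).1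
        (r • planeBasis s + v • planeBasis (1 - s)).2 a := by
  induction a using MvPolynomial.induction_on with
  | C c => simp [restrictLine, AffineData.ev]
  | add p q hp hq => rw [map_add, Polynomial.eval_add, hp, hq, map_add]
  | mul_X p t hp =>
    rw [map_mul, Polynomial.eval_mul, hp, map_mul, ev_X]
    congr 1
    fin_cases s <;> fin_cases t <;> simp [restrictLine, planeCoord, planeBasis]

theorem restrictLine_surjective (s : Fin 2) (r : ℂ) : Function.Surjective (restrictLine s r) := by
  intro p
  refine ⟨Polynomial.aeval (MvPolynomial.X (1 - s)) p, ?_⟩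
  rw [← Polynomial.aeval_algHom_apply]
  have : restrictLine s r (MvPolynomial.X (1 - s)) = Polynomial.X := by
    fin_cases s <;> simp [restrictLine]
  rw [this, Polynomial.aeval_X_left_apply]

/-- Modulo `X s - r`, a polynomial coincides with its restriction to the line viewed again as a
polynomial in two variables; it suffices to see this on the variables. -/
theorem restrictLine_eq_zero_iff (s : Fin 2) (r : ℂ) (a : MvPolynomial (Fin 2) ℂ) :
    restrictLine s r a = 0 ↔ MvPolynomial.X s - MvPolynomial.C r ∣ a := by
  constructor
  · intro h
    set I := Ideal.span {(MvPolynomial.X s - MvPolynomial.C r : MvPolynomial (Fin 2) ℂ)}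
    have key : (Ideal.Quotient.mkₐ ℂ I) = (Ideal.Quotient.mkₐ ℂ I).comp
        ((Polynomial.aeval (MvPolynomial.X (1 - s))).comp (restrictLine s r)) := by
      refine MvPolynomial.algHom_ext fun t => ?_
      by_cases ht : t = s
      · subst ht
        rw [AlgHom.comp_apply, AlgHom.comp_apply, restrictLine, MvPolynomial.aeval_X, if_pos rfl,
          Polynomial.aeval_C, Ideal.Quotient.mkₐ_eq_mk, Ideal.Quotient.eq]
        exact Ideal.mem_span_singleton_self _
      · rw [AlgHom.comp_apply, AlgHom.comp_apply, restrictLine, MvPolynomial.aeval_X, if_neg ht,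
          Polynomial.aeval_X]
        congr 2
        fin_cases s <;> fin_cases t <;> simp_all
    have := DFunLike.congr_fun key a
    rw [AlgHom.comp_apply, AlgHom.comp_apply, h, map_zero, map_zero, Ideal.Quotient.mkₐ_eq_mk,
      Ideal.Quotient.eq_zero_iff_mem] at this
    exact Ideal.mem_span_singleton.1 this
  · rintro ⟨b, rfl⟩
    simp [restrictLine]

end PolyGerm

/-! ### Removing linear factors from ideals extended to germs in two variables -/

section DesaturationGerm

variable {w : ℂ × ℂ} (s : Fin 2)

theorem polyGerm_linear (s : Fin 2) (r : ℂ) (h : AnalyticAt ℂ (fun z => planeCoord s z - r) w) :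
    polyGerm w (MvPolynomial.X s - MvPolynomial.C r)
      = toGerm w ⟨fun z => planeCoord s z - r, h⟩ := by
  rw [polyGerm_apply]
  congr 2
  funext z
  rw [map_sub, ev_X]
  simp [AffineData.ev]

theorem analyticAt_planeCoord_sub (s : Fin 2) (r : ℂ) :
    AnalyticAt ℂ (fun z => planeCoord s z - r) w :=
  ((planeCoord s).analyticAt w).fun_sub analyticAt_const

theorem dense_planeCoord_ne (s : Fin 2) (r : ℂ) : Dense {z : ℂ × ℂ | planeCoord s z ≠ r} := by
  have h1 : Dense ({r}ᶜ : Set ℂ) := dense_compl_singleton r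
  fin_cases s
  · refine (h1.prod dense_univ).mono ?_
    rintro z ⟨hz, -⟩
    exact hz
  · refine (dense_univ.prod h1).mono ?_
    rintro z ⟨-, hz⟩
    exact hz

theorem isUnit_polyGerm_linear {r : ℂ} (hr : planeCoord s w ≠ r) :
    IsUnit (polyGerm w (MvPolynomial.X s - MvPolynomial.C r)) := by
  have h := analyticAt_planeCoord_sub (w := w) s r
  rw [polyGerm_linear s r h, isUnit_iff_dvd_one, ← map_one (toGerm w), toGerm_dvd_iff]
  have hne : planeCoord s w - r ≠ 0 := sub_ne_zero.2 hr
  refine ⟨fun z => (planeCoord s z - r)⁻¹, h.fun_inv hne, ?_⟩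
  filter_upwards [h.continuousAt.eventually_ne hne] with z hz
  exact (mul_inv_cancel₀ hz).symm

/-- The line through `w` where coordinate `s` is constant. -/
def lineThrough (w : ℂ × ℂ) (v : ℂ) : ℂ × ℂ :=
  planeCoord s w • planeBasis s + v • planeBasis (1 - s)

theorem analyticAt_lineThrough (v : ℂ) : AnalyticAt ℂ (lineThrough s w) v := by
  unfold lineThrough
  exact analyticAt_const.fun_add (analyticAt_id.smul analyticAt_const)

theorem lineThrough_planeCoord : lineThrough s w (planeCoord (1 - s) w) = w := by
  unfold lineThrough
  rw [add_comm]
  exact (plane_decomposition s w).symm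

/-- The analytic counterpart of `restrictLine_eq_zero_iff`: a germ vanishing on a coordinate line is
divisible by the equation of the line, by `exists_eq_mul_of_vanish`. -/
theorem pull_eq_zero_iff (c : anGerm w) :
    pullGerm (lineThrough s w) (analyticAt_lineThrough s _) (lineThrough_planeCoord s) c = 0 ↔
      polyGerm w (MvPolynomial.X s - MvPolynomial.C (planeCoord s w)) ∣ c := by
  obtain ⟨f, rfl⟩ := toGerm_surjective w c
  have hfl : AnalyticAt ℂ (f.1 ∘ lineThrough s w) (planeCoord (1 - s) w) :=
    AnalyticAt.comp ((lineThrough_planeCoord s).symm ▸ f.2) (analyticAt_lineThrough s _)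
  have h := analyticAt_planeCoord_sub (w := w) s (planeCoord s w)
  rw [pullGerm_toGerm _ _ _ hfl, toGerm_eq_zero_iff, polyGerm_linear s _ h, toGerm_dvd_iff]
  constructor
  · intro hv
    have hπ : ‖(planeCoord (1 - s)).smulRight (planeBasis (1 - s))‖ ≤ 1 := by
      refine ContinuousLinearMap.opNorm_le_bound _ zero_le_one fun z => ?_
      rw [ContinuousLinearMap.smulRight_apply, norm_smul, one_mul]
      exact (mul_le_of_le_one_right (norm_nonneg _) (norm_planeBasis _)).trans
        (norm_planeCoord_le _ _)
    obtain ⟨g, hg, hfg⟩ := exists_eq_mul_of_vanish f.2 (planeCoord s)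
      (e := planeBasis s) (π := (planeCoord (1 - s)).smulRight (planeBasis (1 - s)))
      (fun z => plane_decomposition s z) (norm_planeBasis s) hπ (by
        have ht : Tendsto (fun z : ℂ × ℂ => planeCoord (1 - s) w + planeCoord (1 - s) z) (𝓝 0)
            (𝓝 (planeCoord (1 - s) w)) := by
          have := ((planeCoord (1 - s)).continuous.tendsto 0).const_add (planeCoord (1 - s) w)
          rwa [map_zero, add_zero] at this
        filter_upwards [ht.eventually hv] with z hz
        have e : lineThrough s w (planeCoord (1 - s) w + planeCoord (1 - s) z)
            = w + (planeCoord (1 - s)).smulRight (planeBasis (1 - s)) z := by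
          conv_rhs => rw [plane_decomposition s w]
          simp only [lineThrough, ContinuousLinearMap.smulRight_apply, add_smul]
          abel
        rw [← e]
        exact hz)
    refine ⟨g, hg, hfg.mono fun z hz => ?_⟩
    rw [hz, map_sub]
  · rintro ⟨g, -, hg⟩
    have ht := (analyticAt_lineThrough (w := w) s (planeCoord (1 - s) w)).continuousAt.tendsto
    rw [lineThrough_planeCoord] at ht
    filter_upwards [ht.eventually hg] with v hv
    change f.1 (lineThrough s w v) = 0
    rw [hv, lineThrough, (planeCoord_line s _ v).1, sub_self, zero_mul]

theorem pull_surjective : Function.Surjective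
    (pullGerm (lineThrough s w) (analyticAt_lineThrough s _) (lineThrough_planeCoord s)) := by
  intro c
  obtain ⟨f, rfl⟩ := toGerm_surjective _ c
  have h1 : AnalyticAt ℂ (fun z => f.1 (planeCoord (1 - s) z)) w :=
    AnalyticAt.fun_comp (g := f.1) (f := fun z => planeCoord (1 - s) z) f.2
      ((planeCoord (1 - s)).analyticAt w)
  have e : ∀ v, planeCoord (1 - s) (lineThrough s w v) = v := fun v => (planeCoord_line s _ v).2
  have h2 : (fun z => f.1 (planeCoord (1 - s) z)) ∘ lineThrough s w = f.1 := by
    funext v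
    simp only [Function.comp_apply, e]
  refine ⟨toGerm w ⟨_, h1⟩, ?_⟩
  rw [pullGerm_toGerm _ _ _ (by rw [h2]; exact f.2)]
  congr 2

theorem pull_polyGerm (a : MvPolynomial (Fin 2) ℂ) :
    pullGerm (lineThrough s w) (analyticAt_lineThrough s _) (lineThrough_planeCoord s)
      (polyGerm w a) = polyGerm₁ _ (restrictLine s (planeCoord s w) a) := by
  have h2 : (fun z : ℂ × ℂ => AffineData.ev z.1 z.2 a) ∘ lineThrough s w
      = fun v => (restrictLine s (planeCoord s w) a).eval v := by
    funext v
    rw [eval_restrictLine]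
    rfl
  rw [polyGerm_apply, polyGerm₁_apply, pullGerm_toGerm _ _ _ (by
    rw [h2]
    exact Polynomial.differentiable _ |>.analyticAt _)]
  congr 2

theorem polyGerm_linear_mul_eq_zero {r : ℂ} {c : anGerm w}
    (h : polyGerm w (MvPolynomial.X s - MvPolynomial.C r) * c = 0) : c = 0 := by
  obtain ⟨f, rfl⟩ := toGerm_surjective w c
  rw [polyGerm_linear s r (analyticAt_planeCoord_sub s r), ← map_mul, toGerm_eq_zero_iff] at h
  rw [toGerm_eq_zero_iff]
  refine eventually_eq_zero_of_dense f.2 (dense_planeCoord_ne s r) (h.mono fun z hz hzr => ?_)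
  exact (mul_eq_zero.1 hz).resolve_left (sub_ne_zero.2 hzr)

/-- If the line `X s = r` does not pass through `w`, its equation is a unit. If it does, reduction
modulo the equation is restriction to the line, and `mem_map_of_C_mul_mem` applies because germs in
one variable are flat over polynomials in one variable. -/
theorem mem_map_of_linear_mul_mem {σ : Type*} {J : Ideal (MvPolynomial σ (MvPolynomial (Fin 2) ℂ))}
    {r : ℂ}
    (hJ : ∀ T, MvPolynomial.C (MvPolynomial.X s - MvPolynomial.C r) * T ∈ J → T ∈ J)
    {G : MvPolynomial σ (anGerm w)}
    (hG : MvPolynomial.C (polyGerm w (MvPolynomial.X s - MvPolynomial.C r)) * G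
      ∈ J.map (MvPolynomial.map (polyGerm w))) :
    G ∈ J.map (MvPolynomial.map (polyGerm w)) := by
  by_cases hr : planeCoord s w = r
  · subst hr
    let := (polyGerm₁ (planeCoord (1 - s) w)).toAlgebra
    have := flat_anGerm (planeCoord (1 - s) w)
    exact mem_map_of_C_mul_mem (πA := (restrictLine s (planeCoord s w)).toRingHom)
      (pull_polyGerm s) (restrictLine_surjective s _) (pull_surjective s)
      (restrictLine_eq_zero_iff s _) (pull_eq_zero_iff s)
      (fun c hc => polyGerm_linear_mul_eq_zero s hc) hJ hG
  · exact (Ideal.unit_mul_mem_iff_mem _ ((isUnit_polyGerm_linear s hr).map MvPolynomial.C)).1 hG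

end DesaturationGerm

/-! ### Jet expressions as polynomials over analytic functions -/

section AnEval

variable {i j : Chart} {k : ℕ}

/-- The coordinates of a point of `P1 × P1`. -/
def coords (i j : Chart) (q : P1 × P1) : ℂ × ℂ := (i.coord q.1, j.coord q.2)

/-- The value at the jet of `f` at `a` of a polynomial in the jet coordinates, with analytic
functions as coefficients. -/
def anEval (i j : Chart) {k : ℕ} {w : ℂ × ℂ} (f : P1 → P1) (a : P1) :
    MvPolynomial (Fin (k + 2)) (anFun w) →+* ℂ :=
  MvPolynomial.eval₂Hom ((Pi.evalRingHom (fun _ : ℂ × ℂ => ℂ) (i.coord a, j.coord (f a))).comp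
    (anFun w).subtype) fun n => jetCoord i j f a n

theorem hasJetExpr_anEval {p : P1 × P1} (Q : MvPolynomial (Fin (k + 2)) (anFun (coords i j p))) :
    HasJetExpr (k + 1) i j p fun f a => anEval i j f a Q := by
  induction Q using MvPolynomial.induction_on with
  | C c => simpa [anEval] using HasJetExpr.coeff c.2
  | add P Q hP hQ => exact hP.add hQ fun f a => by rw [map_add]
  | mul_X P n hP =>
    refine hP.mul (HasJetExpr.jet (n := n) (by omega) (by omega)) fun f a => ?_
    rw [map_mul]
    simp [anEval]

/-- In positive order `k + 1` the variables are those of indices `0, …, k + 1`. Restricting to this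
finite set gives a polynomial ring which is Noetherian over polynomial coefficients. -/
theorem HasJetExpr.exists_anEval {p : P1 × P1} {E : (P1 → P1) → P1 → ℂ}
    (h : HasJetExpr (k + 1) i j p E) :
    ∃ Q : MvPolynomial (Fin (k + 2)) (anFun (coords i j p)),
      EqNear p E fun f a => anEval i j f a Q := by
  obtain ⟨Q, h1, h2, h3⟩ := h
  obtain ⟨Q, rfl⟩ := MvPolynomial.exists_rename_eq_of_vars_subset_range Q
    (fun n : Fin (k + 2) => (n : ℕ)) Fin.val_injective
    (fun n hn => ⟨⟨n, by have := (h1 n hn).1; omega⟩, rfl⟩)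
  obtain ⟨Q, rfl⟩ := MvPolynomial.mem_range_map_iff_coeffs_subset
    (f := (anFun (coords i j p)).subtype) (x := Q) |>.2 (by
      intro c hc
      obtain ⟨m, -, rfl⟩ := MvPolynomial.mem_coeffs_iff.1 hc
      have := h2 (m.mapDomain fun n : Fin (k + 2) => (n : ℕ))
      rw [MvPolynomial.coeff_rename_mapDomain _ Fin.val_injective] at this
      exact ⟨⟨_, this⟩, rfl⟩)
  refine ⟨Q, h3.mono fun q hq f a hfa hf => ?_⟩
  rw [hq f a hfa hf, MvPolynomial.eval₂_rename, MvPolynomial.eval₂_map]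
  rfl

theorem HasJetExpr.exists_coeff {p : P1 × P1} {E : (P1 → P1) → P1 → ℂ}
    (h : HasJetExpr 0 i j p E) :
    ∃ c : ℂ × ℂ → ℂ, AnalyticAt ℂ c (coords i j p) ∧
      EqNear p E fun f a => c (i.coord a, j.coord (f a)) := by
  obtain ⟨Q, h1, h2, h3⟩ := h
  have hv : Q.vars = ∅ := by
    refine Finset.eq_empty_of_forall_notMem fun n hn => ?_
    have := (h1 n hn).2
    omega
  refine ⟨Q.coeff 0, h2 0, h3.mono fun q hq f a hfa hf => ?_⟩
  rw [hq f a hfa hf, MvPolynomial.vars_eq_empty_iff_eq_C.1 hv, MvPolynomial.eval₂_C,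
    MvPolynomial.coeff_C, if_pos rfl]
  rfl

/-- Polynomials with the same germs as coefficients take the same values. -/
theorem eventually_eval₂_eq {σ : Type*} {w : ℂ × ℂ} {P Q : MvPolynomial σ (anFun w)}
    (h : MvPolynomial.map (toGerm w) P = MvPolynomial.map (toGerm w) Q) :
    ∀ᶠ z in 𝓝 w, ∀ y : σ → ℂ,
      P.eval₂ ((Pi.evalRingHom (fun _ : ℂ × ℂ => ℂ) z).comp (anFun w).subtype) y
        = Q.eval₂ ((Pi.evalRingHom (fun _ : ℂ × ℂ => ℂ) z).comp (anFun w).subtype) y := by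
  have h0 : MvPolynomial.map (toGerm w) (P - Q) = 0 := by rw [map_sub, h, sub_self]
  have hc : ∀ᶠ z in 𝓝 w, ∀ m ∈ (P - Q).support, ((P - Q).coeff m).1 z = 0 := by
    rw [Filter.eventually_all_finset]
    intro m _
    rw [← toGerm_eq_zero_iff, ← MvPolynomial.coeff_map, h0, MvPolynomial.coeff_zero]
  filter_upwards [hc] with z hz y
  rw [← sub_eq_zero, ← MvPolynomial.eval₂_sub, MvPolynomial.eval₂_eq]
  refine Finset.sum_eq_zero fun m hm => ?_
  change ((P - Q).coeff m).1 z * _ = 0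
  rw [hz m hm, zero_mul]

end AnEval

/-! ### Equations of the solutions with polynomial and with analytic coefficients -/

namespace AffineData

variable (D : AffineData)

theorem finite_not_reg_par (i : Chart) : {z : ℂ | ¬ D.Reg (i.par z)}.Finite := by
  refine Set.Finite.preimage (f := i.par) ?_ D.finite_not_reg
  intro z _ z' _ h
  rw [← i.coord_par z, h, i.coord_par]

theorem dense_reg (i j : Chart) :
    Dense {z : ℂ × ℂ | D.Reg (i.par z.1) ∧ D.Reg (j.par z.2)} := by
  have h : ∀ i : Chart, Dense {z : ℂ | D.Reg (i.par z)} := fun i => by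
    have := (D.finite_not_reg_par i).countable.dense_compl ℂ
    refine this.mono fun z hz => ?_
    simpa using hz
  exact (h i).prod (h j)

variable {D}

/-- Through every regular point there are solutions with every nonzero derivative, so a
polynomial in `y_1` vanishing at the jets of all solutions is zero. -/
theorem eventually_coeff_eq_zero {i j : Chart} {w : ℂ × ℂ} {n : ℕ} {c : ℕ → ℂ × ℂ → ℂ}
    (hc : ∀ l, AnalyticAt ℂ (c l) w)
    (h : ∀ᶠ z in 𝓝 w, ∀ f a, D.Sol f a → (i.coord a, j.coord (f a)) = z →
      ∑ l ∈ Finset.range n, c l z * deriv (inCharts i j f) (i.coord a) ^ l = 0)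
    {l : ℕ} (hl : l < n) : ∀ᶠ z in 𝓝 w, c l z = 0 := by
  refine eventually_eq_zero_of_dense (hc l) (D.dense_reg i j) (h.mono fun z hz hr => ?_)
  set P : Polynomial ℂ := ∑ l ∈ Finset.range n, Polynomial.C (c l z) * Polynomial.X ^ l with hP
  -- Over a fixed pair of regular points every nonzero `y` is the derivative of a solution, so the
  -- polynomial has infinitely many roots. Regular pairs being dense, its coefficients vanish near
  -- `w`.
  have hroot : ∀ y : ℂ, y ≠ 0 → P.IsRoot y := by
    intro y hy
    obtain ⟨f, hf, hfa, hd⟩ := D.exists_sol i j hr.1 hr.2 hy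
    have := hz f _ hf (by rw [hfa, i.coord_par, j.coord_par])
    rw [Polynomial.IsRoot, hP, Polynomial.eval_finsetSum, ← this]
    exact Finset.sum_congr rfl fun l _ => by rw [hd]; simp
  have hP0 : P = 0 := by
    by_contra hne
    refine (Set.Infinite.mono (s := {0}ᶜ) ?_ ?_) (Polynomial.finite_setOfPred_isRoot hne)
    · exact fun y hy => hroot y hy
    · exact (Set.finite_singleton (0 : ℂ)).infinite_compl
  have := congrArg (Polynomial.coeff · l) hP0
  simp only [hP, Polynomial.finsetSum_coeff, Polynomial.coeff_C_mul, Polynomial.coeff_X_pow,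
    Polynomial.coeff_zero] at this
  simpa [Finset.sum_ite_eq, hl] using this

variable (D)

/-- The value at the jet of `f` at `a` of a polynomial in all jet coordinates. -/
def jetEval (i j : Chart) {k : ℕ} (f : P1 → P1) (a : P1) :
    MvPolynomial (Fin (k + 2)) (MvPolynomial (Fin 2) ℂ) →+* ℂ :=
  MvPolynomial.eval₂Hom (ev (i.coord a) (j.coord (f a))) fun n => jetCoord i j f a n

/-- The polynomials in the jet coordinates vanishing at the jets of the solutions. -/
def solIdeal (i j : Chart) (k : ℕ) :
    Ideal (MvPolynomial (Fin (k + 2)) (MvPolynomial (Fin 2) ℂ)) :=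
  ⨅ γ : {γ : (P1 → P1) × P1 // D.Sol γ.1 γ.2}, RingHom.ker (jetEval i j γ.1.1 γ.1.2)

variable {D}

theorem mem_solIdeal {i j : Chart} {k : ℕ}
    {T : MvPolynomial (Fin (k + 2)) (MvPolynomial (Fin 2) ℂ)} :
    T ∈ D.solIdeal i j k ↔ ∀ f a, D.Sol f a → jetEval i j f a T = 0 := by
  rw [solIdeal, Ideal.mem_iInf]
  exact ⟨fun h f a hf => h ⟨(f, a), hf⟩, fun h γ => h _ _ γ.2⟩

/-- The polynomials in the jet coordinates, with analytic coefficients, which vanish at the jets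
of solutions near `w`. -/
def anSolIdeal (D : AffineData) (i j : Chart) (k : ℕ) (w : ℂ × ℂ) :
    Ideal (MvPolynomial (Fin (k + 2)) (anFun w)) where
  carrier := {Q | ∀ᶠ z in 𝓝 w, ∀ f a, D.Sol f a → (i.coord a, j.coord (f a)) = z →
    anEval i j f a Q = 0}
  add_mem' := fun hP hQ => by
    filter_upwards [hP, hQ] with z h1 h2 f a hf hz
    rw [map_add, h1 f a hf hz, h2 f a hf hz, add_zero]
  zero_mem' := Eventually.of_forall fun z f a _ _ => map_zero _
  smul_mem' := fun P Q hQ => by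
    filter_upwards [hQ] with z h f a hf hz
    rw [smul_eq_mul, map_mul, h f a hf hz, mul_zero]

/-- Vanishing near `w` on solutions depends only on the germs at `w` of the coefficients, so nothing
is lost when functions are replaced by germs. -/
theorem map_toGerm_mem_iff {i j : Chart} {k : ℕ} {w : ℂ × ℂ}
    {Q : MvPolynomial (Fin (k + 2)) (anFun w)} :
    MvPolynomial.map (toGerm w) Q ∈ (D.anSolIdeal i j k w).map (MvPolynomial.map (toGerm w)) ↔
      Q ∈ D.anSolIdeal i j k w := by
  refine ⟨fun h => ?_, fun h => Ideal.mem_map_of_mem _ h⟩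
  obtain ⟨P, hP, hPQ⟩ := (Ideal.mem_map_iff_of_surjective _
    (MvPolynomial.map_surjective _ (toGerm_surjective w))).1 h
  have hP' : ∀ᶠ z in 𝓝 w, ∀ f a, D.Sol f a → (i.coord a, j.coord (f a)) = z →
    anEval i j f a P = 0 := hP
  filter_upwards [hP', eventually_eval₂_eq hPQ] with z h1 h2 f a hf hz
  rw [← h1 f a hf hz]
  subst hz
  exact (h2 _).symm

/-- Polynomials as analytic functions. -/
def polyFun (w : ℂ × ℂ) : MvPolynomial (Fin 2) ℂ →+* anFun w :=
  (RingHom.pi fun z : ℂ × ℂ => ev z.1 z.2).codRestrict (anFun w) fun p => analyticAt_ev p w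

theorem anEval_map_polyFun {i j : Chart} {k : ℕ} {w : ℂ × ℂ} (f : P1 → P1) (a : P1)
    (T : MvPolynomial (Fin (k + 2)) (MvPolynomial (Fin 2) ℂ)) :
    anEval i j f a (MvPolynomial.map (polyFun w) T) = jetEval i j f a T := by
  rw [anEval, MvPolynomial.coe_eval₂Hom, MvPolynomial.eval₂_map]
  rfl

theorem map_polyGerm {σ : Type*} (w : ℂ × ℂ) (T : MvPolynomial σ (MvPolynomial (Fin 2) ℂ)) :
    MvPolynomial.map (polyGerm w) T
      = MvPolynomial.map (toGerm w) (MvPolynomial.map (polyFun w) T) := by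
  rw [MvPolynomial.map_map]
  rfl

theorem map_solIdeal_le (i j : Chart) (k : ℕ) (w : ℂ × ℂ) :
    (D.solIdeal i j k).map (MvPolynomial.map (polyGerm w)) ≤
      (D.anSolIdeal i j k w).map (MvPolynomial.map (toGerm w)) := by
  refine Ideal.map_le_iff_le_comap.2 fun T hT => ?_
  rw [Ideal.mem_comap, map_polyGerm, map_toGerm_mem_iff]
  refine Eventually.of_forall fun z f a hf _ => ?_
  rw [anEval_map_polyFun]
  exact mem_solIdeal.1 hT f a hf

end AffineData

/-! ### Coherence of the ideal of an affine structure -/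

namespace AffineData

variable {D : AffineData} {i j : Chart} {k : ℕ}

open MvPolynomial (C X) in
theorem X_zero_mul_X_one_mem : (X 0 * X 1 - 1 : MvPolynomial (Fin (k + 2)) _) ∈ D.solIdeal i j k := by
  refine mem_solIdeal.2 fun f a hf => ?_
  have hd := hf.2.2.1.deriv_ne_zero (hf.1.mem_dom i) (hf.2.1.mem_dom j)
  simp [jetEval, jetCoord, inv_mul_cancel₀ hd]

open MvPolynomial (C X) in
theorem exists_reduction_mem (n : Fin (k + 1)) : ∃ (N : ℕ) (Ψ : Polynomial (MvPolynomial (Fin 2) ℂ)),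
    (C (D.denom₂ i j) ^ N * X n.succ - Ψ.eval₂ C (X 1) :
      MvPolynomial (Fin (k + 2)) (MvPolynomial (Fin 2) ℂ)) ∈ D.solIdeal i j k := by
  obtain ⟨N, Ψ, h⟩ := D.exists_jet_reduction i j n
  refine ⟨N, Ψ, mem_solIdeal.2 fun f a hf => ?_⟩
  have h1 : jetEval (k := k) i j f a (Ψ.eval₂ C (X 1)) = ev₁ i j Ψ f a := by
    rw [Polynomial.hom_eval₂, ev₁]
    congr 1
    · ext <;> simp [jetEval]
    · simp [jetEval, jetCoord]
  rw [map_sub, h1, ← h f a hf, map_mul, map_pow]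
  simp [jetEval, jetCoord]

open MvPolynomial (C X) in
theorem solIdeal_saturated {h : MvPolynomial (Fin 2) ℂ}
    (hne : ∀ f a, D.Sol f a → ev (i.coord a) (j.coord (f a)) h ≠ 0)
    (T : MvPolynomial (Fin (k + 2)) (MvPolynomial (Fin 2) ℂ)) (hT : C h * T ∈ D.solIdeal i j k) :
    T ∈ D.solIdeal i j k := by
  refine mem_solIdeal.2 fun f a hf => ?_
  have h1 := mem_solIdeal.1 hT f a hf
  rw [map_mul] at h1
  refine (mul_eq_zero.1 h1).resolve_left ?_
  simpa [jetEval] using hne f a hf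

open MvPolynomial (C X) in
-- The polynomials which can be cancelled form a submonoid, so it suffices to cancel the linear
-- factors of the two denominators. Such a factor does not vanish at the endpoints of a solution,
-- because they are regular; hence `solIdeal` is saturated with respect to it, and
-- `mem_map_of_linear_mul_mem` passes this to germs.
theorem mem_of_denom_mul_mem {w : ℂ × ℂ} {G : MvPolynomial (Fin (k + 2)) (anGerm w)}
    (hG : C (polyGerm w (D.denom₂ i j)) * G
      ∈ (D.solIdeal i j k).map (MvPolynomial.map (polyGerm w))) :
    G ∈ (D.solIdeal i j k).map (MvPolynomial.map (polyGerm w)) := by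
  set I := (D.solIdeal i j k).map (MvPolynomial.map (polyGerm w)) with hI
  let S : Submonoid (MvPolynomial (Fin 2) ℂ) :=
    { carrier := {a | ∀ G, C (polyGerm w a) * G ∈ I → G ∈ I}
      one_mem' := fun G hG => by simpa using hG
      mul_mem' := fun {a b} ha hb G hG => hb G (ha _ (by
        rwa [← mul_assoc, ← map_mul, ← map_mul])) }
  have hconst : ∀ r : ℂ, r ≠ 0 → C r ∈ S := by
    intro r hr G hG
    have := I.mul_mem_left (C (polyGerm w (C r⁻¹))) hG
    rwa [← mul_assoc, ← map_mul, ← map_mul, ← map_mul, inv_mul_cancel₀ hr, map_one, map_one,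
      map_one, one_mul] at this
  have h0 : Polynomial.aeval (X 0) (D.cden i) ∈ S := by
    refine aeval_mem_of_linear_mem S _ (D.cden_ne_zero i) hconst fun r hr G hG => ?_
    refine mem_map_of_linear_mul_mem 0 (solIdeal_saturated fun f a hf h => ?_) hG
    rw [map_sub, sub_eq_zero] at h
    refine hf.1.cden_ne_zero i ?_
    have : i.coord a = r := by simpa [ev] using h
    rw [this]
    exact hr
  have h1 : Polynomial.aeval (X 1) (D.cden j) ∈ S := by
    refine aeval_mem_of_linear_mem S _ (D.cden_ne_zero j) hconst fun r hr G hG => ?_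
    refine mem_map_of_linear_mul_mem 1 (solIdeal_saturated fun f a hf h => ?_) hG
    rw [map_sub, sub_eq_zero] at h
    refine hf.2.1.cden_ne_zero j ?_
    have : j.coord (f a) = r := by simpa [ev] using h
    rw [this]
    exact hr
  exact S.mul_mem h0 h1 G hG

open MvPolynomial (C X) in
-- There is no equation in `x`, `y`, `y₁` alone, since the jets of order one of solutions fill an
-- open dense set; this is `eventually_coeff_eq_zero`.
theorem eq_zero_of_eval₂_mem {w : ℂ × ℂ} {P : Polynomial (anGerm w)}
    (hP : P.eval₂ C (X 1 : MvPolynomial (Fin (k + 2)) (anGerm w)) ∈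
      (D.anSolIdeal i j k w).map (MvPolynomial.map (toGerm w))) : P = 0 := by
  choose c hc using fun l => toGerm_surjective w (P.coeff l)
  set Q : MvPolynomial (Fin (k + 2)) (anFun w) :=
    ∑ l ∈ Finset.range (P.natDegree + 1), C (c l) * X 1 ^ l with hQ
  have hQP : MvPolynomial.map (toGerm w) Q = P.eval₂ C (X 1) := by
    rw [Polynomial.eval₂_eq_sum_range, hQ, map_sum]
    exact Finset.sum_congr rfl fun l _ => by
      rw [map_mul, map_pow, MvPolynomial.map_C, MvPolynomial.map_X, hc]
  rw [← hQP, map_toGerm_mem_iff] at hP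
  have hP' : ∀ᶠ z in 𝓝 w, ∀ f a, D.Sol f a → (i.coord a, j.coord (f a)) = z →
    anEval i j f a Q = 0 := hP
  have key := fun l hl => eventually_coeff_eq_zero (D := D) (i := i) (j := j) (w := w)
    (n := P.natDegree + 1) (c := fun l => (c l).1) (fun l => (c l).2) (hP'.mono fun z hz f a hf h => by
      rw [← hz f a hf h, hQ, map_sum]
      subst h
      refine Finset.sum_congr rfl fun l _ => ?_
      rw [map_mul, map_pow]
      simp [anEval, jetCoord]) (l := l) hl
  ext l
  rw [Polynomial.coeff_zero]
  by_cases hl : l < P.natDegree + 1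
  · rw [← hc, toGerm_eq_zero_iff.2 (key l hl)]
  · rw [Polynomial.coeff_eq_zero_of_natDegree_lt (by omega)]

open MvPolynomial (C X) in
/-- The equations with analytic coefficients vanishing on the solutions are generated by those
with polynomial coefficients. -/
theorem anSolIdeal_map_le (w : ℂ × ℂ) :
    (D.anSolIdeal i j k w).map (MvPolynomial.map (toGerm w)) ≤
      (D.solIdeal i j k).map (MvPolynomial.map (polyGerm w)) := by
  intro G hG
  set I := (D.solIdeal i j k).map (MvPolynomial.map (polyGerm w)) with hI
  set φ := Ideal.Quotient.mk I with hφ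
  set h := φ (C (polyGerm w (D.denom₂ i j))) with hh
  set y := φ (X 1) with hy
  -- The image in the quotient of the polynomials in `y₁` alone. After multiplication by powers of
  -- the denominator `h` and of `y₁`, every class falls into it, by the reduction of higher jets.
  set S : Subring _ := (Polynomial.eval₂RingHom (φ.comp C) y).range with hS
  have hCS : ∀ c, φ (C c) ∈ S := fun c => ⟨Polynomial.C c, by simp⟩
  have hyS : y ∈ S := ⟨Polynomial.X, by simp⟩
  have hzero : ∀ T ∈ D.solIdeal i j k, φ (MvPolynomial.map (polyGerm w) T) = 0 := fun T hT =>
    Ideal.Quotient.eq_zero_iff_mem.2 (Ideal.mem_map_of_mem _ hT)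
  have hy0 : y * φ (X 0) = 1 := by
    have := hzero _ (X_zero_mul_X_one_mem (D := D) (i := i) (j := j) (k := k))
    rw [map_sub, map_sub, sub_eq_zero] at this
    rw [hy, ← map_mul, mul_comm (X 1), map_mul]
    simpa using this
  obtain ⟨M, N, P, hP⟩ := exists_pow_mul_mem S φ (h := h) (y := y) (hCS _) hyS hCS (fun s => by
    refine Fin.cases ?_ (fun n => ?_) s
    · refine ⟨0, 1, ?_⟩
      rw [pow_zero, one_mul, pow_one, hy0]
      exact S.one_mem
    · obtain ⟨N, Ψ, hΨ⟩ := exists_reduction_mem (D := D) (i := i) (j := j) n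
      refine ⟨N, 0, ?_⟩
      have := hzero _ hΨ
      rw [map_sub, map_sub, sub_eq_zero, map_mul, map_pow, MvPolynomial.map_C, MvPolynomial.map_X,
        map_mul, map_pow, Polynomial.hom_eval₂, Polynomial.hom_eval₂, MvPolynomial.map_X] at this
      rw [pow_zero, mul_one, this, Polynomial.eval₂_eq_sum_range]
      refine S.sum_mem fun l _ => S.mul_mem ?_ (S.pow_mem hyS l)
      simp only [RingHom.comp_apply, MvPolynomial.map_C]
      exact hCS _) G
  have hPφ : φ (P.eval₂ C (X 1)) = h ^ M * y ^ N * φ G := by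
    rw [← hP, Polynomial.hom_eval₂]
    rfl
  -- Modulo the polynomial equations, `P(y₁)` is a multiple of `G`, so it vanishes on the solutions;
  -- being an expression in `y₁` only, it is zero.
  have hP0 : P = 0 := by
    refine eq_zero_of_eval₂_mem (D := D) (i := i) (j := j) (k := k) ?_
    have h1 : P.eval₂ C (X 1) - C (polyGerm w (D.denom₂ i j)) ^ M * X 1 ^ N * G ∈ I := by
      rw [← Ideal.Quotient.eq_zero_iff_mem, map_sub, sub_eq_zero]
      simpa using hPφ
    have h2 := Ideal.add_mem _ (map_solIdeal_le i j k w h1)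
      (Ideal.mul_mem_left _ (C (polyGerm w (D.denom₂ i j)) ^ M * X 1 ^ N) hG)
    rwa [sub_add_cancel] at h2
  rw [hP0, Polynomial.eval₂_zero, map_zero] at hPφ
  -- The power of `y₁` is cancelled by means of the variable `1 / y₁`.
  have hM : h ^ M * φ G = 0 := by
    have : h ^ M * φ G = (h ^ M * y ^ N * φ G) * φ (X 0) ^ N := by
      calc h ^ M * φ G = h ^ M * φ G * (y * φ (X 0)) ^ N := by rw [hy0, one_pow, mul_one]
        _ = _ := by ring
    rw [this, ← hPφ, zero_mul]
  have hMI : C (polyGerm w (D.denom₂ i j)) ^ M * G ∈ I := by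
    rw [← Ideal.Quotient.eq_zero_iff_mem, map_mul, map_pow]
    exact hM
  clear hM hPφ hP
  -- The factors `h` are cancelled one by one, which is where flatness enters.
  induction M with
  | zero => simpa using hMI
  | succ M ih =>
    refine ih (mem_of_denom_mul_mem (hI ▸ ?_))
    rwa [← mul_assoc, ← pow_succ']

theorem mem_anSolIdeal_of_eqNear {q : P1 × P1} (hi : q.1 ∈ i.dom) (hj : q.2 ∈ j.dom)
    {V : Opens (P1 × P1)} (hq : q ∈ V) {E : DiffEq V} (hE : E ∈ D.idealSheaf.sections V)
    {F : (P1 → P1) → P1 → ℂ} (hEF : EqNear q (valueAt E.1) F) :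
    ∀ᶠ z in 𝓝 (coords i j q), ∀ f a, D.Sol f a → (i.coord a, j.coord (f a)) = z → F f a = 0 := by
  have ht : Tendsto (fun z : ℂ × ℂ => (i.par z.1, j.par z.2)) (𝓝 (coords i j q)) (𝓝 q) := by
    have h1 := i.continuous_par.tendsto (i.coord q.1)
    have h2 := j.continuous_par.tendsto (j.coord q.2)
    rw [i.par_coord hi] at h1
    rw [j.par_coord hj] at h2
    exact (h1.comp (continuous_fst.tendsto _)).prodMk_nhds
      (h2.comp (continuous_snd.tendsto _))
  filter_upwards [ht.eventually hEF, ht.eventually (V.isOpen.mem_nhds hq)] with z h1 h2 f a hf hz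
  subst hz
  rw [i.par_coord (hf.1.mem_dom i), j.par_coord (hf.2.1.mem_dom j)] at h1 h2
  rw [← h1 f a rfl hf.2.2.1]
  exact D.mem_idealSheaf.1 hE f a hf h2

/-- The product of the domains of two charts. -/
def domOpens (i j : Chart) : Opens (P1 × P1) := ⟨i.dom ×ˢ j.dom, i.isOpen_dom.prod j.isOpen_dom⟩

theorem exists_opens_of_eventually {q : P1 × P1} {P : P1 × P1 → Prop} (h : ∀ᶠ r in 𝓝 q, P r)
    {V : Opens (P1 × P1)} (hq : q ∈ V) : ∃ U : Opens (P1 × P1), U ≤ V ∧ q ∈ U ∧ ∀ r ∈ U, P r := by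
  obtain ⟨U, hU, hUo, hqU⟩ := eventually_nhds_iff.1 (h.and (V.isOpen.mem_nhds hq))
  exact ⟨⟨U, hUo⟩, fun r hr => (hU r hr).2, hqU, fun r hr => (hU r hr).1⟩

variable (D) in
-- There are no nonzero equations of order zero: any two regular points are joined by a solution, so
-- a function of `(x, y)` vanishing on solutions is zero on a dense set. The empty family generates.
theorem isCoherentAtOrder_zero : D.idealSheaf.IsCoherentAtOrder 0 := by
  intro p
  refine ⟨⊤, trivial, 0, Fin.elim0, fun m => m.elim0, fun V hV E hE q hq => ?_⟩
  obtain ⟨i, hi⟩ := Chart.exists_mem q.1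
  obtain ⟨j, hj⟩ := Chart.exists_mem q.2
  obtain ⟨c, hc, hEc⟩ := (hE.2 q hq i j hi hj).exists_coeff
  have hc0 := eventually_coeff_eq_zero (D := D) (i := i) (j := j) (n := 1) (c := fun _ => c)
    (fun _ => hc) ((mem_anSolIdeal_of_eqNear hi hj hq hE.1 hEc).mono fun z hz f a hf h => by
      subst h
      simpa using hz f a hf rfl) zero_lt_one
  have hz : ∀ᶠ r in 𝓝 q, ∀ f a, (a, f a) = r → IsLocalBihol f a → valueAt E.1 f a = 0 := by
    filter_upwards [hEc, (tendsto_coords hi hj).eventually hc0] with r h1 h2 f a hfa hf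
    rw [h1 f a hfa hf]
    subst hfa
    exact h2
  obtain ⟨U, hUV, hqU, hU⟩ := exists_opens_of_eventually hz hq
  refine ⟨U, hUV, Fin.elim0, hqU, fun m => m.elim0, ?_⟩
  rw [Fin.sum_univ_zero]
  refine Subtype.ext (funext fun γ => ?_)
  have := hU _ γ.2.2 γ.1.1 γ.1.2 rfl γ.2.1
  rwa [valueAt_of γ.2.1 (hUV γ.2.2)] at this

variable (D) in
-- By Hilbert's basis theorem `solIdeal` has finitely many generators, and by `anSolIdeal_map_le`
-- the same polynomials generate the equations near every point of the product of the two charts,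
-- including those over the poles of `μ`.
theorem isCoherentAtOrder_succ (k : ℕ) : D.idealSheaf.IsCoherentAtOrder (k + 1) := by
  intro p
  obtain ⟨i, hi⟩ := Chart.exists_mem p.1
  obtain ⟨j, hj⟩ := Chart.exists_mem p.2
  obtain ⟨n, T, hT⟩ := Submodule.fg_iff_exists_fin_generating_family.1
    (IsNoetherian.noetherian (D.solIdeal i j k))
  have hTmem : ∀ m, T m ∈ D.solIdeal i j k := fun m => hT ▸ Submodule.subset_span ⟨m, rfl⟩
  have hg : ∀ m, IsOfOrder (k + 1) (ofGermFun (domOpens i j) fun f a => jetEval i j f a (T m)) := by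
    intro m
    refine isOfOrder_ofGermFun fun q hq => ⟨i, j, hq.1, hq.2, ?_⟩
    simp only [← anEval_map_polyFun (w := coords i j q)]
    exact hasJetExpr_anEval _
  refine ⟨domOpens i j, ⟨hi, hj⟩, n, fun m => ⟨_, (hg m).isDiffEq⟩, fun m => ⟨?_, hg m⟩, ?_⟩
  · refine D.mem_idealSheaf.2 fun f a hf ha => ?_
    rw [valueAt_ofGermFun hf.2.2.1 ha]
    exact mem_solIdeal.1 (hTmem m) f a hf
  intro V hV E hE q hq
  have hqi : q.1 ∈ i.dom := (hV hq).1
  have hqj : q.2 ∈ j.dom := (hV hq).2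
  obtain ⟨Q, hQ⟩ := (hE.2 q hq i j hqi hqj).exists_anEval
  have hQmem : MvPolynomial.map (toGerm (coords i j q)) Q ∈
      (D.solIdeal i j k).map (MvPolynomial.map (polyGerm (coords i j q))) :=
    anSolIdeal_map_le _ (Ideal.mem_map_of_mem _ (mem_anSolIdeal_of_eqNear hqi hqj hq hE.1 hQ))
  have hspan : (D.solIdeal i j k).map (MvPolynomial.map (polyGerm (coords i j q))) =
      Ideal.span (Set.range fun m => MvPolynomial.map (polyGerm (coords i j q)) (T m)) := by
    conv_lhs => rw [← hT]
    change Ideal.map _ (Ideal.span _) = _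
    rw [Ideal.map_span, ← Set.range_comp]
    rfl
  rw [hspan] at hQmem
  obtain ⟨c, hc⟩ := Ideal.mem_span_range_iff_exists_fun.1 hQmem
  choose c' hc' using fun m => MvPolynomial.map_surjective _ (toGerm_surjective _) (c m)
  have hsum : MvPolynomial.map (toGerm (coords i j q)) Q = MvPolynomial.map (toGerm _)
      (∑ m, c' m * MvPolynomial.map (polyFun (coords i j q)) (T m)) := by
    rw [← hc, map_sum]
    exact Finset.sum_congr rfl fun m _ => by rw [map_mul, hc', map_polyGerm]
  have hexpr : ∀ᶠ r in 𝓝 q, ∀ m, HasJetExpr (k + 1) i j r fun f a => anEval i j f a (c' m) :=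
    eventually_all.2 fun m => (hasJetExpr_anEval (c' m)).eventually hqi hqj
  have hval : ∀ᶠ r in 𝓝 q, ∀ f a, (a, f a) = r → IsLocalBihol f a →
      valueAt E.1 f a = ∑ m, anEval i j f a (c' m) * jetEval i j f a (T m) := by
    filter_upwards [hQ, (tendsto_coords hqi hqj).eventually (eventually_eval₂_eq hsum)]
      with r h1 h2 f a hfa hf
    rw [h1 f a hfa hf]
    subst hfa
    have h3 : anEval i j f a Q = anEval i j f a
        (∑ m, c' m * MvPolynomial.map (polyFun (coords i j q)) (T m)) := h2 _
    rw [h3, map_sum]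
    exact Finset.sum_congr rfl fun m _ => by rw [map_mul, anEval_map_polyFun]
  obtain ⟨U, hUV, hqU, hU⟩ := exists_opens_of_eventually (hexpr.and hval) hq
  have hcU : ∀ m, IsOfOrder (k + 1) (ofGermFun U fun f a => anEval i j f a (c' m)) := fun m =>
    isOfOrder_ofGermFun fun r hr => ⟨i, j, (hV (hUV hr)).1, (hV (hUV hr)).2, (hU r hr).1 m⟩
  refine ⟨U, hUV, fun m => ⟨_, (hcU m).isDiffEq⟩, hqU, hcU, ?_⟩
  refine Subtype.ext (funext fun γ => ?_)
  have h1 := (hU _ γ.2.2).2 γ.1.1 γ.1.2 rfl γ.2.1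
  rw [valueAt_of γ.2.1 (hUV γ.2.2)] at h1
  rw [← Subring.coe_subtype, map_sum, Finset.sum_apply]
  exact h1

variable (D) in
theorem isDGroupoid_idealSheaf : IsDGroupoid D.idealSheaf where
  coherent k := by
    cases k with
    | zero => exact D.isCoherentAtOrder_zero
    | succ k => exact D.isCoherentAtOrder_succ k
  differential := D.idealSheaf_isDifferential
  groupoid := ⟨0, {a | ¬ D.Reg a}, D.finite_not_reg, fun l _ =>
    ⟨D.idealSheaf_containsIdentity l, D.idealSheaf_isInvStable l, fun _ _ _ hx hy hz =>
      D.idealSheaf_isCompStableAt l (not_not.1 hx) (not_not.1 hy) (not_not.1 hz)⟩⟩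

end AffineData

open Polynomial

/-! ### Orders of polynomials at the places of the projective line -/

/-- The punctured neighbourhoods of a point of the projective line, in the affine coordinate. -/
def placeFilter (v : P1) : Filter ℂ := v.elim (Bornology.cobounded ℂ) fun a => 𝓝[≠] a

/-- The coordinate `x - a` at a finite point `a`, and `x` at infinity. -/
def placeCoord (v : P1) (x : ℂ) : ℂ := v.elim x fun a => x - a

/-- A local uniformizer: `x - a` at a finite point `a`, and `1 / x` at infinity. -/
def uniformizer (v : P1) (x : ℂ) : ℂ := v.elim x⁻¹ fun a => x - a

/-- The number of zeros at a finite point, or of poles at infinity. -/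
def placeMult (v : P1) (H : ℂ[X]) : ℕ := v.elim H.natDegree fun a => H.rootMultiplicity a

/-- The order of vanishing of a polynomial at a point of the projective line. -/
def placeOrd (v : P1) (H : ℂ[X]) : ℤ := v.elim (-(H.natDegree : ℤ)) fun a => H.rootMultiplicity a

/-- The logarithmic derivative of a polynomial. -/
def logD (H : ℂ[X]) (x : ℂ) : ℂ := (derivative H).eval x / H.eval x

theorem placeFilter_le_cofinite (v : P1) : placeFilter v ≤ cofinite := by
  induction v using OnePoint.rec with
  | infty => exact Bornology.le_cofinite ℂ
  | coe a => exact nhdsNE_le_cofinite a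

instance placeFilter_neBot (v : P1) : (placeFilter v).NeBot := by
  induction v using OnePoint.rec with
  | infty => exact inferInstanceAs (Bornology.cobounded ℂ).NeBot
  | coe a => exact inferInstanceAs (𝓝[≠] a).NeBot

theorem eventually_eval_ne_zero {H : ℂ[X]} (hH : H ≠ 0) : ∀ᶠ x in cofinite, H.eval x ≠ 0 := by
  have := finite_setOfPred_isRoot hH
  rw [eventually_cofinite]
  simpa [IsRoot] using this

/-- Induction over a factorization into linear factors. -/
theorem polynomial_induction {p : ℂ[X] → Prop} (hC : ∀ c : ℂ, c ≠ 0 → p (C c))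
    (hX : ∀ r : ℂ, p (X - C r)) (hmul : ∀ f g, f ≠ 0 → g ≠ 0 → p f → p g → p (f * g))
    {f : ℂ[X]} (hf : f ≠ 0) : p f := by
  induction hn : f.natDegree generalizing f with
  | zero =>
    obtain ⟨a, rfl⟩ : ∃ a, f = C a := ⟨_, eq_C_of_natDegree_eq_zero hn⟩
    exact hC a fun h0 => hf (by rw [h0, map_zero])
  | succ n ih =>
    obtain ⟨r, hr⟩ := IsAlgClosed.exists_root f (by
      intro h0
      rw [degree_eq_natDegree hf, hn] at h0
      norm_cast at h0)
    obtain ⟨g, rfl⟩ := dvd_iff_isRoot.2 hr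
    have hg : g ≠ 0 := right_ne_zero_of_mul hf
    rw [natDegree_mul (X_sub_C_ne_zero r) hg, natDegree_X_sub_C] at hn
    exact hmul _ _ (X_sub_C_ne_zero r) hg (hX r) (ih hg (by omega))

theorem placeMult_C (v : P1) (c : ℂ) : placeMult v (C c) = 0 := by
  induction v using OnePoint.rec <;> simp [placeMult]

theorem placeMult_mul (v : P1) {f g : ℂ[X]} (hf : f ≠ 0) (hg : g ≠ 0) :
    placeMult v (f * g) = placeMult v f + placeMult v g := by
  induction v using OnePoint.rec with
  | infty => exact natDegree_mul hf hg
  | coe a => exact rootMultiplicity_mul (mul_ne_zero hf hg)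

theorem placeOrd_C (v : P1) (c : ℂ) : placeOrd v (C c) = 0 := by
  induction v using OnePoint.rec <;> simp [placeOrd]

theorem placeOrd_mul (v : P1) {f g : ℂ[X]} (hf : f ≠ 0) (hg : g ≠ 0) :
    placeOrd v (f * g) = placeOrd v f + placeOrd v g := by
  have h := placeMult_mul v hf hg
  induction v using OnePoint.rec with
  | infty =>
    simp only [placeMult, placeOrd, OnePoint.elim_infty] at h ⊢
    rw [h]
    push_cast
    ring
  | coe a =>
    simp only [placeMult, placeOrd, OnePoint.elim_some] at h ⊢
    exact_mod_cast h

theorem eventually_uniformizer_ne_zero (v : P1) : ∀ᶠ x in placeFilter v, uniformizer v x ≠ 0 := by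
  induction v using OnePoint.rec with
  | infty =>
    refine (placeFilter_le_cofinite _) ?_
    rw [mem_cofinite]
    exact (Set.finite_singleton (0 : ℂ)).subset fun x hx => by simpa [uniformizer] using hx
  | coe a =>
    exact eventually_mem_nhdsWithin.mono fun x hx => sub_ne_zero.2 hx

theorem tendsto_inv_mul_cobounded (r : ℂ) :
    Tendsto (fun x : ℂ => (x - r) * x⁻¹) (Bornology.cobounded ℂ) (𝓝 1) := by
  have h0 : Tendsto (fun x : ℂ => 1 - r * x⁻¹) (Bornology.cobounded ℂ) (𝓝 (1 - r * 0)) :=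
    (tendsto_inv₀_cobounded.const_mul r).const_sub 1
  rw [mul_zero, sub_zero] at h0
  refine h0.congr' ?_
  filter_upwards [eventually_uniformizer_ne_zero OnePoint.infty] with x hx
  have hx0 : x ≠ 0 := fun h => hx (by simp [uniformizer, h])
  field_simp

/-- The property is multiplicative, so it is enough to check constants and linear factors. The same
method gives the limits of logarithmic derivatives below. -/
theorem exists_tendsto_mul_uniformizer (v : P1) {H : ℂ[X]} (hH : H ≠ 0) :
    ∃ c : ℂ, c ≠ 0 ∧
      Tendsto (fun x => H.eval x * uniformizer v x ^ (-placeOrd v H)) (placeFilter v) (𝓝 c) := by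
  refine polynomial_induction (p := fun H => ∃ c : ℂ, c ≠ 0 ∧
    Tendsto (fun x => H.eval x * uniformizer v x ^ (-placeOrd v H)) (placeFilter v) (𝓝 c))
    (fun c hc => ⟨c, hc, ?_⟩) (fun r => ?_) ?_ hH
  · simp [placeOrd_C]
  · induction v using OnePoint.rec with
    | infty =>
      refine ⟨1, one_ne_zero, ?_⟩
      refine (tendsto_inv_mul_cobounded r).congr fun x => ?_
      simp [placeOrd, uniformizer]
    | coe a =>
      by_cases har : a = r
      · subst har
        refine ⟨1, one_ne_zero, tendsto_const_nhds.congr' ?_⟩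
        filter_upwards [eventually_uniformizer_ne_zero a] with x hx
        have hx' : x - a ≠ 0 := hx
        simp [placeOrd, uniformizer, rootMultiplicity_X_sub_C_self, hx']
      · refine ⟨a - r, sub_ne_zero.2 har, ?_⟩
        simp only [placeOrd, OnePoint.elim_some, rootMultiplicity_X_sub_C, if_neg har]
        simp only [Nat.cast_zero, neg_zero, zpow_zero, mul_one, eval_sub, eval_X, eval_C]
        exact ((continuous_id.sub continuous_const).tendsto a).mono_left nhdsWithin_le_nhds
  · rintro f g hf hg ⟨c, hc, h1⟩ ⟨c', hc', h2⟩
    refine ⟨c * c', mul_ne_zero hc hc', (h1.mul h2).congr' ?_⟩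
    filter_upwards [eventually_uniformizer_ne_zero v] with x hx
    rw [eval_mul, placeOrd_mul v hf hg, neg_add, zpow_add₀ hx]
    ring

theorem logD_mul {f g : ℂ[X]} {x : ℂ} (hf : f.eval x ≠ 0) (hg : g.eval x ≠ 0) :
    logD (f * g) x = logD f x + logD g x := by
  simp only [logD, derivative_mul, eval_add, eval_mul]
  field_simp

theorem logD_C (c : ℂ) : logD (C c) = 0 := by
  funext x
  simp [logD]

theorem logD_X_sub_C (r x : ℂ) : logD (X - C r) x = (x - r)⁻¹ := by
  simp [logD]

theorem analyticAt_logD {H : ℂ[X]} {x : ℂ} (hx : H.eval x ≠ 0) : AnalyticAt ℂ (logD H) x :=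
  ((derivative H).differentiable.analyticAt x).fun_div (H.differentiable.analyticAt x) hx

theorem eventually_nhds_eval_ne_zero {H : ℂ[X]} {x : ℂ} (hx : H.eval x ≠ 0) :
    ∀ᶠ y in 𝓝 x, H.eval y ≠ 0 :=
  H.continuous.continuousAt.eventually_ne hx

theorem tendsto_placeCoord_inv (v : P1) (r : ℂ) :
    Tendsto (fun x => placeCoord v x * (x - r)⁻¹) (placeFilter v)
      (𝓝 (placeMult v (X - C r) : ℂ)) := by
  induction v using OnePoint.rec with
  | infty =>
    have h := (tendsto_inv_mul_cobounded r).inv₀ one_ne_zero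
    rw [inv_one] at h
    have hm : placeMult OnePoint.infty (X - C r) = 1 := natDegree_X_sub_C r
    rw [hm, Nat.cast_one]
    refine h.congr fun x => ?_
    rw [mul_inv, inv_inv, mul_comm]
    rfl
  | coe a =>
    by_cases har : a = r
    · subst har
      have hm : placeMult a (X - C a) = 1 := rootMultiplicity_X_sub_C_self
      rw [hm, Nat.cast_one]
      refine tendsto_const_nhds.congr' ?_
      filter_upwards [eventually_uniformizer_ne_zero a] with x hx
      exact (mul_inv_cancel₀ (show x - a ≠ 0 from hx)).symm
    · have hm : placeMult a (X - C r) = 0 := by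
        change rootMultiplicity a (X - C r) = 0
        rw [rootMultiplicity_X_sub_C, if_neg har]
      have hc : ContinuousAt (fun x : ℂ => (x - a) * (x - r)⁻¹) a :=
        (continuousAt_id.sub continuousAt_const).mul
          ((continuousAt_id.sub continuousAt_const).inv₀ (sub_ne_zero.2 har))
      have h := hc.tendsto
      simp only [sub_self, zero_mul] at h
      rw [hm, Nat.cast_zero]
      exact h.mono_left nhdsWithin_le_nhds

theorem placeMult_X_sub_C_sq (v : P1) (r : ℂ) :
    (placeMult v (X - C r) : ℂ) ^ 2 = placeMult v (X - C r) := by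
  have : placeMult v (X - C r) = 0 ∨ placeMult v (X - C r) = 1 := by
    induction v using OnePoint.rec with
    | infty => exact Or.inr (natDegree_X_sub_C r)
    | coe a =>
      change rootMultiplicity a (X - C r) = 0 ∨ rootMultiplicity a (X - C r) = 1
      rw [rootMultiplicity_X_sub_C]
      split_ifs <;> simp
  rcases this with h | h <;> simp [h]

/-- The logarithmic derivative has at a finite point a simple pole whose residue is the
multiplicity, and at infinity `x H' / H` tends to the degree. Using `placeCoord` and `placeMult`
makes both cases read alike. -/
theorem tendsto_placeCoord_mul_logD (v : P1) {H : ℂ[X]} (hH : H ≠ 0) :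
    Tendsto (fun x => placeCoord v x * logD H x) (placeFilter v) (𝓝 (placeMult v H : ℂ)) := by
  refine polynomial_induction (p := fun H => Tendsto (fun x => placeCoord v x * logD H x)
    (placeFilter v) (𝓝 (placeMult v H : ℂ))) (fun c _ => ?_) (fun r => ?_) ?_ hH
  · simp [placeMult_C, logD_C]
  · simp only [logD_X_sub_C]
    exact tendsto_placeCoord_inv v r
  · intro f g hf hg h1 h2
    rw [placeMult_mul v hf hg, Nat.cast_add]
    refine (h1.add h2).congr' ?_
    filter_upwards [placeFilter_le_cofinite v (eventually_eval_ne_zero hf),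
      placeFilter_le_cofinite v (eventually_eval_ne_zero hg)] with x hx hx'
    rw [logD_mul hx hx']
    ring

theorem tendsto_placeCoord_sq_mul_deriv_logD (v : P1) {H : ℂ[X]} (hH : H ≠ 0) :
    Tendsto (fun x => placeCoord v x ^ 2 * deriv (logD H) x) (placeFilter v)
      (𝓝 (-placeMult v H : ℂ)) := by
  refine polynomial_induction (p := fun H => Tendsto (fun x => placeCoord v x ^ 2 *
    deriv (logD H) x) (placeFilter v) (𝓝 (-placeMult v H : ℂ))) (fun c _ => ?_) (fun r => ?_) ?_ hH
  · rw [logD_C, placeMult_C]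
    simp
  · have h := ((tendsto_placeCoord_inv v r).pow 2).neg
    rw [placeMult_X_sub_C_sq] at h
    refine h.congr' ?_
    filter_upwards [placeFilter_le_cofinite v (eventually_eval_ne_zero (X_sub_C_ne_zero r))]
      with x hx
    have hx' : x - r ≠ 0 := by simpa using hx
    have hd : HasDerivAt (logD (X - C r)) (-1 / (x - r) ^ 2) x := by
      rw [funext (logD_X_sub_C r)]
      exact ((hasDerivAt_id' x).sub_const r).fun_inv hx'
    rw [hd.deriv, mul_pow, inv_pow]
    field_simp
  · intro f g hf hg h1 h2
    rw [placeMult_mul v hf hg, Nat.cast_add, neg_add]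
    refine (h1.add h2).congr' ?_
    filter_upwards [placeFilter_le_cofinite v (eventually_eval_ne_zero hf),
      placeFilter_le_cofinite v (eventually_eval_ne_zero hg)] with x hx hx'
    have he : logD (f * g) =ᶠ[𝓝 x] fun y => logD f y + logD g y := by
      filter_upwards [eventually_nhds_eval_ne_zero hx, eventually_nhds_eval_ne_zero hx']
        with y hy hy'
      exact logD_mul hy hy'
    rw [he.deriv_eq, deriv_fun_add (analyticAt_logD hx).differentiableAt
      (analyticAt_logD hx').differentiableAt]
    ring

/-- Partial fractions. -/
theorem logD_eq_sum {H : ℂ[X]} (hH : H ≠ 0) {S : Finset ℂ} (hS : ∀ r, H.IsRoot r → r ∈ S) :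
    H.natDegree = ∑ r ∈ S, H.rootMultiplicity r ∧
      ∀ x, H.eval x ≠ 0 → logD H x = ∑ r ∈ S, (H.rootMultiplicity r : ℂ) * (x - r)⁻¹ := by
  revert hS
  refine polynomial_induction (p := fun H => (∀ r, H.IsRoot r → r ∈ S) →
    H.natDegree = ∑ r ∈ S, H.rootMultiplicity r ∧
      ∀ x, H.eval x ≠ 0 → logD H x = ∑ r ∈ S, (H.rootMultiplicity r : ℂ) * (x - r)⁻¹)
    (fun c _ _ => ?_) (fun r hS => ?_) ?_ hH
  · simp [logD_C]
  · have hr : r ∈ S := hS r (by simp)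
    simp only [natDegree_X_sub_C, rootMultiplicity_X_sub_C, logD_X_sub_C]
    refine ⟨?_, fun x _ => ?_⟩
    · simp [hr]
    · simp [hr]
  · intro f g hf hg h1 h2 hS
    obtain ⟨d1, e1⟩ := h1 fun r hr => hS r (by simp [IsRoot, hr.eq_zero])
    obtain ⟨d2, e2⟩ := h2 fun r hr => hS r (by simp [IsRoot, hr.eq_zero])
    simp only [rootMultiplicity_mul (mul_ne_zero hf hg), natDegree_mul hf hg, Nat.cast_add,
      add_mul, Finset.sum_add_distrib]
    refine ⟨by rw [d1, d2], fun x hx => ?_⟩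
    rw [eval_mul] at hx
    rw [logD_mul (left_ne_zero_of_mul hx) (right_ne_zero_of_mul hx),
      e1 x (left_ne_zero_of_mul hx), e2 x (right_ne_zero_of_mul hx)]

/-- A combination of logarithmic derivatives without residues vanishes, and so does the sum of
its residues. -/
theorem sum_logD_eq_zero {ι : Type*} {s : Finset ι} {H : ι → ℂ[X]} (hH : ∀ m ∈ s, H m ≠ 0)
    {c : ι → ℂ} (h : ∀ a : ℂ, ∑ m ∈ s, c m * (H m).rootMultiplicity a = 0) :
    ∑ m ∈ s, c m * (H m).natDegree = 0 ∧
      ∀ x, (∀ m ∈ s, (H m).eval x ≠ 0) → ∑ m ∈ s, c m * logD (H m) x = 0 := by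
  classical
  set S : Finset ℂ := s.biUnion fun m => (H m).roots.toFinset with hSdef
  have hS : ∀ m ∈ s, ∀ r, (H m).IsRoot r → r ∈ S := fun m hm r hr =>
    Finset.mem_biUnion.2 ⟨m, hm, by simpa using ⟨hH m hm, hr⟩⟩
  constructor
  · calc ∑ m ∈ s, c m * ((H m).natDegree : ℂ)
        = ∑ m ∈ s, ∑ r ∈ S, c m * ((H m).rootMultiplicity r : ℂ) := by
          refine Finset.sum_congr rfl fun m hm => ?_
          rw [(logD_eq_sum (hH m hm) (hS m hm)).1, Nat.cast_sum, Finset.mul_sum]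
      _ = 0 := by
          rw [Finset.sum_comm]
          exact Finset.sum_eq_zero fun r _ => h r
  · intro x hx
    calc ∑ m ∈ s, c m * logD (H m) x
        = ∑ m ∈ s, ∑ r ∈ S, c m * ((H m).rootMultiplicity r : ℂ) * (x - r)⁻¹ := by
          refine Finset.sum_congr rfl fun m hm => ?_
          rw [(logD_eq_sum (hH m hm) (hS m hm)).2 x (hx m hm), Finset.mul_sum]
          exact Finset.sum_congr rfl fun r _ => (mul_assoc _ _ _).symm
      _ = 0 := by
          rw [Finset.sum_comm]
          refine Finset.sum_eq_zero fun r _ => ?_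
          rw [← Finset.sum_mul, h r, zero_mul]

/-! ### Rational functions at the places of the projective line -/

/-- The sign relating the order at a place and the multiplicity: `-1` at infinity. -/
def placeSign (v : P1) : ℤ := v.elim (-1) fun _ => 1

theorem placeSign_mul_self (v : P1) : placeSign v * placeSign v = 1 := by
  induction v using OnePoint.rec <;> simp [placeSign]

theorem placeMult_eq (v : P1) (H : ℂ[X]) : (placeMult v H : ℤ) = placeSign v * placeOrd v H := by
  induction v using OnePoint.rec <;> simp [placeMult, placeSign, placeOrd]

theorem placeMult_cast (v : P1) (H : ℂ[X]) :
    (placeMult v H : ℂ) = placeSign v * placeOrd v H := by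
  exact_mod_cast congrArg (Int.cast : ℤ → ℂ) (placeMult_eq v H)

theorem placeCoord_eq (v : P1) (x : ℂ) : placeCoord v x = uniformizer v x ^ placeSign v := by
  induction v using OnePoint.rec <;> simp [placeCoord, uniformizer, placeSign]

theorem tendsto_uniformizer (v : P1) : Tendsto (uniformizer v) (placeFilter v) (𝓝 0) := by
  induction v using OnePoint.rec with
  | infty => exact tendsto_inv₀_cobounded
  | coe a =>
    have h : Tendsto (fun x : ℂ => x - a) (𝓝 a) (𝓝 (a - a)) :=
      (continuous_id.sub continuous_const).tendsto a
    rw [sub_self] at h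
    exact h.mono_left nhdsWithin_le_nhds

theorem tendsto_placeFilter {α : Type*} {l : Filter α} {f : α → ℂ} {b : P1}
    (h : Tendsto (fun x => uniformizer b (f x)) l (𝓝[≠] 0)) : Tendsto f l (placeFilter b) := by
  induction b using OnePoint.rec with
  | infty =>
    have := tendsto_inv₀_nhdsNE_zero.comp h
    refine this.congr fun x => ?_
    simp [uniformizer]
  | coe b =>
    have h1 : Tendsto (fun x => f x - b) l (𝓝[≠] 0) := h
    obtain ⟨h2, h3⟩ := tendsto_nhdsWithin_iff.1 h1
    refine tendsto_nhdsWithin_iff.2 ⟨?_, h3.mono fun x hx hxb => hx (by simpa [sub_eq_zero] using hxb)⟩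
    have := h2.add_const b
    simpa using this

theorem disjoint_placeFilter {b b' : P1} (h : b ≠ b') :
    Disjoint (placeFilter b) (placeFilter b') := by
  induction b using OnePoint.rec with
  | infty =>
    induction b' using OnePoint.rec with
    | infty => exact absurd rfl h
    | coe b' => exact (Metric.disjoint_nhds_cobounded b').symm.mono_right nhdsWithin_le_nhds
  | coe b =>
    induction b' using OnePoint.rec with
    | infty => exact (Metric.disjoint_nhds_cobounded b).mono_left nhdsWithin_le_nhds
    | coe b' =>
      have hbb : b ≠ b' := fun e => h (by rw [e])
      exact (disjoint_nhds_nhds.2 hbb).mono nhdsWithin_le_nhds nhdsWithin_le_nhds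

theorem exists_tendsto_div (v : P1) {A B : ℂ[X]} (hA : A ≠ 0) (hB : B ≠ 0) :
    ∃ c : ℂ, c ≠ 0 ∧ Tendsto
      (fun x => A.eval x / B.eval x * uniformizer v x ^ (-(placeOrd v A - placeOrd v B)))
      (placeFilter v) (𝓝 c) := by
  obtain ⟨a, ha, h1⟩ := exists_tendsto_mul_uniformizer v hA
  obtain ⟨b, hb, h2⟩ := exists_tendsto_mul_uniformizer v hB
  refine ⟨a / b, div_ne_zero ha hb, (h1.div h2 hb).congr' ?_⟩
  filter_upwards [eventually_uniformizer_ne_zero v] with x hx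
  simp only [Pi.div_apply]
  rw [neg_sub, sub_eq_add_neg, zpow_add₀ hx, zpow_neg _ (placeOrd v B)]
  field_simp

theorem tendsto_uniformizer_zpow (v : P1) {n : ℤ} (hn : 0 < n) :
    Tendsto (fun x => uniformizer v x ^ n) (placeFilter v) (𝓝 0) := by
  lift n to ℕ using hn.le
  have := (tendsto_uniformizer v).pow n
  rw [zero_pow (by omega)] at this
  exact_mod_cast this

/-- An order is read off from an asymptotic equivalence. This is how orders are compared below,
instead of by manipulating multiplicities. -/
theorem zpow_exponent_unique (v : P1) {F : ℂ → ℂ} {m n : ℤ} {c c' : ℂ} (hc : c ≠ 0) (hc' : c' ≠ 0)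
    (h : Tendsto (fun x => F x * uniformizer v x ^ m) (placeFilter v) (𝓝 c))
    (h' : Tendsto (fun x => F x * uniformizer v x ^ n) (placeFilter v) (𝓝 c')) : m = n := by
  by_contra hne
  wlog hmn : m < n generalizing m n c c'
  · exact this hc' hc h' h (Ne.symm hne) (by omega)
  have h2 := h.mul (tendsto_uniformizer_zpow v (n := n - m) (by omega))
  rw [mul_zero] at h2
  refine hc' (tendsto_nhds_unique h' (h2.congr' ?_))
  filter_upwards [eventually_uniformizer_ne_zero v] with x hx
  rw [mul_assoc, ← zpow_add₀ hx]
  congr 2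
  ring

theorem placeOrd_sub_eq_of_tendsto (v : P1) {A B : ℂ[X]} (hA : A ≠ 0) (hB : B ≠ 0) {k : ℤ} {c : ℂ}
    (hc : c ≠ 0) (h : Tendsto (fun x => A.eval x / B.eval x * uniformizer v x ^ k)
      (placeFilter v) (𝓝 c)) : placeOrd v A - placeOrd v B = -k := by
  obtain ⟨c', hc', h'⟩ := exists_tendsto_div v hA hB
  have := zpow_exponent_unique v hc hc' h h'
  omega

/-- If `A` vanishes to at least the order of `B` at a place, then `A / B` has a limit, which is
zero if the order of `A` is larger. -/
theorem exists_tendsto_of_le (v : P1) {A B : ℂ[X]} (hA : A ≠ 0) (hB : B ≠ 0) {k : ℤ}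
    (h : 0 ≤ placeOrd v A - placeOrd v B + k) :
    ∃ c, Tendsto (fun x => A.eval x / B.eval x * uniformizer v x ^ k) (placeFilter v) (𝓝 c) ∧
      (0 < placeOrd v A - placeOrd v B + k → c = 0) := by
  obtain ⟨c, hc, h'⟩ := exists_tendsto_div v hA hB
  have e : ∀ᶠ x in placeFilter v, A.eval x / B.eval x * uniformizer v x ^ k =
      A.eval x / B.eval x * uniformizer v x ^ (-(placeOrd v A - placeOrd v B)) *
        uniformizer v x ^ (placeOrd v A - placeOrd v B + k) := by
    filter_upwards [eventually_uniformizer_ne_zero v] with x hx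
    rw [mul_assoc, ← zpow_add₀ hx]
    congr 2
    ring
  rcases h.eq_or_lt with h0 | h0
  · refine ⟨c, h'.congr' ?_, fun h1 => absurd h1 (by omega)⟩
    filter_upwards [e] with x hx
    rw [hx, ← h0, zpow_zero, mul_one]
  · refine ⟨0, ?_, fun _ => rfl⟩
    have := h'.mul (tendsto_uniformizer_zpow v h0)
    rw [mul_zero] at this
    exact this.congr' (e.mono fun x hx => hx.symm)

/-! ### Rational maps and ramification indices -/

section RationalMap

variable (P Q : ℂ[X])

/-- The numerator of `R - b`, for `R = P / Q`, and of `R` for `b` at infinity. -/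
def numAt (b : P1) : ℂ[X] := b.elim P fun b => P - C b * Q

/-- `P / Q` maps the place `v` to the place `b`, with ramification index `e`. -/
def MapsPlace (v b : P1) (e : ℕ) : Prop :=
  0 < e ∧ placeOrd v (numAt P Q b) = placeOrd v Q + placeSign b * e

variable {P Q}

theorem placeCoord_div {x : ℂ} (hx : Q.eval x ≠ 0) (b : P1) :
    placeCoord b (P.eval x / Q.eval x) = (numAt P Q b).eval x / Q.eval x := by
  induction b using OnePoint.rec with
  | infty => rfl
  | coe b =>
    simp only [placeCoord, numAt, OnePoint.elim_some, eval_sub, eval_mul, eval_C]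
    field_simp

theorem numAt_ne_zero (hcop : IsCoprime P Q) (hd : 1 ≤ max P.natDegree Q.natDegree) (b : P1) :
    numAt P Q b ≠ 0 := by
  have key : ∀ c : ℂ, P ≠ C c * Q := by
    intro c hc
    have hu : IsUnit Q := by
      rw [hc] at hcop
      exact isCoprime_self.1 hcop.of_mul_left_right
    have hQ := natDegree_eq_zero_of_isUnit hu
    have hP : P.natDegree ≤ 0 := by
      rw [hc]
      exact (natDegree_C_mul_le c Q).trans hQ.le
    omega
  induction b using OnePoint.rec with
  | infty =>
    have := key 0
    simpa [numAt] using this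
  | coe b => exact sub_ne_zero.2 (key b)

variable (hQ : Q ≠ 0) (hcop : IsCoprime P Q) (hd : 1 ≤ max P.natDegree Q.natDegree)
include hQ hcop hd

/-- If `P / Q` has a pole at `v`, the image is infinity. Otherwise `P / Q` has a finite limit `c`,
and `P / Q - c`, which tends to zero, has positive order. -/
theorem exists_mapsPlace (v : P1) : ∃ b e, MapsPlace P Q v b e := by
  have hP : P ≠ 0 := numAt_ne_zero hcop hd OnePoint.infty
  by_cases hlt : placeOrd v P < placeOrd v Q
  · refine ⟨OnePoint.infty, (placeOrd v Q - placeOrd v P).toNat, by omega, ?_⟩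
    change placeOrd v P = placeOrd v Q + (-1) * _
    omega
  · obtain ⟨c, hc, -⟩ := exists_tendsto_of_le v hP hQ (k := 0) (by omega)
    have hH : P - C c * Q ≠ 0 := numAt_ne_zero hcop hd c
    have h0 : Tendsto (fun x => (P - C c * Q).eval x / Q.eval x) (placeFilter v) (𝓝 0) := by
      have h1 := hc.sub_const c
      rw [sub_self] at h1
      refine h1.congr' ?_
      filter_upwards [placeFilter_le_cofinite v (eventually_eval_ne_zero hQ)] with x hx
      simp only [zpow_zero, mul_one, eval_sub, eval_mul, eval_C]
      field_simp
    have hlt' : placeOrd v Q < placeOrd v (P - C c * Q) := by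
      by_contra hle
      obtain ⟨c', hc', h2⟩ := exists_tendsto_div v hH hQ
      obtain ⟨a, ha⟩ : ∃ a, Tendsto (fun x => uniformizer v x ^
          (-(placeOrd v (P - C c * Q) - placeOrd v Q))) (placeFilter v) (𝓝 a) := by
        rcases (by omega : 0 ≤ -(placeOrd v (P - C c * Q) - placeOrd v Q)).eq_or_lt with h3 | h3
        · exact ⟨1, by simp [← h3]⟩
        · exact ⟨0, tendsto_uniformizer_zpow v h3⟩
      have h4 := h0.mul ha
      rw [zero_mul] at h4
      exact hc' (tendsto_nhds_unique h2 h4)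
    refine ⟨c, (placeOrd v (P - C c * Q) - placeOrd v Q).toNat, by omega, ?_⟩
    change placeOrd v (P - C c * Q) = placeOrd v Q + 1 * _
    omega

theorem MapsPlace.exists_tendsto {v b : P1} {e : ℕ} (h : MapsPlace P Q v b e) :
    ∃ c : ℂ, c ≠ 0 ∧ Tendsto (fun x => uniformizer b (P.eval x / Q.eval x) *
      uniformizer v x ^ (-(e : ℤ))) (placeFilter v) (𝓝 c) := by
  obtain ⟨-, he⟩ := h
  have hnum := numAt_ne_zero hcop hd b
  induction b using OnePoint.rec with
  | infty =>
    obtain ⟨c, hc, h1⟩ := exists_tendsto_div v hQ hnum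
    refine ⟨c, hc, h1.congr fun x => ?_⟩
    rw [he]
    simp [placeSign, uniformizer, numAt]
  | coe b =>
    obtain ⟨c, hc, h1⟩ := exists_tendsto_div v hnum hQ
    refine ⟨c, hc, h1.congr' ?_⟩
    filter_upwards [placeFilter_le_cofinite v (eventually_eval_ne_zero hQ)] with x hx
    rw [← placeCoord_div hx, he]
    simp [placeSign, uniformizer, placeCoord]

theorem MapsPlace.tendsto {v b : P1} {e : ℕ} (h : MapsPlace P Q v b e) :
    Tendsto (fun x => P.eval x / Q.eval x) (placeFilter v) (placeFilter b) := by
  obtain ⟨c, hc, h1⟩ := h.exists_tendsto hQ hcop hd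
  refine tendsto_placeFilter (tendsto_nhdsWithin_iff.2 ⟨?_, ?_⟩)
  · have h2 := h1.mul (tendsto_uniformizer_zpow v (n := e) (by exact_mod_cast h.1))
    rw [mul_zero] at h2
    refine h2.congr' ?_
    filter_upwards [eventually_uniformizer_ne_zero v] with x hx
    rw [mul_assoc, ← zpow_add₀ hx, neg_add_cancel, zpow_zero, mul_one]
  · filter_upwards [h1.eventually_ne hc] with x hx hx0
    exact hx (by rw [hx0, zero_mul])

theorem MapsPlace.unique {v b b' : P1} {e e' : ℕ} (h : MapsPlace P Q v b e)
    (h' : MapsPlace P Q v b' e') : b = b' ∧ e = e' := by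
  have hb : b = b' := by
    by_contra hne
    exact (h.tendsto hQ hcop hd).not_tendsto (disjoint_placeFilter hne) (h'.tendsto hQ hcop hd)
  subst hb
  refine ⟨rfl, ?_⟩
  have h1 := h.2.symm.trans h'.2
  have h2 : placeSign b * ((e : ℤ) - e') = 0 := by linarith
  have h3 : placeSign b ≠ 0 := fun h0 => by simpa [h0] using placeSign_mul_self b
  have := (mul_eq_zero.1 h2).resolve_left h3
  omega

/-- The logarithmic derivative of `R - b` (or of `R` at a pole) at a place over `b`. -/
theorem MapsPlace.tendsto_logD {v b : P1} {e : ℕ} (h : MapsPlace P Q v b e) :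
    Tendsto (fun x => placeCoord v x * (logD (numAt P Q b) x - logD Q x)) (placeFilter v)
      (𝓝 (placeSign v * placeSign b * e : ℂ)) := by
  have h1 := (tendsto_placeCoord_mul_logD v (numAt_ne_zero hcop hd b)).sub
    (tendsto_placeCoord_mul_logD v hQ)
  have h2 : (placeMult v (numAt P Q b) : ℂ) - placeMult v Q = placeSign v * placeSign b * e := by
    rw [placeMult_cast, placeMult_cast, h.2]
    push_cast
    ring
  rw [h2] at h1
  refine h1.congr fun x => ?_
  ring

end RationalMap

/-! ### Derivatives of a rational map through logarithmic derivatives -/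

section Derivatives

variable {P Q : ℂ[X]} {x : ℂ}

/-- The numerator of the derivative of `P / Q`. -/
def wron (P Q : ℂ[X]) : ℂ[X] := derivative P * Q - P * derivative Q

theorem analyticAt_div_eval (hx : Q.eval x ≠ 0) :
    AnalyticAt ℂ (fun y => P.eval y / Q.eval y) x :=
  (P.differentiable.analyticAt x).fun_div (Q.differentiable.analyticAt x) hx

theorem deriv_div_eval (hx : Q.eval x ≠ 0) :
    deriv (fun y => P.eval y / Q.eval y) x = (wron P Q).eval x / Q.eval x ^ 2 := by
  rw [((P.hasDerivAt x).fun_div (Q.hasDerivAt x) hx).deriv]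
  simp [wron]

theorem deriv_deriv_div_eval (hx : Q.eval x ≠ 0) (hw : (wron P Q).eval x ≠ 0) :
    deriv (deriv fun y => P.eval y / Q.eval y) x =
      deriv (fun y => P.eval y / Q.eval y) x * (logD (wron P Q) x - 2 * logD Q x) := by
  have h1 : deriv (fun y => P.eval y / Q.eval y) =ᶠ[𝓝 x]
      fun y => (wron P Q).eval y / (Q ^ 2).eval y := by
    filter_upwards [eventually_nhds_eval_ne_zero hx] with y hy
    rw [deriv_div_eval hy, eval_pow]
  have hx2 : (Q ^ 2).eval x ≠ 0 := by
    rw [eval_pow]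
    exact pow_ne_zero 2 hx
  rw [h1.deriv_eq, deriv_div_eval hx, (((wron P Q).hasDerivAt x).fun_div
    ((Q ^ 2).hasDerivAt x) hx2).deriv, logD, logD, derivative_pow]
  simp only [eval_pow, eval_mul, Nat.cast_ofNat, map_ofNat, eval_ofNat]
  field_simp
  ring

/-- The derivative of `R` is `R - b` times its logarithmic derivative, and `R` times its own
logarithmic derivative when `b` is infinity. The freedom in `b` allows a description adapted to each
place. -/
theorem deriv_div_eval_eq (hx : Q.eval x ≠ 0) (b : P1) (hb : (numAt P Q b).eval x ≠ 0) :
    deriv (fun y => P.eval y / Q.eval y) x =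
      placeCoord b (P.eval x / Q.eval x) * (logD (numAt P Q b) x - logD Q x) := by
  rw [placeCoord_div hx, deriv_div_eval hx, logD, logD]
  induction b using OnePoint.rec with
  | infty =>
    simp only [numAt, OnePoint.elim_infty, wron, eval_sub, eval_mul] at hb ⊢
    field_simp
  | coe b =>
    simp only [numAt, OnePoint.elim_some, wron, eval_sub, eval_mul, eval_C, derivative_sub,
      derivative_mul, derivative_C, zero_mul, zero_add] at hb ⊢
    generalize hh : P.eval x - b * Q.eval x = h at hb ⊢
    rw [show P.eval x = h + b * Q.eval x by rw [← hh]; ring]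
    field_simp
    ring

/-- With `w = R'' / R'` one has `R''' / R' = w' + w²`, so the Schwarzian part of the equation is `2
w' - w²`; here `w` is the logarithmic derivative of `wron P Q / Q²`. -/
theorem schwarzEq_div_eval (ν : RatFunc ℂ) (hx : Q.eval x ≠ 0) (hw : (wron P Q).eval x ≠ 0) :
    schwarzEq ν (fun y => P.eval y / Q.eval y) x =
      ν.eval (RingHom.id ℂ) (P.eval x / Q.eval x) *
        deriv (fun y => P.eval y / Q.eval y) x ^ 2
      + (2 * (deriv (logD (wron P Q)) x - 2 * deriv (logD Q) x)
        - (logD (wron P Q) x - 2 * logD Q x) ^ 2) - ν.eval (RingHom.id ℂ) x := by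
  set φ := fun y => P.eval y / Q.eval y with hφ
  have hd : deriv φ x ≠ 0 := by
    rw [hφ, deriv_div_eval hx]
    exact div_ne_zero hw (pow_ne_zero 2 hx)
  have h2 : iteratedDeriv 2 φ x = deriv φ x * (logD (wron P Q) x - 2 * logD Q x) := by
    rw [iteratedDeriv_succ, iteratedDeriv_one]
    exact deriv_deriv_div_eval hx hw
  have h3 : iteratedDeriv 3 φ x = deriv φ x * (logD (wron P Q) x - 2 * logD Q x) ^ 2 +
      deriv φ x * (deriv (logD (wron P Q)) x - 2 * deriv (logD Q) x) := by
    have he : iteratedDeriv 2 φ =ᶠ[𝓝 x]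
        fun y => deriv φ y * (logD (wron P Q) y - 2 * logD Q y) := by
      filter_upwards [eventually_nhds_eval_ne_zero hx, eventually_nhds_eval_ne_zero hw]
        with y hy hy'
      rw [iteratedDeriv_succ, iteratedDeriv_one]
      exact deriv_deriv_div_eval hy hy'
    have d1 : HasDerivAt (deriv φ) (deriv φ x * (logD (wron P Q) x - 2 * logD Q x)) x := by
      have := (analyticAt_div_eval (P := P) hx).deriv.differentiableAt.hasDerivAt
      rwa [deriv_deriv_div_eval hx hw] at this
    have d2 := (analyticAt_logD hw).differentiableAt.hasDerivAt
    have d3 := (analyticAt_logD hx).differentiableAt.hasDerivAt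
    rw [iteratedDeriv_succ, he.deriv_eq, (d1.fun_mul (d2.fun_sub (d3.const_mul 2))).deriv]
    ring
  rw [schwarzEq, h2, h3]
  field_simp
  ring

end Derivatives

/-! ### Ramification and the order of the derivative -/

section Ramification

variable {P Q : ℂ[X]}

theorem MapsPlace.placeMult_num {v b : P1} {e : ℕ} (h : MapsPlace P Q v b e) :
    (placeMult v (numAt P Q b) : ℤ) = placeMult v Q + placeSign v * placeSign b * e := by
  rw [placeMult_eq, placeMult_eq, h.2]
  ring

variable (hQ : Q ≠ 0) (hcop : IsCoprime P Q) (hd : 1 ≤ max P.natDegree Q.natDegree)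
include hQ hcop hd

/-- The logarithmic derivative of `R - b` is `wron P Q / (Q * numAt P Q b)`, and by
`MapsPlace.tendsto_logD` it has exactly a simple pole in the variable of the place, with residue `±
e ≠ 0`. This shows both that the Wronskian is nonzero and what its order is. -/
theorem MapsPlace.wron_ne_zero_and_placeOrd {v b : P1} {e : ℕ} (h : MapsPlace P Q v b e) :
    wron P Q ≠ 0 ∧
      placeOrd v (wron P Q) = placeOrd v Q + placeOrd v (numAt P Q b) - placeSign v := by
  have hnum := numAt_ne_zero hcop hd b
  have h1 := h.tendsto_logD hQ hcop hd
  have hc : (placeSign v * placeSign b * e : ℂ) ≠ 0 := by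
    have hs : ∀ v : P1, (placeSign v : ℂ) ≠ 0 := fun v h0 => by
      have := placeSign_mul_self v
      rw [Int.cast_eq_zero.1 h0] at this
      simp at this
    exact mul_ne_zero (mul_ne_zero (hs v) (hs b)) (Nat.cast_ne_zero.2 h.1.ne')
  have h2 : Tendsto (fun x => (wron P Q).eval x / (Q * numAt P Q b).eval x *
      uniformizer v x ^ placeSign v) (placeFilter v) (𝓝 (placeSign v * placeSign b * e : ℂ)) := by
    refine h1.congr' ?_
    filter_upwards [placeFilter_le_cofinite v (eventually_eval_ne_zero hQ),
      placeFilter_le_cofinite v (eventually_eval_ne_zero hnum)] with x hx hx'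
    have e1 := deriv_div_eval_eq hx b hx'
    rw [deriv_div_eval hx, placeCoord_div hx] at e1
    have e2 : logD (numAt P Q b) x - logD Q x
        = (wron P Q).eval x / (Q * numAt P Q b).eval x := by
      rw [eval_mul]
      field_simp at e1 ⊢
      rw [e1]
    rw [e2, placeCoord_eq, mul_comm]
  have hw : wron P Q ≠ 0 := by
    intro h0
    rw [h0] at h2
    simp only [eval_zero, zero_div, zero_mul] at h2
    exact hc (tendsto_nhds_unique h2 tendsto_const_nhds)
  refine ⟨hw, ?_⟩
  have h3 := placeOrd_sub_eq_of_tendsto v hw (mul_ne_zero hQ hnum) hc h2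
  rw [placeOrd_mul v hQ hnum] at h3
  omega

theorem wron_ne_zero : wron P Q ≠ 0 := by
  obtain ⟨b, e, h⟩ := exists_mapsPlace hQ hcop hd OnePoint.infty
  exact (h.wron_ne_zero_and_placeOrd hQ hcop hd).1

theorem MapsPlace.placeMult_wron {v b : P1} {e : ℕ} (h : MapsPlace P Q v b e) :
    (placeMult v (wron P Q) : ℤ) = placeMult v Q + placeMult v (numAt P Q b) - 1 := by
  rw [placeMult_eq, placeMult_eq, placeMult_eq, (h.wron_ne_zero_and_placeOrd hQ hcop hd).2]
  have := placeSign_mul_self v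
  linear_combination -this

/-- The contribution of the second derivative to the projective connection at a place. -/
theorem MapsPlace.tendsto_schwarzian {v b : P1} {e : ℕ} (h : MapsPlace P Q v b e) :
    Tendsto (fun x => placeCoord v x ^ 2 *
      (2 * (deriv (logD (wron P Q)) x - 2 * deriv (logD Q) x)
        - (logD (wron P Q) x - 2 * logD Q x) ^ 2)) (placeFilter v) (𝓝 (1 - (e : ℂ) ^ 2)) := by
  have hw := wron_ne_zero hQ hcop hd
  have h1 := tendsto_placeCoord_mul_logD v hw
  have h2 := tendsto_placeCoord_mul_logD v hQ
  have h3 := tendsto_placeCoord_sq_mul_deriv_logD v hw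
  have h4 := tendsto_placeCoord_sq_mul_deriv_logD v hQ
  have h5 := ((h3.sub (h4.const_mul 2)).const_mul 2).sub ((h1.sub (h2.const_mul 2)).pow 2)
  have e1 : (placeMult v (wron P Q) : ℂ) = placeMult v Q + placeMult v (numAt P Q b) - 1 := by
    exact_mod_cast congrArg (Int.cast : ℤ → ℂ) (h.placeMult_wron hQ hcop hd)
  have e2 : (placeMult v (numAt P Q b) : ℂ) = placeMult v Q + placeSign v * placeSign b * e := by
    exact_mod_cast congrArg (Int.cast : ℤ → ℂ) (h.placeMult_num)
  have e3 : ∀ v : P1, (placeSign v : ℂ) * placeSign v = 1 := fun v => by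
    exact_mod_cast congrArg (Int.cast : ℤ → ℂ) (placeSign_mul_self v)
  rw [e1, e2] at h5
  have e4 : (2 : ℂ) * (-(placeMult v Q + (placeMult v Q + placeSign v * placeSign b * e) - 1)
      - 2 * -placeMult v Q) - (placeMult v Q + (placeMult v Q + placeSign v * placeSign b * e) - 1
      - 2 * placeMult v Q) ^ 2 = 1 - (e : ℂ) ^ 2 := by
    linear_combination (-(e : ℂ) ^ 2 * (placeSign b * placeSign b)) * e3 v - (e : ℂ) ^ 2 * e3 b
  rw [e4] at h5
  refine h5.congr fun x => ?_
  ring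

end Ramification

/-! ### Local behaviour of an invariant projective connection -/

section InvariantConnection

variable {P Q : ℂ[X]}

/-- The Schwarzian term `2 w' - w²`, with `w` the logarithmic derivative of `(P / Q)'`. -/
def schwarzTerm (P Q : ℂ[X]) (x : ℂ) : ℂ :=
  2 * (deriv (logD (wron P Q)) x - 2 * deriv (logD Q) x) - (logD (wron P Q) x - 2 * logD Q x) ^ 2

/-- The projective connection `A / B` is invariant by `P / Q`. -/
def IsInvariantBy (P Q A B : ℂ[X]) : Prop :=
  ∀ᶠ x in cofinite, A.eval (P.eval x / Q.eval x) / B.eval (P.eval x / Q.eval x) *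
    deriv (fun y => P.eval y / Q.eval y) x ^ 2 + schwarzTerm P Q x = A.eval x / B.eval x

/-- The order at a place of the projective connection `A / B`, increased by two. -/
def connOrd (A B : ℂ[X]) (v : P1) : ℤ := placeOrd v A - placeOrd v B + 2 * placeSign v

variable {A B : ℂ[X]}

theorem placeCoord_sq_mul_eq {v : P1} {x : ℂ} (hx : uniformizer v x ≠ 0) (n : ℤ) :
    placeCoord v x ^ 2 * (A.eval x / B.eval x) * uniformizer v x ^ n
      = A.eval x / B.eval x * uniformizer v x ^ (2 * placeSign v + n) := by
  rw [placeCoord_eq, zpow_add₀ hx, mul_comm 2, zpow_mul]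
  norm_cast
  ring

theorem exists_tendsto_conn (hA : A ≠ 0) (hB : B ≠ 0) (v : P1) :
    ∃ c : ℂ, c ≠ 0 ∧ Tendsto (fun x => placeCoord v x ^ 2 * (A.eval x / B.eval x) *
      uniformizer v x ^ (-connOrd A B v)) (placeFilter v) (𝓝 c) := by
  obtain ⟨c, hc, h⟩ := exists_tendsto_div v hA hB
  refine ⟨c, hc, h.congr' ?_⟩
  filter_upwards [eventually_uniformizer_ne_zero v] with x hx
  rw [placeCoord_sq_mul_eq hx, connOrd]
  congr 2
  ring

theorem exists_tendsto_conn_of_nonneg (hB : B ≠ 0) {v : P1}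
    (h : A ≠ 0 → 0 ≤ connOrd A B v) :
    ∃ c : ℂ, Tendsto (fun x => placeCoord v x ^ 2 * (A.eval x / B.eval x)) (placeFilter v)
      (𝓝 c) := by
  by_cases hA : A = 0
  · exact ⟨0, by simp [hA]⟩
  obtain ⟨c, hc, -⟩ := exists_tendsto_of_le v hA hB (k := 2 * placeSign v) (h hA)
  refine ⟨c, hc.congr' ?_⟩
  filter_upwards [eventually_uniformizer_ne_zero v] with x hx
  have := placeCoord_sq_mul_eq (A := A) (B := B) hx 0
  rw [zpow_zero, mul_one, add_zero] at this
  exact this.symm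

variable (hQ : Q ≠ 0) (hcop : IsCoprime P Q) (hd : 1 ≤ max P.natDegree Q.natDegree)
include hQ hcop hd

theorem IsInvariantBy.eventually_eq (h : IsInvariantBy P Q A B) (v b : P1) :
    ∀ᶠ x in placeFilter v, placeCoord v x ^ 2 * (A.eval x / B.eval x) =
      (placeCoord v x * (logD (numAt P Q b) x - logD Q x)) ^ 2 *
        (placeCoord b (P.eval x / Q.eval x) ^ 2 *
          (A.eval (P.eval x / Q.eval x) / B.eval (P.eval x / Q.eval x))) +
        placeCoord v x ^ 2 * schwarzTerm P Q x := by
  filter_upwards [placeFilter_le_cofinite v h,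
    placeFilter_le_cofinite v (eventually_eval_ne_zero hQ),
    placeFilter_le_cofinite v (eventually_eval_ne_zero (numAt_ne_zero hcop hd b))]
    with x h1 h2 h3
  rw [← h1, deriv_div_eval_eq h2 b h3]
  ring

theorem MapsPlace.tendsto_sq {v b : P1} {e : ℕ} (h : MapsPlace P Q v b e) :
    Tendsto (fun x => (placeCoord v x * (logD (numAt P Q b) x - logD Q x)) ^ 2) (placeFilter v)
      (𝓝 ((e : ℂ) ^ 2)) := by
  have h1 := (h.tendsto_logD hQ hcop hd).pow 2
  have e3 : ∀ v : P1, (placeSign v : ℂ) * placeSign v = 1 := fun v => by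
    exact_mod_cast congrArg (Int.cast : ℤ → ℂ) (placeSign_mul_self v)
  have e4 : (placeSign v * placeSign b * e : ℂ) ^ 2 = (e : ℂ) ^ 2 := by
    linear_combination ((e : ℂ) ^ 2 * (placeSign b * placeSign b)) * e3 v + (e : ℂ) ^ 2 * e3 b
  rwa [e4] at h1

/-- The limit of the equation of invariance multiplied by the square of the coordinate. It is the
relation `1 - c_v = e² (1 - c_b)` between coefficients of double poles. -/
theorem MapsPlace.tendsto_conn (hinv : IsInvariantBy P Q A B) {v b : P1} {e : ℕ}
    (h : MapsPlace P Q v b e) {c : ℂ}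
    (hc : Tendsto (fun x => placeCoord b x ^ 2 * (A.eval x / B.eval x)) (placeFilter b) (𝓝 c)) :
    Tendsto (fun x => placeCoord v x ^ 2 * (A.eval x / B.eval x)) (placeFilter v)
      (𝓝 ((e : ℂ) ^ 2 * c + (1 - (e : ℂ) ^ 2))) := by
  have h1 := ((h.tendsto_sq hQ hcop hd).mul (hc.comp (h.tendsto hQ hcop hd))).add
    (h.tendsto_schwarzian hQ hcop hd)
  refine h1.congr' ?_
  filter_upwards [hinv.eventually_eq hQ hcop hd v b] with x hx
  rw [hx]
  rfl

/-- The Schwarzian term has at most a double pole, so it is negligible when the connection has a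
worse pole at `b`. The leading part is then simply pulled back, which multiplies `connOrd` by the
ramification index. -/
theorem MapsPlace.connOrd_eq (hinv : IsInvariantBy P Q A B) (hA : A ≠ 0) (hB : B ≠ 0)
    {v b : P1} {e : ℕ} (h : MapsPlace P Q v b e) (hneg : connOrd A B b < 0) :
    connOrd A B v = e * connOrd A B b := by
  obtain ⟨c, hc, h1⟩ := exists_tendsto_conn hA hB b
  obtain ⟨κ, hκ, h2⟩ := h.exists_tendsto hQ hcop hd
  set o := connOrd A B b with ho
  have hpos : 0 < -((e : ℤ) * o) := by
    have : 0 < (e : ℤ) := by exact_mod_cast h.1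
    nlinarith
  have h3 := (h1.comp (h.tendsto hQ hcop hd)).mul (h2.zpow₀ o (Or.inl hκ))
  have h4 := ((h.tendsto_sq hQ hcop hd).mul h3).add
    ((h.tendsto_schwarzian hQ hcop hd).mul (tendsto_uniformizer_zpow v hpos))
  rw [mul_zero, add_zero] at h4
  have hne : (e : ℂ) ^ 2 * (c * κ ^ o) ≠ 0 :=
    mul_ne_zero (pow_ne_zero 2 (Nat.cast_ne_zero.2 h.1.ne')) (mul_ne_zero hc (zpow_ne_zero o hκ))
  have hub : ∀ᶠ x in placeFilter v, uniformizer b (P.eval x / Q.eval x) ≠ 0 :=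
    (h.tendsto hQ hcop hd).eventually (eventually_uniformizer_ne_zero b)
  have h5 : Tendsto (fun x => A.eval x / B.eval x *
      uniformizer v x ^ (2 * placeSign v + -((e : ℤ) * o))) (placeFilter v)
      (𝓝 ((e : ℂ) ^ 2 * (c * κ ^ o))) := by
    refine h4.congr' ?_
    filter_upwards [hinv.eventually_eq hQ hcop hd v b, eventually_uniformizer_ne_zero v, hub]
      with x hx hx1 hx2
    rw [← placeCoord_sq_mul_eq hx1, hx]
    simp only [Function.comp_apply]
    rw [mul_zpow, ← zpow_mul, add_mul, ← neg_mul]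
    have e1 : uniformizer b (P.eval x / Q.eval x) ^ (-o) *
        uniformizer b (P.eval x / Q.eval x) ^ o = 1 := by
      rw [← zpow_add₀ hx2, neg_add_cancel, zpow_zero]
    simp only [schwarzTerm]
    linear_combination ((placeCoord v x * (logD (numAt P Q b) x - logD Q x)) ^ 2 *
        (placeCoord b (P.eval x / Q.eval x) ^ 2 *
          (A.eval (P.eval x / Q.eval x) / B.eval (P.eval x / Q.eval x))) *
        uniformizer v x ^ (-(e : ℤ) * o)) * e1
  have h6 := placeOrd_sub_eq_of_tendsto v hA hB hne h5
  rw [connOrd]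
  omega

end InvariantConnection

/-! ### Counting in fibres, and weights of an invariant projective connection -/

section Fibres

/-- The zeros of `A / B` counted with multiplicity: the finite ones number `deg A` by coprimality,
and infinity contributes `deg B - deg A` when this is positive. Truncated subtraction takes care of
the other case. -/
theorem max_natDegree_le_sum {A B : ℂ[X]} (hcop : IsCoprime A B) (hA : A ≠ 0) {T : Finset P1}
    (hT : ∀ v, placeOrd v B < placeOrd v A → v ∈ T) :
    max A.natDegree B.natDegree ≤ ∑ v ∈ T, (placeOrd v A - placeOrd v B).toNat := by
  classical
  have hB0 : ∀ a : ℂ, A.IsRoot a → B.rootMultiplicity a = 0 := by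
    intro a ha
    refine rootMultiplicity_eq_zero fun hb => ?_
    obtain ⟨u, w, huw⟩ := hcop
    have := congrArg (eval a) huw
    simp [ha.eq_zero, hb.eq_zero] at this
  have hinf : (OnePoint.infty : P1) ∉ A.roots.toFinset.map ⟨((↑) : ℂ → P1), OnePoint.coe_injective⟩ := by
    simp
  calc max A.natDegree B.natDegree ≤ (B.natDegree - A.natDegree) + A.natDegree := by omega
    _ = ∑ v ∈ insert (OnePoint.infty : P1)
          (A.roots.toFinset.map ⟨((↑) : ℂ → P1), OnePoint.coe_injective⟩),
          (placeOrd v A - placeOrd v B).toNat := by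
        rw [Finset.sum_insert hinf, Finset.sum_map]
        congr 1
        · simp only [placeOrd, OnePoint.elim_infty]
          omega
        · rw [(logD_eq_sum hA (S := A.roots.toFinset) fun r hr => by simpa using ⟨hA, hr⟩).1]
          refine Finset.sum_congr rfl fun a ha => ?_
          have ha' : A.IsRoot a := (by simpa using ha : A ≠ 0 ∧ A.IsRoot a).2
          simp [placeOrd, hB0 a ha']
    _ ≤ ∑ v ∈ T, (placeOrd v A - placeOrd v B).toNat :=
        Finset.sum_le_sum_of_ne_zero fun v _ hv => hT v (by omega)

variable {P Q : ℂ[X]}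

theorem natDegree_le_max_numAt (c : ℂ) :
    max P.natDegree Q.natDegree ≤ max (P - C c * Q).natDegree Q.natDegree := by
  have h := natDegree_add_le (P - C c * Q) (C c * Q)
  rw [sub_add_cancel] at h
  have h' := natDegree_C_mul_le c Q
  omega

theorem isCoprime_sub_C_mul (hcop : IsCoprime P Q) (c : ℂ) : IsCoprime (P - C c * Q) Q := by
  have := hcop.add_mul_right_left (-C c)
  rwa [neg_mul, ← sub_eq_add_neg] at this

/-- The ramification indices in a fibre add up to the degree. -/
theorem degree_le_sum_ramification (hQ : Q ≠ 0) (hcop : IsCoprime P Q)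
    (hd : 1 ≤ max P.natDegree Q.natDegree) {b : P1} {T : Finset P1} {e : P1 → ℕ}
    (hT : ∀ v k, MapsPlace P Q v b k → v ∈ T ∧ e v = k) :
    max P.natDegree Q.natDegree ≤ ∑ v ∈ T, e v := by
  induction b using OnePoint.rec with
  | infty =>
    have hmap : ∀ v, placeOrd v P < placeOrd v Q →
        MapsPlace P Q v OnePoint.infty (placeOrd v Q - placeOrd v P).toNat := by
      intro v hv
      refine ⟨by omega, ?_⟩
      change placeOrd v P = placeOrd v Q + (-1) * _
      omega
    rw [max_comm]
    refine (max_natDegree_le_sum hcop.symm hQ fun v hv => (hT v _ (hmap v hv)).1).trans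
      (Finset.sum_le_sum fun v _ => ?_)
    by_cases hv : placeOrd v P < placeOrd v Q
    · exact (hT v _ (hmap v hv)).2.ge
    · omega
  | coe b =>
    have hmap : ∀ v, placeOrd v Q < placeOrd v (P - C b * Q) →
        MapsPlace P Q v b (placeOrd v (P - C b * Q) - placeOrd v Q).toNat := by
      intro v hv
      refine ⟨by omega, ?_⟩
      change placeOrd v (P - C b * Q) = placeOrd v Q + 1 * _
      omega
    refine (natDegree_le_max_numAt b).trans ((max_natDegree_le_sum (isCoprime_sub_C_mul hcop b)
      (numAt_ne_zero hcop hd b) fun v hv => (hT v _ (hmap v hv)).1).trans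
      (Finset.sum_le_sum fun v _ => ?_))
    by_cases hv : placeOrd v Q < placeOrd v (P - C b * Q)
    · exact (hT v _ (hmap v hv)).2.ge
    · omega

variable {A B : ℂ[X]}

theorem finite_connOrd_neg (hB : B ≠ 0) : {v : P1 | connOrd A B v < 0}.Finite := by
  have h1 : ((↑) '' {a : ℂ | B.IsRoot a} ∪ {OnePoint.infty} : Set P1).Finite :=
    ((finite_setOfPred_isRoot hB).image _).union (Set.finite_singleton _)
  refine h1.subset fun v hv => ?_
  induction v using OnePoint.rec with
  | infty => exact Or.inr rfl
  | coe a =>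
    refine Or.inl ⟨a, ?_, rfl⟩
    have hv' : (A.rootMultiplicity a : ℤ) - B.rootMultiplicity a + 2 * 1 < 0 := hv
    by_contra hr
    rw [rootMultiplicity_eq_zero (p := B) hr] at hv'
    omega

/-- A projective connection invariant by a rational map of degree at least two has at most double
poles. -/
theorem connOrd_nonneg (hQ : Q ≠ 0) (hcop : IsCoprime P Q)
    (hd : 2 ≤ max P.natDegree Q.natDegree) (hinv : IsInvariantBy P Q A B) (hA : A ≠ 0)
    (hB : B ≠ 0) (v : P1) : 0 ≤ connOrd A B v := by
  classical
  have hd1 : 1 ≤ max P.natDegree Q.natDegree := by omega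
  choose R e hR using exists_mapsPlace hQ hcop hd1
  set n : P1 → ℕ := fun v => (-connOrd A B v).toNat with hn
  set S : Finset P1 := (finite_connOrd_neg (A := A) hB).toFinset with hS
  have hmem : ∀ v, v ∈ S ↔ connOrd A B v < 0 := fun v => by simp [hS]
  have hpull : ∀ v, R v ∈ S → v ∈ S ∧ n v = e v * n (R v) := by
    intro v hv
    rw [hmem] at hv
    have h1 := (hR v).connOrd_eq hQ hcop hd1 hinv hA hB hv
    have he : 0 < (e v : ℤ) := by exact_mod_cast (hR v).1
    refine ⟨(hmem v).2 (by rw [h1]; exact mul_neg_of_pos_of_neg he hv), ?_⟩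
    simp only [hn]
    zify
    rw [Int.toNat_of_nonneg (by rw [h1]; nlinarith), Int.toNat_of_nonneg (by omega), h1]
    ring
  by_contra hneg
  have hvS : v ∈ S := (hmem v).2 (by omega)
  have hN : 0 < ∑ v ∈ S, n v :=
    Finset.sum_pos' (fun _ _ => Nat.zero_le _) ⟨v, hvS, by simp only [hn]; omega⟩
  -- The excess at `v` is `e v` times the excess at its image, so the total over the fibre of `b` is
  -- at least the degree times `n b`. Fibres over bad places consist of bad places, so a positive
  -- total would be at least twice itself.
  have hle : max P.natDegree Q.natDegree * ∑ b ∈ S, n b ≤ ∑ v ∈ S, n v := by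
    calc max P.natDegree Q.natDegree * ∑ b ∈ S, n b
        ≤ ∑ b ∈ S, ∑ v ∈ S.filter (fun v => R v ∈ S) with R v = b, e v * n (R v) := by
          rw [Finset.mul_sum]
          refine Finset.sum_le_sum fun b hb => ?_
          rw [Finset.sum_congr rfl (g := fun v => e v * n b) fun v hv => by
            rw [(Finset.mem_filter.1 hv).2], ← Finset.sum_mul]
          refine Nat.mul_le_mul_right _ (degree_le_sum_ramification (b := b) hQ hcop hd1 fun v k hk => ?_)
          obtain ⟨h1, h2⟩ := hk.unique hQ hcop hd1 (hR v)
          subst h1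
          exact ⟨by simp [hb, (hpull v hb).1], h2.symm⟩
      _ = ∑ v ∈ S.filter (fun v => R v ∈ S), e v * n (R v) :=
          Finset.sum_fiberwise_of_maps_to (fun v hv => (Finset.mem_filter.1 hv).2) _
      _ = ∑ v ∈ S.filter (fun v => R v ∈ S), n v :=
          Finset.sum_congr rfl fun v hv => (hpull v (Finset.mem_filter.1 hv).2).2.symm
      _ ≤ ∑ v ∈ S, n v := Finset.sum_le_sum_of_subset (Finset.filter_subset _ _)
  nlinarith

/-- The principal square root commutes with multiplication by positive reals. It therefore provides
weights with `θ v = e * θ b` at all places at once, without any choice of signs. -/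
theorem sq_mul_cpow_half {e : ℕ} (he : 0 < e) (z : ℂ) :
    ((e : ℂ) ^ 2 * z) ^ (1 / 2 : ℂ) = e * z ^ (1 / 2 : ℂ) := by
  have h12 : (1 / 2 : ℂ) ≠ 0 := by norm_num
  by_cases hz : z = 0
  · rw [hz, mul_zero, Complex.zero_cpow h12, mul_zero]
  have he0 : (e : ℂ) ≠ 0 := Nat.cast_ne_zero.2 he.ne'
  have hpos : (0 : ℝ) < (e : ℝ) := Nat.cast_pos.2 he
  rw [Complex.cpow_def_of_ne_zero (mul_ne_zero (pow_ne_zero 2 he0) hz),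
    Complex.cpow_def_of_ne_zero hz]
  have h1 : ((e : ℂ) ^ 2 * z) = (((e : ℝ) ^ 2 : ℝ) : ℂ) * z := by push_cast; ring
  rw [h1, Complex.log_ofReal_mul (by positivity) hz, Real.log_pow, add_mul, Complex.exp_add]
  congr 1
  push_cast
  rw [show 2 * Complex.log (e : ℂ) * (1 / 2) = Complex.log e by ring, Complex.exp_log he0]

/-- The cone angles of an invariant projective connection. -/
theorem exists_weights (hQ : Q ≠ 0) (hcop : IsCoprime P Q)
    (hd : 2 ≤ max P.natDegree Q.natDegree) (hinv : IsInvariantBy P Q A B) (hB : B ≠ 0) :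
    ∃ θ : P1 → ℂ, (∀ v b e, MapsPlace P Q v b e → θ v = e * θ b) ∧
      ∀ a : ℂ, B.eval a ≠ 0 → θ a = 1 := by
  have hd1 : 1 ≤ max P.natDegree Q.natDegree := by omega
  choose c hc using fun v => exists_tendsto_conn_of_nonneg (A := A) hB (v := v)
    fun hA => connOrd_nonneg hQ hcop hd hinv hA hB v
  refine ⟨fun v => (1 - c v) ^ (1 / 2 : ℂ), fun v b e h => ?_, fun a ha => ?_⟩
  · have h1 := tendsto_nhds_unique (hc v) (h.tendsto_conn hQ hcop hd1 hinv (hc b))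
    have h2 : 1 - c v = (e : ℂ) ^ 2 * (1 - c b) := by
      rw [h1]
      ring
    simp only [h2]
    exact sq_mul_cpow_half h.1 _
  · have h1 : Tendsto (fun x : ℂ => (x - a) ^ 2 * (A.eval x / B.eval x)) (𝓝[≠] a)
        (𝓝 ((a - a) ^ 2 * (A.eval a / B.eval a))) :=
      (((continuousAt_id.sub continuousAt_const).pow 2).mul
        (A.continuous.continuousAt.div B.continuous.continuousAt ha)).tendsto.mono_left
          nhdsWithin_le_nhds
    have h2 := tendsto_nhds_unique (hc a) h1
    simp [h2]

end Fibres

/-- The affine connection with given simple poles and residues. -/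
def AffineData.ofResidues (S : Finset ℂ) (k : ℂ → ℂ) : AffineData where
  num := -∑ b ∈ S, C (k b) * ∏ b' ∈ S.erase b, (X - C b')
  den := ∏ b ∈ S, (X - C b)
  den_ne_zero := Finset.prod_ne_zero_iff.2 fun b _ => X_sub_C_ne_zero b

theorem AffineData.mu_ofResidues {S : Finset ℂ} {k : ℂ → ℂ} {z : ℂ} (hz : z ∉ S) :
    (ofResidues S k).mu .affine z = -∑ b ∈ S, k b * (z - b)⁻¹ := by
  have hne : ∀ b ∈ S, z - b ≠ 0 := fun b hb h => hz (by rwa [sub_eq_zero.1 h])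
  simp only [mu, ofResidues, eval_neg, eval_finsetSum, eval_mul, eval_C, eval_prod, eval_sub,
    eval_X, neg_div, Finset.sum_div]
  congr 1
  refine Finset.sum_congr rfl fun b hb => ?_
  rw [← Finset.mul_prod_erase S _ hb]
  have h1 := hne b hb
  have h2 : ∏ b' ∈ S.erase b, (z - b') ≠ 0 :=
    Finset.prod_ne_zero_iff.2 fun b' hb' => hne b' (Finset.mem_of_mem_erase hb')
  field_simp

/-! ### Invariance of an affine connection read on residues -/

section Invariance

variable {P Q : ℂ[X]} (hQ : Q ≠ 0) (hcop : IsCoprime P Q) (hd : 1 ≤ max P.natDegree Q.natDegree)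
include hQ hcop hd

/-- The hypothesis is the vanishing of residues at the finite points. `sum_logD_eq_zero` then gives
both an identity between degrees, which is the residue at infinity, and the vanishing of the whole
combination. -/
theorem residue_combination {S : Finset ℂ} {k : ℂ → ℂ} {m : ℂ}
    (hres : ∀ a : ℂ, -∑ b ∈ S, k b * ((P - C b * Q).rootMultiplicity a : ℂ)
      + ∑ b ∈ S, k b * ((X - C b).rootMultiplicity a : ℂ)
      + (wron P Q).rootMultiplicity a + m * Q.rootMultiplicity a = 0) :
    (-∑ b ∈ S, k b * ((P - C b * Q).natDegree : ℂ) + ∑ b ∈ S, k b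
      + (wron P Q).natDegree + m * Q.natDegree = 0) ∧
    ∀ᶠ x in cofinite, -∑ b ∈ S, k b * logD (P - C b * Q) x + ∑ b ∈ S, k b * (x - b)⁻¹
      + logD (wron P Q) x + m * logD Q x = 0 := by
  let H : ℂ ⊕ ℂ ⊕ Fin 2 → ℂ[X] :=
    Sum.elim (fun b => P - C b * Q) (Sum.elim (fun b => X - C b) ![wron P Q, Q])
  let c : ℂ ⊕ ℂ ⊕ Fin 2 → ℂ := Sum.elim (fun b => -k b) (Sum.elim k ![1, m])
  have hH : ∀ i ∈ S.disjSum (S.disjSum Finset.univ), H i ≠ 0 := by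
    rintro (b | b | i) -
    · exact numAt_ne_zero hcop hd b
    · exact X_sub_C_ne_zero b
    · fin_cases i
      · exact wron_ne_zero hQ hcop hd
      · exact hQ
  have key := sum_logD_eq_zero hH (c := c) (fun a => by
    rw [← hres a]
    simp [Finset.sum_disjSum, H, c, Fin.sum_univ_two]
    ring)
  refine ⟨?_, ?_⟩
  · rw [← key.1]
    simp [Finset.sum_disjSum, H, c, Fin.sum_univ_two]
    ring
  · have hev : ∀ᶠ x in cofinite, ∀ i ∈ S.disjSum (S.disjSum Finset.univ), (H i).eval x ≠ 0 :=
      (Filter.eventually_all_finset _).2 fun i hi => eventually_eval_ne_zero (hH i hi)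
    filter_upwards [hev] with x hx
    rw [← key.2 x hx]
    simp [Finset.sum_disjSum, H, c, Fin.sum_univ_two, logD_X_sub_C]
    ring

/-- For `μ = -∑ k_b / (x - b)` the defect `μ(R) R' + R'' / R' - μ` is the combination of logarithmic
derivatives in `residue_combination`. The coefficient `∑ k_b - 2` of `logD Q` collects the poles of
the terms `R - b` and the `-2` coming from `R' = wron P Q / Q²`. -/
theorem exists_connection_of_residues {S : Finset ℂ} {k : ℂ → ℂ}
    (hres : ∀ a : ℂ, -∑ b ∈ S, k b * ((P - C b * Q).rootMultiplicity a : ℂ)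
      + ∑ b ∈ S, k b * ((X - C b).rootMultiplicity a : ℂ)
      + (wron P Q).rootMultiplicity a + (∑ b ∈ S, k b - 2) * Q.rootMultiplicity a = 0) :
    ∃ D : AffineData, ∀ᶠ x in cofinite,
      ConnEq (D.mu .affine) (D.mu .affine) (fun y => P.eval y / Q.eval y) x := by
  refine ⟨.ofResidues S k, ?_⟩
  have hev : ∀ᶠ x in cofinite, ∀ b ∈ S, (P - C b * Q).eval x ≠ 0 :=
    (Filter.eventually_all_finset _).2 fun b _ =>
      eventually_eval_ne_zero (numAt_ne_zero hcop hd (b : P1))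
  have hS : ∀ᶠ x in cofinite, x ∉ S := S.finite_toSet.compl_mem_cofinite
  filter_upwards [(residue_combination hQ hcop hd hres).2, eventually_eval_ne_zero hQ,
    eventually_eval_ne_zero (wron_ne_zero hQ hcop hd), hev, hS] with x h1 h2 h3 h4 h5
  have hφ : ∀ b : ℂ, P.eval x / Q.eval x - b = (P - C b * Q).eval x / Q.eval x :=
    fun b => placeCoord_div h2 (b : P1)
  have h6 : P.eval x / Q.eval x ∉ S := fun hmem => by
    have := hφ (P.eval x / Q.eval x)
    rw [sub_self] at this
    exact div_ne_zero (h4 _ hmem) h2 this.symm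
  have h7 : ∀ b ∈ S, deriv (fun y => P.eval y / Q.eval y) x * (P.eval x / Q.eval x - b)⁻¹
      = logD (P - C b * Q) x - logD Q x := by
    intro b hb
    have h8 := deriv_div_eval_eq h2 (b : P1) (h4 b hb)
    have h9 : P.eval x / Q.eval x - b ≠ 0 := by
      rw [hφ]
      exact div_ne_zero (h4 b hb) h2
    rw [h8, mul_comm]
    exact inv_mul_cancel_left₀ h9 _
  have h10 : deriv (fun y => P.eval y / Q.eval y) x *
      ∑ b ∈ S, k b * (P.eval x / Q.eval x - b)⁻¹
      = ∑ b ∈ S, k b * logD (P - C b * Q) x - (∑ b ∈ S, k b) * logD Q x := by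
    rw [Finset.mul_sum, Finset.sum_mul, ← Finset.sum_sub_distrib]
    refine Finset.sum_congr rfl fun b hb => ?_
    rw [mul_left_comm, h7 b hb]
    ring
  rw [ConnEq, AffineData.mu_ofResidues h5, AffineData.mu_ofResidues h6, deriv_deriv_div_eval h2 h3]
  set φ' := deriv (fun y => P.eval y / Q.eval y) x
  linear_combination φ' * h1 - φ' * h10

end Invariance

/-! ### Existence of an invariant affine connection -/

section ExistsConnection

variable {P Q : ℂ[X]}

theorem MapsPlace.eval_of_coe {a b : ℂ} {e : ℕ} (hcop : IsCoprime P Q)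
    (h : MapsPlace P Q a b e) : (P - C b * Q).eval a = 0 ∧ Q.eval a ≠ 0 := by
  have h1 : ((P - C b * Q).rootMultiplicity a : ℤ) = Q.rootMultiplicity a + 1 * e := h.2
  have he := h.1
  have h2 : (P - C b * Q).eval a = 0 := by
    by_contra hne
    have := rootMultiplicity_eq_zero (p := P - C b * Q) (x := a) hne
    omega
  refine ⟨h2, fun h3 => ?_⟩
  obtain ⟨u, w, huw⟩ := isCoprime_sub_C_mul hcop b
  have := congrArg (eval a) huw
  simp only [eval_add, eval_mul, h2, h3, mul_zero, add_zero, eval_one] at this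
  exact zero_ne_one this

theorem MapsPlace.eval_of_infty {a : ℂ} {e : ℕ} (hcop : IsCoprime P Q)
    (h : MapsPlace P Q a OnePoint.infty e) : Q.eval a = 0 ∧ P.eval a ≠ 0 := by
  have h1 : (P.rootMultiplicity a : ℤ) = Q.rootMultiplicity a + (-1) * e := h.2
  have he := h.1
  have h2 : Q.eval a = 0 := by
    by_contra hne
    have := rootMultiplicity_eq_zero (p := Q) (x := a) hne
    omega
  refine ⟨h2, fun h3 => ?_⟩
  obtain ⟨u, w, huw⟩ := hcop
  have := congrArg (eval a) huw
  simp only [eval_add, eval_mul, h2, h3, mul_zero, add_zero, eval_one] at this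
  exact zero_ne_one this

theorem sum_mul_rootMultiplicity_X_sub_C {S : Finset ℂ} {k : ℂ → ℂ} (hk : ∀ b, b ∉ S → k b = 0)
    (a : ℂ) : ∑ b ∈ S, k b * ((X - C b).rootMultiplicity a : ℂ) = k a := by
  simp only [rootMultiplicity_X_sub_C, Nat.cast_ite, Nat.cast_one, Nat.cast_zero, mul_ite, mul_one,
    mul_zero]
  rw [Finset.sum_ite_eq]
  split_ifs with h
  · rfl
  · exact (hk a h).symm

theorem sum_eq_of_eq_off {S : Finset ℂ} {k : ℂ → ℂ} (hk : ∀ b, b ∉ S → k b = 0) {m : ℂ → ℂ}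
    {b₀ M : ℂ} (hm : ∀ b, b ≠ b₀ → m b = M) :
    ∑ b ∈ S, k b * m b = (∑ b ∈ S, k b) * M + k b₀ * (m b₀ - M) := by
  have h1 : ∑ b ∈ S, k b * (m b - M) = k b₀ * (m b₀ - M) := by
    refine (Finset.sum_eq_single b₀ (fun b _ hb => ?_) fun hb => ?_)
    · rw [hm b hb, sub_self, mul_zero]
    · rw [hk b₀ hb, zero_mul]
  rw [← h1, Finset.sum_mul, ← Finset.sum_add_distrib]
  exact Finset.sum_congr rfl fun b _ => by ring

variable (hQ : Q ≠ 0) (hcop : IsCoprime P Q) (hd : 1 ≤ max P.natDegree Q.natDegree)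
include hQ hcop hd

/-- If `a` maps to a finite `b` with index `e`, the residue at `a` is `-(1 - θ_b) e + (1 - θ_a) + (e
- 1) = e θ_b - θ_a`. If `a` is a pole of order `e`, it is `(1 - θ_a) + (e - 1) + (θ_∞ - 1) e = e θ_∞
- θ_a`. Both vanish by hypothesis. -/
theorem residue_eq_zero {θ : P1 → ℂ} (hθ : ∀ v b e, MapsPlace P Q v b e → θ v = e * θ b)
    {S : Finset ℂ} (hS : ∀ b : ℂ, b ∉ S → θ b = 1) (a : ℂ) :
    -∑ b ∈ S, (1 - θ b) * ((P - C b * Q).rootMultiplicity a : ℂ)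
      + ∑ b ∈ S, (1 - θ b) * ((X - C b).rootMultiplicity a : ℂ)
      + (wron P Q).rootMultiplicity a + (θ OnePoint.infty - 1) * Q.rootMultiplicity a = 0 := by
  have hk : ∀ b : ℂ, b ∉ S → 1 - θ b = 0 := fun b hb => by rw [hS b hb, sub_self]
  rw [sum_mul_rootMultiplicity_X_sub_C (k := fun b => 1 - θ b) hk]
  obtain ⟨b, e, h⟩ := exists_mapsPlace hQ hcop hd (a : P1)
  have hw : (placeMult (a : P1) (wron P Q) : ℂ)
      = placeMult (a : P1) Q + placeMult (a : P1) (numAt P Q b) - 1 := by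
    exact_mod_cast congrArg (Int.cast : ℤ → ℂ) (h.placeMult_wron hQ hcop hd)
  have hn : (placeMult (a : P1) (numAt P Q b) : ℂ)
      = placeMult (a : P1) Q + placeSign a * placeSign b * e := by
    exact_mod_cast congrArg (Int.cast : ℤ → ℂ) h.placeMult_num
  have hθa := hθ _ _ _ h
  induction b using OnePoint.rec with
  | infty =>
    obtain ⟨h1, h2⟩ := h.eval_of_infty hcop
    have h3 : ∀ b : ℂ, (P - C b * Q).rootMultiplicity a = 0 := fun b =>
      rootMultiplicity_eq_zero (by simpa [IsRoot, h1] using h2)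
    have h4 : P.rootMultiplicity a = 0 := rootMultiplicity_eq_zero h2
    simp only [placeMult, OnePoint.elim_some, OnePoint.elim_infty, numAt, placeSign, h4] at hw hn
    simp only [h3, hw, hθa]
    push_cast at hn ⊢
    simp only [mul_zero, Finset.sum_const_zero]
    linear_combination -(θ OnePoint.infty) * hn
  | coe b =>
    obtain ⟨h1, h2⟩ := h.eval_of_coe hcop
    have h3 : ∀ b' : ℂ, b' ≠ b → ((P - C b' * Q).rootMultiplicity a : ℂ) = 0 := fun b' hb' => by
      rw [rootMultiplicity_eq_zero, Nat.cast_zero]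
      simp only [IsRoot, eval_sub, eval_mul, eval_C] at h1 ⊢
      intro h4
      exact mul_ne_zero (sub_ne_zero.2 hb') h2 (by linear_combination h1 - h4)
    rw [sum_eq_of_eq_off (k := fun b => 1 - θ b) hk h3]
    have h4 : Q.rootMultiplicity a = 0 := rootMultiplicity_eq_zero h2
    simp only [placeMult, OnePoint.elim_some, numAt, placeSign, h4] at hw hn
    simp only [hw, hθa, h4]
    push_cast at hn ⊢
    linear_combination (θ b) * hn

/-- The Riemann–Hurwitz formula for invariant weights. -/
theorem sum_weights_eq_two (hd2 : 2 ≤ max P.natDegree Q.natDegree) {θ : P1 → ℂ}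
    (hθ : ∀ v b e, MapsPlace P Q v b e → θ v = e * θ b)
    {S : Finset ℂ} (hS : ∀ b : ℂ, b ∉ S → θ b = 1) :
    ∑ b ∈ S, (1 - θ b) - 2 = θ OnePoint.infty - 1 := by
  have hk : ∀ b : ℂ, b ∉ S → 1 - θ b = 0 := fun b hb => by rw [hS b hb, sub_self]
  have hsum := (residue_combination hQ hcop hd (k := fun b => 1 - θ b)
    (residue_eq_zero hQ hcop hd hθ hS)).1
  obtain ⟨b, e, h⟩ := exists_mapsPlace hQ hcop hd OnePoint.infty
  have hw : (placeMult OnePoint.infty (wron P Q) : ℂ)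
      = placeMult OnePoint.infty Q + placeMult OnePoint.infty (numAt P Q b) - 1 := by
    exact_mod_cast congrArg (Int.cast : ℤ → ℂ) (h.placeMult_wron hQ hcop hd)
  have hn := h.placeMult_num
  have hθa := hθ _ _ _ h
  have he := h.1
  have hd2' : (1 : ℂ) - (max P.natDegree Q.natDegree : ℕ) ≠ 0 := fun h0 => by
    have h1 : ((max P.natDegree Q.natDegree : ℕ) : ℂ) = (1 : ℕ) := by
      push_cast
      linear_combination -h0
    have := Nat.cast_injective h1
    omega
  -- Once the ramification at infinity is inserted, the identity between degrees becomes `(1 - d) (∑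
  -- (1 - θ_b) - 2 - (θ_∞ - 1)) = 0`, and `d ≠ 1`.
  refine sub_eq_zero.1 ((mul_eq_zero.1 ?_).resolve_left hd2')
  induction b using OnePoint.rec with
  | infty =>
    simp only [placeMult, OnePoint.elim_infty, numAt, placeSign] at hw hn
    have h3 : ∀ b : ℂ, (P - C b * Q).natDegree = P.natDegree := fun b =>
      natDegree_sub_eq_left_of_natDegree_lt ((natDegree_C_mul_le b Q).trans_lt (by omega))
    have hmax : max P.natDegree Q.natDegree = P.natDegree := by omega
    simp only [h3, hw, ← Finset.sum_mul] at hsum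
    rw [hmax]
    have hn' : (P.natDegree : ℂ) = Q.natDegree + e := by
      have : P.natDegree = Q.natDegree + e := by omega
      exact_mod_cast congrArg (Nat.cast : ℕ → ℂ) this
    linear_combination hsum + θ OnePoint.infty * hn' - hθa
  | coe b =>
    simp only [placeMult, OnePoint.elim_infty, OnePoint.elim_some, numAt, placeSign] at hw hn
    have h3 : ∀ b' : ℂ, b' ≠ b → ((P - C b' * Q).natDegree : ℂ) = Q.natDegree := by
      intro b' hb'
      have h4 : P - C b' * Q = (P - C b * Q) + C (b - b') * Q := by
        rw [map_sub]
        ring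
      rw [h4, natDegree_add_eq_right_of_natDegree_lt, natDegree_C_mul (sub_ne_zero.2 hb'.symm)]
      rw [natDegree_C_mul (sub_ne_zero.2 hb'.symm)]
      omega
    have hmax : max P.natDegree Q.natDegree = Q.natDegree := by
      have h4 := natDegree_add_le (P - C b * Q) (C b * Q)
      rw [sub_add_cancel] at h4
      have := natDegree_C_mul_le b Q
      omega
    rw [sum_eq_of_eq_off (k := fun b => 1 - θ b) hk h3, hw] at hsum
    rw [hmax]
    have hn' : (Q.natDegree : ℂ) = (P - C b * Q).natDegree + e := by
      have : Q.natDegree = (P - C b * Q).natDegree + e := by omega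
      exact_mod_cast congrArg (Nat.cast : ℕ → ℂ) this
    linear_combination hsum + θ b * hn' - hθa

theorem exists_connection_of_two_le (hd2 : 2 ≤ max P.natDegree Q.natDegree) {A B : ℂ[X]}
    (hB : B ≠ 0) (hinv : IsInvariantBy P Q A B) : ∃ D : AffineData, ∀ᶠ x in cofinite,
      ConnEq (D.mu .affine) (D.mu .affine) (fun y => P.eval y / Q.eval y) x := by
  obtain ⟨θ, hθ, hθ1⟩ := exists_weights hQ hcop hd2 hinv hB
  have hS : ∀ b : ℂ, b ∉ B.roots.toFinset → θ b = 1 := fun b hb =>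
    hθ1 b fun h0 => hb (by simpa using ⟨hB, h0⟩)
  refine exists_connection_of_residues hQ hcop hd (S := B.roots.toFinset)
    (k := fun b => 1 - θ b) fun a => ?_
  rw [sum_weights_eq_two hQ hcop hd hd2 hθ hS]
  exact residue_eq_zero hQ hcop hd hθ hS a

/-- A homography has a fixed point; it is affine in a coordinate sending this point to infinity, and
so preserves the affine structure of that coordinate. The projective connection plays no role here.
-/
theorem exists_connection_of_le_one (hd1 : max P.natDegree Q.natDegree ≤ 1) :
    ∃ D : AffineData, ∀ᶠ x in cofinite,
      ConnEq (D.mu .affine) (D.mu .affine) (fun y => P.eval y / Q.eval y) x := by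
  have hPd : P.natDegree ≤ 1 := (le_max_left _ _).trans hd1
  have hQd : Q.natDegree ≤ 1 := (le_max_right _ _).trans hd1
  have hw : ∀ a, (wron P Q).rootMultiplicity a = 0 := by
    obtain ⟨p₁, p₀, rfl⟩ := exists_eq_X_add_C_of_natDegree_le_one hPd
    obtain ⟨q₁, q₀, rfl⟩ := exists_eq_X_add_C_of_natDegree_le_one hQd
    intro a
    have : wron (C p₁ * X + C p₀) (C q₁ * X + C q₀) = C (p₁ * q₀ - p₀ * q₁) := by
      simp only [wron, derivative_add, derivative_mul, derivative_C, derivative_X, map_sub, map_mul]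
      ring
    rw [this, rootMultiplicity_C]
  rcases Nat.eq_zero_or_pos Q.natDegree with hQ0 | hQ0
  -- Infinity is fixed: the map is affine and preserves `μ = 0`.
  · refine exists_connection_of_residues hQ hcop hd (S := ∅) (k := 0) fun a => ?_
    rw [eq_C_of_natDegree_eq_zero hQ0]
    rw [eq_C_of_natDegree_eq_zero hQ0] at hw
    simp [hw, rootMultiplicity_C]
  · have hX : (X * Q).natDegree = Q.natDegree + 1 := natDegree_X_mul hQ
    have hdeg : (P - X * Q).natDegree = Q.natDegree + 1 := by
      rw [natDegree_sub_eq_right_of_natDegree_lt (by rw [hX]; omega), hX]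
    obtain ⟨p, hp⟩ := IsAlgClosed.exists_root (P - X * Q) (by
      intro h0
      have := natDegree_eq_zero_iff_degree_le_zero.2 h0.le
      omega)
    have hp' : (P - C p * Q).IsRoot p := by simpa [IsRoot] using hp
    have hH := numAt_ne_zero hcop hd (p : P1)
    obtain ⟨g, hg⟩ := dvd_iff_isRoot.2 hp'
    have hH' : (X - C p) * g ≠ 0 := hg ▸ hH
    have hgd : g.natDegree = 0 := by
      have h1 := natDegree_mul (X_sub_C_ne_zero p) (right_ne_zero_of_mul hH')
      rw [← hg, natDegree_X_sub_C] at h1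
      have h2 := natDegree_sub_le P (C p * Q)
      have h3 := natDegree_C_mul_le p Q
      omega
    -- The flat coordinate is `1 / (x - p)`, whose derivative is proportional to `(x - p)⁻²`; hence
    -- the coefficient `2`.
    refine exists_connection_of_residues hQ hcop hd (S := {p}) (k := fun _ => 2) fun a => ?_
    simp only [Finset.sum_singleton, hg, rootMultiplicity_mul hH', hw]
    rw [eq_C_of_natDegree_eq_zero hgd, rootMultiplicity_C]
    simp

end ExistsConnection

/-! ### Solving the equation of type (3) to finite order -/

/-- Congruence of germs at `a` modulo `(x - a) ^ n`. -/
def CongrMod (a : ℂ) (n : ℕ) (F G : ℂ → ℂ) : Prop :=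
  ∃ h : ℂ → ℂ, AnalyticAt ℂ h a ∧ ∀ᶠ x in 𝓝 a, F x = G x + (x - a) ^ n * h x

namespace CongrMod

variable {a : ℂ} {n : ℕ} {F G F' G' : ℂ → ℂ}

theorem of_eventuallyEq (h : F =ᶠ[𝓝 a] G) : CongrMod a n F G :=
  ⟨fun _ => 0, analyticAt_const, h.mono fun x hx => by simpa using hx⟩

theorem add (h : CongrMod a n F G) (h' : CongrMod a n F' G') :
    CongrMod a n (fun x => F x + F' x) (fun x => G x + G' x) := by
  obtain ⟨k, hk, e⟩ := h
  obtain ⟨k', hk', e'⟩ := h'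
  refine ⟨fun x => k x + k' x, hk.fun_add hk', ?_⟩
  filter_upwards [e, e'] with x hx hx'
  rw [hx, hx']
  ring

theorem mul (h : CongrMod a n F G) (h' : CongrMod a n F' G') (hG : AnalyticAt ℂ G a)
    (hF' : AnalyticAt ℂ F' a) : CongrMod a n (fun x => F x * F' x) (fun x => G x * G' x) := by
  obtain ⟨k, hk, e⟩ := h
  obtain ⟨k', hk', e'⟩ := h'
  refine ⟨fun x => k x * F' x + G x * k' x, (hk.fun_mul hF').fun_add (hG.fun_mul hk'), ?_⟩
  filter_upwards [e, e'] with x hx hx'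
  rw [hx, hx']
  ring

theorem inv (h : CongrMod a n F G) (hF : AnalyticAt ℂ F a) (hG : AnalyticAt ℂ G a)
    (hF0 : F a ≠ 0) (hG0 : G a ≠ 0) : CongrMod a n (fun x => (F x)⁻¹) (fun x => (G x)⁻¹) := by
  obtain ⟨k, hk, e⟩ := h
  refine ⟨fun x => -(k x * ((F x)⁻¹ * (G x)⁻¹)),
    (hk.fun_mul ((hF.fun_inv hF0).fun_mul (hG.fun_inv hG0))).fun_neg, ?_⟩
  filter_upwards [e, hF.continuousAt.eventually_ne hF0, hG.continuousAt.eventually_ne hG0]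
    with x hx h1 h2
  have h3 : G x = F x - (x - a) ^ n * k x := by rw [hx]; ring
  field_simp
  rw [h3]
  ring

theorem const (c : ℂ) : CongrMod a n (fun _ => c) (fun _ => c) :=
  of_eventuallyEq (Eventually.of_forall fun _ => rfl)

theorem eval (h : CongrMod a n F G) (hF : AnalyticAt ℂ F a) (hG : AnalyticAt ℂ G a) (p : ℂ[X]) :
    CongrMod a n (fun x => p.eval (F x)) (fun x => p.eval (G x)) := by
  have hp : ∀ (q : ℂ[X]) {H : ℂ → ℂ}, AnalyticAt ℂ H a → AnalyticAt ℂ (fun x => q.eval (H x)) a :=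
    fun q H hH => by simpa using hH.aeval_polynomial q
  induction p using Polynomial.induction_on' with
  | add p q hp hq => simpa only [eval_add] using hp.add hq
  | monomial k c =>
    induction k with
    | zero => simpa using const c
    | succ k ih =>
      simp only [eval_monomial, pow_succ, ← mul_assoc] at ih ⊢
      refine ih.mul h ?_ hF
      simpa using hp (monomial k c) hG

theorem trans {H : ℂ → ℂ} (h : CongrMod a n F G) (h' : CongrMod a n G H) : CongrMod a n F H := by
  obtain ⟨k, hk, e⟩ := h
  obtain ⟨k', hk', e'⟩ := h'
  refine ⟨fun x => k x + k' x, hk.fun_add hk', ?_⟩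
  filter_upwards [e, e'] with x hx hx'
  rw [hx, hx']
  ring

end CongrMod

theorem deriv_add_pow {φ : ℂ → ℂ} {a : ℂ} (hφ : AnalyticAt ℂ φ a) (c : ℂ) (n : ℕ) :
    deriv (fun x => φ x + c * (x - a) ^ (n + 1)) =ᶠ[𝓝 a]
      fun x => deriv φ x + c * (n + 1) * (x - a) ^ n := by
  filter_upwards [hφ.eventually_analyticAt] with x hx
  have h1 : HasDerivAt (fun x : ℂ => x - a) 1 x := (hasDerivAt_id x).sub_const a
  have := hx.differentiableAt.hasDerivAt.fun_add ((h1.fun_pow (n + 1)).const_mul c)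
  rw [this.deriv]
  push_cast
  ring

section SchwarzJet

variable (ν : RatFunc ℂ) {φ ψ : ℂ → ℂ} {a : ℂ}

theorem schwarzEq_eq (φ : ℂ → ℂ) : schwarzEq ν φ = fun x =>
    ν.num.eval (φ x) * (ν.denom.eval (φ x))⁻¹ * (deriv φ x * deriv φ x)
      + 2 * (deriv (deriv (deriv φ)) x * (deriv φ x)⁻¹)
      + (-3) * ((deriv (deriv φ) x * (deriv φ x)⁻¹) * (deriv (deriv φ) x * (deriv φ x)⁻¹))
      + -(ν.num.eval x * (ν.denom.eval x)⁻¹) := by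
  funext x
  simp only [schwarzEq, RatFunc.eval, iteratedDeriv_succ, iteratedDeriv_zero,
    eval₂_id, div_eq_mul_inv]
  ring

theorem analyticAt_eval (p : ℂ[X]) (hφ : AnalyticAt ℂ φ a) :
    AnalyticAt ℂ (fun x => p.eval (φ x)) a := by
  simpa using hφ.aeval_polynomial p

theorem analyticAt_schwarzEq (hφ : AnalyticAt ℂ φ a) (hd : deriv φ a ≠ 0)
    (h : ν.denom.eval (φ a) ≠ 0) (h' : ν.denom.eval a ≠ 0) :
    AnalyticAt ℂ (schwarzEq ν φ) a := by
  rw [schwarzEq_eq]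
  have h1 := hφ.deriv.fun_inv hd
  have h2 := hφ.deriv.deriv.fun_mul h1
  exact (((((analyticAt_eval _ hφ).fun_mul ((analyticAt_eval _ hφ).fun_inv h)).fun_mul
    (hφ.deriv.fun_mul hφ.deriv)).fun_add
    (analyticAt_const.fun_mul (hφ.deriv.deriv.deriv.fun_mul h1))).fun_add
    (analyticAt_const.fun_mul (h2.fun_mul h2))).fun_add
    ((analyticAt_eval _ analyticAt_id).fun_mul ((analyticAt_eval _ analyticAt_id).fun_inv h')).fun_neg

/-- Adding a term of order `m + 3` changes the equation at order `m`. -/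
theorem schwarzEq_add_pow (hφ : AnalyticAt ℂ φ a) (hd : deriv φ a ≠ 0)
    (h : ν.denom.eval (φ a) ≠ 0) (c : ℂ) (m : ℕ) :
    CongrMod a (m + 1) (schwarzEq ν fun x => φ x + c * (x - a) ^ (m + 3)) (fun x =>
      schwarzEq ν φ x + (x - a) ^ m * (2 * (c * ((m + 3) * (m + 2) * (m + 1))) * (deriv φ x)⁻¹)) := by
  set ψ := fun x => φ x + c * (x - a) ^ (m + 3) with hψdef
  have e1 := deriv_add_pow hφ c (m + 2)
  have e2 := e1.deriv.trans (deriv_add_pow hφ.deriv _ (m + 1))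
  have e3 := e2.deriv.trans (deriv_add_pow hφ.deriv.deriv _ m)
  have hp : ∀ k : ℕ, AnalyticAt ℂ (fun x => (x - a) ^ k) a := fun k =>
    (analyticAt_id.fun_sub analyticAt_const).fun_pow k
  have hψ : AnalyticAt ℂ ψ a := hφ.fun_add (analyticAt_const.fun_mul (hp _))
  have hψa : ψ a = φ a := by simp [hψdef]
  have hψd : deriv ψ a = deriv φ a := by simpa using e1.self_of_nhds
  have c0 : CongrMod a (m + 1) ψ φ := ⟨fun x => c * (x - a) ^ 2,
    analyticAt_const.fun_mul (hp 2), Eventually.of_forall fun x => by simp only [hψdef]; ring⟩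
  have c1 : CongrMod a (m + 1) (deriv ψ) (deriv φ) := ⟨_,
    (analyticAt_const (v := c * ((m + 2 : ℕ) + 1))).fun_mul (hp 1), e1.mono fun x hx => by
      rw [hx]; ring⟩
  have c2 : CongrMod a (m + 1) (deriv (deriv ψ)) (deriv (deriv φ)) := ⟨_,
    analyticAt_const (v := c * ((m + 2 : ℕ) + 1) * ((m + 1 : ℕ) + 1)), e2.mono fun x hx => by
      rw [hx]; ring⟩
  have c3 : CongrMod a (m + 1) (deriv (deriv (deriv ψ))) (fun x => deriv (deriv (deriv φ)) x +
      c * ((m + 2 : ℕ) + 1) * ((m + 1 : ℕ) + 1) * (m + 1) * (x - a) ^ m) :=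
    CongrMod.of_eventuallyEq e3
  have ci := c1.inv hψ.deriv hφ.deriv (by rwa [hψd]) hd
  have h1 := hφ.deriv.fun_inv hd
  have h1' := hψ.deriv.fun_inv (hψd ▸ hd)
  have cq := c2.mul ci hφ.deriv.deriv h1'
  have cn := (c0.eval hψ hφ ν.num).mul ((c0.eval hψ hφ ν.denom).inv (analyticAt_eval _ hψ)
    (analyticAt_eval _ hφ) (by rwa [hψa]) h) (analyticAt_eval _ hφ)
    ((analyticAt_eval _ hψ).fun_inv (by rwa [hψa]))
  have hq := hφ.deriv.deriv.fun_mul h1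
  have hq' := hψ.deriv.deriv.fun_mul h1'
  rw [schwarzEq_eq ν ψ]
  refine ((((cn.mul (c1.mul c1 hφ.deriv hψ.deriv) ((analyticAt_eval _ hφ).fun_mul
    ((analyticAt_eval _ hφ).fun_inv h)) (hψ.deriv.fun_mul hψ.deriv)).add
    ((CongrMod.const 2).mul (c3.mul ci (hφ.deriv.deriv.deriv.fun_add
      (analyticAt_const.fun_mul (hp m))) h1') analyticAt_const
      (hψ.deriv.deriv.deriv.fun_mul h1'))).add
    ((CongrMod.const (-3)).mul (cq.mul cq hq hq') analyticAt_const (hq'.fun_mul hq'))).add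
    (CongrMod.of_eventuallyEq (EventuallyEq.refl _ _))).trans
    (CongrMod.of_eventuallyEq (Eventually.of_forall fun x => ?_))
  rw [schwarzEq_eq ν φ]
  push_cast
  ring

/-- The equation contains `y₃` with the nonzero coefficient `2 / y₁`, so its Taylor coefficients can
be killed one after the other by adjusting the derivatives of order at least three. The jet of order
two stays free; it is chosen so as to violate every equation `μ(y) y₁² + y₂ = μ(x) y₁` regular at
`a`. -/
theorem exists_schwarzEq_flat (h : ν.denom.eval a ≠ 0) (N : ℕ) : ∃ φ : ℂ → ℂ,
    AnalyticAt ℂ φ a ∧ φ a = a ∧ deriv φ a = 1 ∧ deriv (deriv φ) a = 1 ∧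
      CongrMod a N (schwarzEq ν φ) (fun _ => 0) := by
  induction N with
  | zero =>
    -- The initial map is `x + (x - a)² / 2`, which has the prescribed jet of order two; to order
    -- zero only analyticity of the equation is required.
    have e1 := deriv_add_pow (analyticAt_id (𝕜 := ℂ) (z := a)) (1 / 2) 1
    have hid : deriv (id : ℂ → ℂ) = fun _ => 1 := by funext x; exact deriv_id x
    have e2 := e1.deriv.trans (deriv_add_pow analyticAt_id.deriv _ 0)
    have hφ : AnalyticAt ℂ (fun x => id x + 1 / 2 * (x - a) ^ (1 + 1)) a :=
      analyticAt_id.fun_add (analyticAt_const.fun_mul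
        ((analyticAt_id.fun_sub analyticAt_const).fun_pow _))
    have hd : deriv (fun x => id x + 1 / 2 * (x - a) ^ (1 + 1)) a = 1 := by
      simpa [hid] using e1.self_of_nhds
    refine ⟨_, hφ, by simp, hd, ?_, schwarzEq ν _,
      analyticAt_schwarzEq ν hφ (by rw [hd]; exact one_ne_zero) (by simpa using h) h,
      Eventually.of_forall fun x => by simp⟩
    have := e2.self_of_nhds
    rw [this, hid]
    norm_num
  | succ m ih =>
    obtain ⟨φ, hφ, h0, h1, h2, g, hg, e⟩ := ih
    have hK : (2 * ((m + 3) * (m + 2) * (m + 1)) : ℂ) ≠ 0 := by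
      have : ((2 * ((m + 3) * (m + 2) * (m + 1)) : ℕ) : ℂ) ≠ 0 := Nat.cast_ne_zero.2 (by positivity)
      exact_mod_cast this
    -- By `schwarzEq_add_pow` the coefficient of order `m` changes from `g a` to `g a + 2 c (m + 3)
    -- (m + 2) (m + 1) / φ'(a)`, with `φ'(a) = 1`.
    set c := -g a / (2 * ((m + 3) * (m + 2) * (m + 1)) : ℂ) with hc
    have hd : deriv φ a ≠ 0 := h1 ▸ one_ne_zero
    have e1 := deriv_add_pow hφ c (m + 2)
    have e2 := e1.deriv.trans (deriv_add_pow hφ.deriv _ (m + 1))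
    refine ⟨fun x => φ x + c * (x - a) ^ (m + 3), hφ.fun_add (analyticAt_const.fun_mul
        ((analyticAt_id.fun_sub analyticAt_const).fun_pow _)), by simpa using h0,
      by simpa [h1] using e1.self_of_nhds, by simpa [h2] using e2.self_of_nhds,
      (schwarzEq_add_pow ν hφ hd (by rwa [h0]) c m).trans ?_⟩
    have hk : AnalyticAt ℂ (fun x => g x +
        2 * (c * ((m + 3) * (m + 2) * (m + 1))) * (deriv φ x)⁻¹) a :=
      hg.fun_add (analyticAt_const.fun_mul (hφ.deriv.fun_inv hd))
    have hk0 : g a + 2 * (c * ((m + 3) * (m + 2) * (m + 1))) * (deriv φ a)⁻¹ = 0 := by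
      have : 2 * (c * ((m + 3) * (m + 2) * (m + 1))) = -g a := by
        rw [mul_left_comm, hc, div_mul_cancel₀ _ hK]
      rw [this, h1]
      ring
    obtain ⟨k, hka, ek⟩ := (natCast_le_analyticOrderAt hk (n := 1)).1
      (by simpa [Order.one_le_iff_pos, pos_iff_ne_zero, hk.analyticOrderAt_ne_zero] using hk0)
    refine ⟨k, hka, ?_⟩
    filter_upwards [e, ek] with x hx hx'
    simp only [smul_eq_mul] at hx'
    rw [hx, zero_add, zero_add, ← mul_add, hx']
    ring

theorem CongrMod.iteratedDeriv_eq_zero {F : ℂ → ℂ} {N m : ℕ} (h : CongrMod a N F fun _ => 0)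
    (hm : m < N) : iteratedDeriv m F a = 0 := by
  obtain ⟨k, hk, e⟩ := h
  have hF : AnalyticAt ℂ F a := by
    have h1 : AnalyticAt ℂ (fun x => 0 + (x - a) ^ N * k x) a := analyticAt_const.fun_add
      (((analyticAt_id.fun_sub analyticAt_const).fun_pow N).fun_mul hk)
    exact h1.congr (EventuallyEq.symm e)
  have := (natCast_le_analyticOrderAt hF (n := N)).2 ⟨k, hk, by simpa using e⟩
  exact (natCast_le_analyticOrderAt_iff_iteratedDeriv_eq_zero hF).1 this m hm

end SchwarzJet

/-- The formula holds at the poles as well: the coordinate of infinity and the quotient by zero both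
have the default value `0`. -/
theorem inCharts_ratMap (R : RatFunc ℂ) : inCharts .affine .affine (ratMap R) =
    fun z => R.num.eval z / R.denom.eval z := by
  funext z
  simp only [inCharts, Chart.par, Chart.coord, ratMap, OnePoint.elim_some]
  split_ifs with h
  · simp [h]
  · rfl

theorem ratMap_coe (R : RatFunc ℂ) {z : ℂ} (h : R.denom.eval z ≠ 0) :
    ratMap R (z : P1) = ((R.num.eval z / R.denom.eval z : ℂ) : P1) := by
  simp only [ratMap, OnePoint.elim_some, if_neg h]

theorem IsNonzeroGerm.eventually_ne_zero {s : P1 → ℂ} {a : P1} (h : IsNonzeroGerm s a) :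
    ∀ᶠ b in 𝓝[≠] a, s b ≠ 0 := by
  obtain ⟨i, hi, h1, h2⟩ := h
  rcases h1.eventually_eq_zero_or_eventually_ne_zero with h3 | h3
  · refine absurd ?_ h2
    filter_upwards [(i.continuousAt_coord hi).eventually h3, i.isOpen_dom.mem_nhds hi] with b hb hbi
    rwa [i.par_coord hbi] at hb
  · rw [eventually_nhdsWithin_iff] at h3 ⊢
    filter_upwards [(i.continuousAt_coord hi).eventually h3, i.isOpen_dom.mem_nhds hi]
      with b hb hbi hba
    have := hb fun h0 => hba (by
      have := congrArg i.par h0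
      rwa [i.par_coord hbi, i.par_coord hi] at this)
    rwa [i.par_coord hbi] at this

theorem IsLocalBihol.tendsto_nhdsNE {f : P1 → P1} {a : P1} (h : IsLocalBihol f a) :
    Tendsto f (𝓝[≠] a) (𝓝[≠] (f a)) :=
  tendsto_nhdsWithin_iff.2 ⟨h.continuousAt.tendsto.mono_left nhdsWithin_le_nhds,
    h.eventually_ne (f a)⟩

theorem eventually_notMem_of_finite {T : Set P1} (hT : T.Finite) (a : P1) :
    ∀ᶠ b in 𝓝[≠] a, b ∉ T := by
  have h1 : (T \ {a})ᶜ ∈ 𝓝 a := hT.sdiff.isClosed.isOpen_compl.mem_nhds (by simp)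
  rw [eventually_nhdsWithin_iff]
  filter_upwards [h1] with b hb hba h
  exact hb ⟨h, hba⟩

theorem tendsto_coe_nhdsNE (x : ℂ) : Tendsto ((↑) : ℂ → P1) (𝓝[≠] x) (𝓝[≠] (x : P1)) := by
  refine tendsto_nhdsWithin_iff.2 ⟨(OnePoint.continuous_coe.tendsto x).mono_left
    nhdsWithin_le_nhds, ?_⟩
  filter_upwards [self_mem_nhdsWithin] with y hy h
  exact hy (OnePoint.coe_injective h)

theorem eventually_eval_div_ne_zero {P Q B : ℂ[X]} (hQ : Q ≠ 0) (hcop : IsCoprime P Q)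
    (hd : 1 ≤ max P.natDegree Q.natDegree) (hB : B ≠ 0) :
    ∀ᶠ x in cofinite, B.eval (P.eval x / Q.eval x) ≠ 0 := by
  have h1 : ∀ᶠ x in cofinite, ∀ b ∈ B.roots.toFinset, (P - C b * Q).eval x ≠ 0 :=
    (Finset.eventually_all _).2 fun b _ => eventually_eval_ne_zero (numAt_ne_zero hcop hd (b : P1))
  filter_upwards [h1, eventually_eval_ne_zero hQ] with x hx hxQ h0
  refine hx _ (by simpa using ⟨hB, h0⟩ : P.eval x / Q.eval x ∈ _) ?_
  simp only [eval_sub, eval_mul, eval_C]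
  field_simp
  ring

/-! ### Rational maps that are solutions of a groupoid of type (3) -/

section TypeThree

variable {R ν : RatFunc ℂ} {I : IdealSheaf}

theorem isLocalBihol_ratMap {x : ℂ} (hx : R.denom.eval x ≠ 0)
    (hw : (wron R.num R.denom).eval x ≠ 0) : IsLocalBihol (ratMap R) (x : P1) := by
  refine ⟨.affine, .affine, OnePoint.coe_ne_infty x, ?_, ?_, ?_⟩
  · rw [ratMap_coe R hx]
    exact OnePoint.coe_ne_infty _
  · rw [inCharts_ratMap]
    exact (R.num.differentiable.analyticAt _).fun_div (R.denom.differentiable.analyticAt _) hx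
  · rw [inCharts_ratMap]
    change deriv _ x ≠ 0
    rw [deriv_div_eval hx]
    exact div_ne_zero hw (pow_ne_zero _ hx)

/-- Near a generic point, the equation of type (3) times a denominator `s(x) t(y)` is an equation of
the ideal, so it vanishes on the jets of `R`. The denominator is nonzero at the other nearby points,
and the identity theorem extends the vanishing to all but finitely many points. -/
theorem isInvariantBy_of_isTypeThree (hd : 1 ≤ max R.num.natDegree R.denom.natDegree)
    (hR : IsSolution (ratMap R) I) (h : IsTypeThree I ν) :
    IsInvariantBy R.num R.denom ν.num ν.denom := by
  have hcop := R.isCoprime_num_denom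
  have hgood := (((eventually_eval_ne_zero R.denom_ne_zero).and (eventually_eval_ne_zero
    (wron_ne_zero R.denom_ne_zero hcop hd))).and (eventually_eval_ne_zero ν.denom_ne_zero)).and
    (eventually_eval_div_ne_zero R.denom_ne_zero hcop hd ν.denom_ne_zero)
  set φ : ℂ → ℂ := fun y => R.num.eval y / R.denom.eval y with hφ
  set T := {x : ℂ | ((R.denom.eval x ≠ 0 ∧ (wron R.num R.denom).eval x ≠ 0) ∧
    ν.denom.eval x ≠ 0) ∧ ν.denom.eval (φ x) ≠ 0}ᶜ with hT
  have hTf : T.Finite := eventually_cofinite.1 hgood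
  -- The plane minus a finite set is connected, as the identity theorem requires.
  have hpre : IsPreconnected Tᶜ := (hTf.countable.isConnected_compl_of_one_lt_rank
    (by rw [Complex.rank_real_complex]; exact Nat.one_lt_ofNat)).isPreconnected
  have hmem : ∀ {x}, x ∈ Tᶜ ↔ ((R.denom.eval x ≠ 0 ∧ (wron R.num R.denom).eval x ≠ 0) ∧
    ν.denom.eval x ≠ 0) ∧ ν.denom.eval (φ x) ≠ 0 := fun {x} => by rw [hT, compl_compl]; rfl
  have hTo : IsOpen Tᶜ := hTf.isClosed.isOpen_compl
  obtain ⟨x₀, hx₀⟩ := hgood.exists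
  have hx₀T : x₀ ∈ Tᶜ := hmem.2 hx₀
  have hbi : ∀ x ∈ Tᶜ, IsLocalBihol (ratMap R) (x : P1) := fun x hx =>
    isLocalBihol_ratMap (hmem.1 hx).1.1.1 (hmem.1 hx).1.1.2
  have han : AnalyticOnNhd ℂ (schwarzEq ν φ) Tᶜ := fun x hx => by
    obtain ⟨⟨⟨h1, h2⟩, h3⟩, h4⟩ := hmem.1 hx
    refine analyticAt_schwarzEq ν ((R.num.differentiable.analyticAt _).fun_div
      (R.denom.differentiable.analyticAt _) h1) ?_ h4 h3
    rw [deriv_div_eval h1]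
    exact div_ne_zero h2 (pow_ne_zero _ h1)
  have hloc : ∀ᶠ x in 𝓝[≠] x₀, schwarzEq ν φ x = 0 := by
    obtain ⟨s, t, hs, ht, V, hpV, F, hF, hFe⟩ := (h ((x₀ : P1), ratMap R x₀)).2 0
    have hb := hbi x₀ hx₀T
    have e1 := (tendsto_coe_nhdsNE x₀).eventually hs.eventually_ne_zero
    have e2 := (tendsto_coe_nhdsNE x₀).eventually (hb.tendsto_nhdsNE.eventually
      ht.eventually_ne_zero)
    have e3 : ∀ᶠ x : ℂ in 𝓝[≠] x₀, ((x : P1), ratMap R x) ∈ V :=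
      nhdsWithin_le_nhds ((hb.tendsto_graph (i := .affine) (OnePoint.coe_ne_infty x₀)).eventually
        (V.isOpen.mem_nhds hpV))
    filter_upwards [e1, e2, e3, nhdsWithin_le_nhds (hTo.mem_nhds hx₀T)] with x h1 h2 h3 h4
    have hg := hmem.1 h4
    have := hFe (ratMap R) x (hbi x h4) h3 ⟨x, rfl, hg.1.2⟩
      ⟨φ x, ratMap_coe R hg.1.1.1, hg.2⟩
    rw [hR V F hF x (hbi x h4) h3] at this
    have := (mul_eq_zero.1 this.symm).resolve_left (mul_ne_zero h1 h2)
    rw [schwarzDeriv, iteratedDeriv_zero, inCharts_ratMap] at this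
    exact this
  have hzero := han.eqOn_zero_of_preconnected_of_frequently_eq_zero hpre hx₀T hloc.frequently
  filter_upwards [hgood] with x hx
  have := hzero (hmem.2 hx)
  rw [Pi.zero_apply, schwarzEq_div_eval ν hx.1.1.1 hx.1.1.2] at this
  simp only [RatFunc.eval, eval₂_id] at this
  rw [schwarzTerm]
  linear_combination this

theorem exists_connection (hR : IsSolution (ratMap R) I) (h : IsTypeThree I ν) :
    ∃ D : AffineData, ∀ᶠ x in cofinite, ConnEq (D.mu .affine) (D.mu .affine)
      (fun y => R.num.eval y / R.denom.eval y) x := by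
  have hcop := R.isCoprime_num_denom
  rcases Nat.eq_zero_or_pos (max R.num.natDegree R.denom.natDegree) with h0 | h0
  -- A constant map has zero derivatives and satisfies the equation of any affine structure.
  · refine ⟨⟨0, 1, one_ne_zero⟩, Eventually.of_forall fun x => ?_⟩
    rw [eq_C_of_natDegree_eq_zero (p := R.num) (by omega),
      eq_C_of_natDegree_eq_zero (p := R.denom) (by omega)]
    simp [ConnEq]
  · rcases Nat.lt_or_ge 1 (max R.num.natDegree R.denom.natDegree) with h1 | h1
    · exact exists_connection_of_two_le R.denom_ne_zero hcop h0 h1 ν.denom_ne_zero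
        (isInvariantBy_of_isTypeThree h0 hR h)
    · exact exists_connection_of_le_one R.denom_ne_zero hcop h0 h1

theorem eventually_sol_ratMap {D : AffineData} (h : ∀ᶠ x in cofinite,
    ConnEq (D.mu .affine) (D.mu .affine) (fun y => R.num.eval y / R.denom.eval y) x) {a : P1}
    (ha : IsLocalBihol (ratMap R) a) : ∀ᶠ b in 𝓝[≠] a, D.Sol (ratMap R) b := by
  have hT := ((eventually_cofinite.1 h).image ((↑) : ℂ → P1)).insert OnePoint.infty
  filter_upwards [AffineData.eventually_reg (D := D) a,
    ha.tendsto_nhdsNE.eventually (AffineData.eventually_reg (D := D) _),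
    nhdsWithin_le_nhds ha.eventually, eventually_notMem_of_finite hT a] with b h1 h2 h3 h4
  refine AffineData.sol_of_connEq (i := .affine) (j := .affine) h1 h2 h3 ?_
  filter_upwards [hT.isClosed.isOpen_compl.mem_nhds h4] with c hc
  rw [inCharts_ratMap]
  induction c using OnePoint.rec with
  | infty => exact absurd (Set.mem_insert _ _) hc
  | coe x =>
    by_contra hx
    exact hc (Set.mem_insert_of_mem _ ⟨x, hx, rfl⟩)

end TypeThree

/-! ### The equation of order two, and the contradiction -/

namespace AffineData

variable (D : AffineData)

/-- The function of jets `μ(y) y₁² + y₂ - μ(x) y₁`. -/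
def connFun (f : P1 → P1) (a : P1) : ℂ :=
  D.mu .affine (Chart.affine.coord (f a)) * jetCoord .affine .affine f a 1 ^ 2 +
    jetCoord .affine .affine f a 2 +
      -(D.mu .affine (Chart.affine.coord a) * jetCoord .affine .affine f a 1)

theorem analyticAt_mu_affine {z : ℂ} (h : D.den.eval z ≠ 0) : AnalyticAt ℂ (D.mu .affine) z :=
  (D.num.differentiable.analyticAt _).fun_div (D.den.differentiable.analyticAt _) h

theorem hasJetExpr_connFun {p : P1 × P1} (hp : p ∈ D.regOpens) :
    HasJetExpr 2 .affine .affine p D.connFun := by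
  obtain ⟨⟨x, -, hx, h1⟩, ⟨y, -, hy, h2⟩⟩ := hp
  have c1 : HasJetExpr 2 .affine .affine p (fun f a => D.mu .affine (Chart.affine.coord a)) :=
    HasJetExpr.coeff (c := fun w => D.mu .affine w.1)
      (AnalyticAt.fun_comp (g := D.mu .affine) (by rw [h1]; exact D.analyticAt_mu_affine hx)
        analyticAt_fst)
  have c2 : HasJetExpr 2 .affine .affine p (fun f a => D.mu .affine (Chart.affine.coord (f a))) :=
    HasJetExpr.coeff (c := fun w => D.mu .affine w.2)
      (AnalyticAt.fun_comp (g := D.mu .affine) (by rw [h2]; exact D.analyticAt_mu_affine hy)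
        analyticAt_snd)
  have j1 : HasJetExpr 2 .affine .affine p (fun f a => jetCoord .affine .affine f a 1) :=
    HasJetExpr.jet (by norm_num) (by norm_num)
  have j2 : HasJetExpr 2 .affine .affine p (fun f a => jetCoord .affine .affine f a 2) :=
    HasJetExpr.jet le_rfl (by norm_num)
  have q := c2.mul (j1.mul j1 fun _ _ => rfl) (fun _ _ => rfl)
  have r := (HasJetExpr.const (-1)).mul (c1.mul j1 fun _ _ => rfl) (fun _ _ => rfl)
  refine ((q.add j2 fun _ _ => rfl).add r fun _ _ => rfl).congr
    (Eventually.of_forall fun _ f a _ _ => ?_)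
  simp only [connFun]
  ring

/-- The equation of the maps which preserve the affine structure. -/
def connEquation : DiffEq D.regOpens :=
  ⟨ofGermFun D.regOpens D.connFun, (isOfOrder_ofGermFun (k := 2) fun _ hp =>
    ⟨.affine, .affine, (D.mem_regOpens.1 hp).1.mem_dom _, (D.mem_regOpens.1 hp).2.mem_dom _, D.hasJetExpr_connFun hp⟩).isDiffEq⟩

theorem connEquation_mem : D.connEquation ∈ D.idealSheaf.sections D.regOpens := by
  rw [mem_idealSheaf]
  intro f a hf hW
  refine (valueAt_ofGermFun (E := D.connFun) hf.2.2.1 hW).trans ?_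
  have h := hf.connEq .affine .affine
  rw [ConnEq, inCharts_par _ _ _ (hf.1.mem_dom _)] at h
  simp only [connFun, jetCoord, iteratedDeriv_succ, iteratedDeriv_zero]
  linear_combination h

end AffineData

/-- Up to a denominator, the equation of order two would be a combination of derivatives of the
equation of type (3), of order less than some `N`. A germ on which all of these vanish, but with a
jet of order two violating the affine structure, contradicts this. -/
theorem not_isTypeThree_of_le {D : AffineData} {I : IdealSheaf}
    (hI : ∀ W, D.idealSheaf.sections W ≤ I.sections W) (ν : RatFunc ℂ) : ¬ IsTypeThree I ν := by
  intro h
  obtain ⟨z, hz, hzD⟩ := ((eventually_eval_ne_zero ν.denom_ne_zero).and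
    ((eventually_eval_ne_zero D.den_ne_zero).and
      (eventually_eval_ne_zero (X_ne_zero (R := ℂ))))).exists
  have hreg : D.Reg (z : P1) := ⟨z, by simpa using hzD.2, hzD.1, rfl⟩
  obtain ⟨s, t, hs, ht, V, hpV, hVW, N, A, hA⟩ := (h ((z : P1), (z : P1))).1 D.regOpens
    ⟨hreg, hreg⟩ D.connEquation (hI _ D.connEquation_mem)
  have e3 : ∀ᶠ x : ℂ in 𝓝[≠] z, ((x : P1), (x : P1)) ∈ V :=
    (tendsto_coe_nhdsNE z).eventually (nhdsWithin_le_nhds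
      ((continuous_id.prodMk continuous_id).continuousAt.eventually (V.isOpen.mem_nhds hpV)))
  -- The base point is moved from `z` to a nearby `a` where the denominators `s` and `t` do not
  -- vanish; the test germ will fix `a`, so both are evaluated there.
  obtain ⟨a, ⟨h1, h2⟩, h3, h4⟩ := ((((tendsto_coe_nhdsNE z).eventually hs.eventually_ne_zero).and
    ((tendsto_coe_nhdsNE z).eventually ht.eventually_ne_zero)).and (e3.and
      (nhdsWithin_le_nhds (eventually_nhds_eval_ne_zero hz)))).exists
  obtain ⟨φ, hφ, hφ0, hφ1, hφ2, hflat⟩ := exists_schwarzEq_flat ν h4 N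
  set f := ofCharts .affine .affine φ with hf
  have hfa : f (a : P1) = a := by
    change ((φ a : ℂ) : P1) = a
    rw [hφ0]
  have hfb : IsLocalBihol f (a : P1) := isLocalBihol_ofCharts (OnePoint.coe_ne_infty a) hφ
    (by change deriv φ a ≠ 0; rw [hφ1]; exact one_ne_zero)
  have hfV : ((a : P1), f a) ∈ V := by rwa [hfa]
  have key := hA f a hfb hfV ⟨a, rfl, h4⟩ ⟨a, hfa, h4⟩
  rw [Finset.sum_eq_zero fun m _ => by
    rw [schwarzDeriv, hf, inCharts_ofCharts]
    exact mul_eq_zero_of_right _ (hflat.iteratedDeriv_eq_zero m.2)] at key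
  -- With `φ(a) = a` and `φ'(a) = 1` the two terms in `μ` cancel, leaving `φ''(a) = 1`.
  have hval : valueAt D.connEquation.1 f a = 1 := by
    refine (valueAt_ofGermFun (E := D.connFun) hfb (hVW hfV)).trans ?_
    rw [AffineData.connFun, hfa]
    simp only [jetCoord, iteratedDeriv_succ, iteratedDeriv_zero, hf, inCharts_ofCharts]
    change D.mu .affine a * deriv φ a ^ 2 + deriv (deriv φ) a + -(D.mu .affine a * deriv φ a) = 1
    rw [hφ1, hφ2]
    ring
  rw [hval, hfa] at key
  exact mul_ne_zero (mul_ne_zero h1 h2) one_ne_zero key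

end JetP1

end

theorem mainTheorem3 (R : RatFunc ℂ) :
    ¬ ∃ (I : JetP1.IdealSheaf) (ν : RatFunc ℂ),
      JetP1.IsDEnvelope (JetP1.ratMap R) I ∧ JetP1.IsTypeThree I ν := by
  rintro ⟨I, ν, ⟨-, hsol, hmax⟩, hthree⟩
  obtain ⟨D, hD⟩ := JetP1.exists_connection hsol hthree
  exact JetP1.not_isTypeThree_of_le (hmax _ D.isDGroupoid_idealSheaf
    (JetP1.AffineData.isSolution_idealSheaf fun _ ha => JetP1.eventually_sol_ratMap hD ha)) ν hthree
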